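/- **Theorem (Trace formula II).** Let $N^{n+k}$ be a compact connected semi-simple Riemannian symmetric space: a compact connected Riemannian manifold such that every $p\in N$ is an isolated fixed point of some involutive isometry $s_p$ of $N$, and such that the Lie algebra $\mathfrak g$ of the isometry group of $N$ is semi-simple. For $X\in\mathfrak g$ let $X^\dagger$ denote the Killing field $X^\dagger(q)=\frac{d}{dt}\exp(tX)q|_{t=0}$, so that $[X,Y]^\dagger=-[X^\dagger,Y^\dagger]$. Let $\mathbf B$ be the Killing form of $\mathfrak g$, put $\langle X,Y\rangle_{\mathfrak g}=-\mathbf B(X,Y)$, and assume that $N$ carries the canonical metric, i.e. for every $p$ the canonical map $\mathfrak n_p\to T_pN$, $X\mapsto X^\dagger(p)$, is an isometric isomorphism, where $\mathfrak n_p=\{X\in\mathfrak g : (s_p)_*X^\dagger=-X^\dagger\}$ has the inner product $\langle\,,\rangle_{\mathfrak g}$. Equip $\wedge^2\mathfrak g$ with $\langle X\wedge Y,Z\wedge W\rangle=\langle X,Z\rangle_{\mathfrak g}\langle Y,W\rangle_{\mathfrak g}-\langle X,W\rangle_{\mathfrak g}\langle Y,Z\rangle_{\mathfrak g}$. Let $(M^n,g)$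 be a Riemannian manifold, $F:M\to N$ an isometric immersion with second fundamental form $B$, and $f:\Sigma^{n-1}\to M$ a minimal isometric immersion of a closed manifold with a smooth unit normal field $\nu$ (i.e. with trivial normal bundle) and second fundamental form $A$. Tangent vectors of $\Sigma$ and $M$ are identified with their images under $df$ and $dF$. The index form of $f$ on normal fields $V,W$ is $$Q(V,W)=\int_\Sigma\langle\nabla^\perp V,\nabla^\perp W\rangle-\mathrm{Ric}^M(V,W)-|A|^2\langle V,W\rangle\,d\mu_\Sigma .$$ For a tangent vector field $T$ of $\Sigma$ and $v\in\wedge^2\mathfrak g$ put $\varphi_{T,v}=\langle\nu\wedge T,\Pi(v)\rangle$, where $\Pi:\wedge^2\mathfrak g\to\Gamma(\wedge^2TN)$ is the linear map with $\Pi(X\wedge Y)=X^\dagger\wedge Y^\dagger$, and let $q_T(v,w)=Q(\varphi_{T,v}\nu,\varphi_{T,w}\nu)$. Let $\omega$ be a harmonic $1$-form on $\Sigma$ ($\Delta_1\omega=(d\delta+\delta d)\omega=0$), with metric dual $\omega^\sharp$. Let $\mathrm{Tr}_{\wedge^2\mathfrak g}\,q_{\omega^\sharp}=\sum_a q_{\omega^\sharp}(v_a,v_a)$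 for any orthonormal basis $(v_a)$ of $\wedge^2\mathfrak g$. Then $$\begin{aligned}\mathrm{Tr}_{\wedge^2\mathfrak g}\,q_{\omega^\sharp}=\int_\Sigma&\sum_{\mu=1}^{n-1}\Big(|B(e_\mu,\omega^\sharp)|^2+|B(e_\mu,\nu)|^2|\omega|^2\Big)-\Big(\sum_{\mu=1}^{n-1}\langle R^M(\omega^\sharp,e_\mu)e_\mu,\omega^\sharp\rangle+\mathrm{Ric}^M(\nu,\nu)|\omega|^2\Big)\\&+\sum_{\mu=1}^{n-1}\Big(\langle\overline R(\omega^\sharp,e_\mu)e_\mu,\omega^\sharp\rangle+\langle\overline R(\nu,e_\mu)e_\mu,\nu\rangle|\omega|^2\Big)\,d\mu_\Sigma ,\end{aligned}$$ where $(e_\mu)$ is any orthonormal basis of $T_p\Sigma$ at each $p\in\Sigma$, and $R^M$, $\overline R$ are the curvature tensors of $M$ and $N$, $R(X,Y)Z=\nabla_X\nabla_YZ-\nabla_Y\nabla_XZ-\nabla_{[X,Y]}Z$. Equivalently, $$\begin{aligned}\mathrm{Tr}_{\wedge^2\mathfrak g}\,q_{\omega^\sharp}=\int_\Sigma&\sum_{\mu=1}^{n-1}2\Big(|B(\omega^\sharp,e_\mu)|^2+|B(\nu,e_\mu)|^2|\omega|^2\Big)\\&-\sum_{\mu=1}^{n-1}\Big(\langle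 B(\omega^\sharp,\omega^\sharp),B(e_\mu,e_\mu)\rangle+\langle B(\nu,\nu),B(e_\mu,e_\mu)\rangle|\omega|^2\Big)\,d\mu_\Sigma .\end{aligned}$$ All integrands above are integrable. -/

import Mathlib

open scoped Manifold ContDiff Bundle
open MeasureTheory VectorField

noncomputable section

namespace TraceFormula

/-- The model space `ℝⁿ` with its Euclidean inner product. -/
abbrev Euc (n : ℕ) : Type := EuclideanSpace ℝ (Fin n)

/-- The `i`-th standard basis vector of `ℝⁿ`. -/
abbrev stdVec {n : ℕ} (i : Fin n) : Euc n := EuclideanSpace.single i 1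

/-! ### Riemannian geometry in a coordinate domain

Here `h : ℝⁿ → Mat_n(ℝ)` is the matrix `(h_ij)` of a metric in coordinates. -/

section Coordinates

variable {n : ℕ}

/-- The partial derivative `∂_i f`. -/
def partialD (i : Fin n) (f : Euc n → ℝ) (y : Euc n) : ℝ := fderiv ℝ f y (stdVec i)

/-- The Christoffel symbol `Γ^k_ij = ½ ∑_l h^{kl} (∂_i h_jl + ∂_j h_il - ∂_l h_ij)`. -/
def christoffel (h : Euc n → Matrix (Fin n) (Fin n) ℝ) (k i j : Fin n) (y : Euc n) : ℝ :=
  (1 / 2) * ∑ l, (h y)⁻¹ k l *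
    (partialD i (fun z ↦ h z j l) y + partialD j (fun z ↦ h z i l) y -
      partialD l (fun z ↦ h z i j) y)

/-- The vector `Γ(u, v)` with components `∑_ij Γ^k_ij u^i v^j`. -/
def christoffelMap (h : Euc n → Matrix (Fin n) (Fin n) ℝ) (y u v : Euc n) : Euc n :=
  WithLp.toLp 2 fun k ↦ ∑ i, ∑ j, christoffel h k i j y * u i * v j

/-- The component along `∂_l` of `R(∂_i, ∂_j)∂_k`, where
`R(X, Y)Z = ∇_X∇_Y Z - ∇_Y∇_X Z - ∇_[X,Y] Z`. -/
def curvatureCoeff (h : Euc n → Matrix (Fin n) (Fin n) ℝ) (l i j k : Fin n) (y : Euc n) : ℝ :=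
  partialD i (christoffel h l j k) y - partialD j (christoffel h l i k) y +
    ∑ a, (christoffel h l i a y * christoffel h a j k y -
      christoffel h l j a y * christoffel h a i k y)

/-- The curvature `R(u, v)w` in coordinates. -/
def coordCurvature (h : Euc n → Matrix (Fin n) (Fin n) ℝ) (y u v w : Euc n) : Euc n :=
  WithLp.toLp 2 fun l ↦ ∑ i, ∑ j, ∑ k, curvatureCoeff h l i j k y * u i * v j * w k

/-- The components `(∇_i α)_j` of the covariant derivative of a one-form. -/
def covForm (h : Euc n → Matrix (Fin n) (Fin n) ℝ) (α : Fin n → Euc n → ℝ) (i j : Fin n)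
    (y : Euc n) : ℝ :=
  partialD i (α j) y - ∑ a, christoffel h a i j y * α a y

/-- The codifferential `δα = -∑_ij h^{ij} (∇_i α)_j` of a one-form. -/
def codiffOne (h : Euc n → Matrix (Fin n) (Fin n) ℝ) (α : Fin n → Euc n → ℝ) (y : Euc n) : ℝ :=
  -∑ i, ∑ j, (h y)⁻¹ i j * covForm h α i j y

/-- The components `(dα)_ij = ∂_i α_j - ∂_j α_i` of the exterior derivative of a one-form. -/
def extDerivOne (α : Fin n → Euc n → ℝ) (i j : Fin n) (y : Euc n) : ℝ :=
  partialD i (α j) y - partialD j (α i) y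

/-- The components `(∇_i β)_jk` of the covariant derivative of a two-form. -/
def covTwoForm (h : Euc n → Matrix (Fin n) (Fin n) ℝ) (β : Fin n → Fin n → Euc n → ℝ)
    (i j k : Fin n) (y : Euc n) : ℝ :=
  partialD i (β j k) y - ∑ a, (christoffel h a i j y * β a k y + christoffel h a i k y * β j a y)

/-- The components `(δβ)_k = -∑_ij h^{ij} (∇_i β)_jk` of the codifferential of a two-form. -/
def codiffTwo (h : Euc n → Matrix (Fin n) (Fin n) ℝ) (β : Fin n → Fin n → Euc n → ℝ)
    (k : Fin n) (y : Euc n) : ℝ :=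
  -∑ i, ∑ j, (h y)⁻¹ i j * covTwoForm h β i j k y

/-- The components of the Hodge Laplacian `Δ₁α = dδα + δdα` of a one-form. -/
def coordHodgeLaplacian (h : Euc n → Matrix (Fin n) (Fin n) ℝ) (α : Fin n → Euc n → ℝ)
    (k : Fin n) (y : Euc n) : ℝ :=
  partialD k (codiffOne h α) y + codiffTwo h (extDerivOne α) k y

end Coordinates

/-! ### Riemannian manifolds

Local quantities at `p` are computed in the preferred chart at `p`; the tangent space at `p` is
identified with `ℝⁿ` through this chart, as Mathlib does. -/

section Manifold

variable {n : ℕ} {M : Type*} [TopologicalSpace M] [ChartedSpace (Euc n) M]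

/-- The tangent vector with components `v` in the chart at `p`, at the point with coordinates `y`
in this chart. -/
def coordVec (p : M) (y v : Euc n) : TangentSpace (𝓡 n) ((extChartAt (𝓡 n) p).symm y) :=
  mfderiv 𝓘(ℝ, Euc n) (𝓡 n) (extChartAt (𝓡 n) p).symm y v

/-- The coordinate vector field near `p` with constant components `v` in the chart at `p`. -/
def coordField (p : M) (v : Euc n) (x : M) : TangentSpace (𝓡 n) x :=
  (mfderiv (𝓡 n) 𝓘(ℝ, Euc n) (extChartAt (𝓡 n) p) x).inverse v

/-- The coordinate basis of `T_pM` in the chart at `p`. -/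
def tangentBasis (p : M) (i : Fin n) : TangentSpace (𝓡 n) p := stdVec i

variable [IsManifold (𝓡 n) ∞ M]

variable (n M) in
/-- Smooth Riemannian metrics on the `n`-dimensional manifold `M`. -/
abbrev Metric :=
  Bundle.ContMDiffRiemannianMetric (𝓡 n) ∞ (Euc n) (fun x : M ↦ TangentSpace (𝓡 n) x)

variable (n M) in
/-- Smooth vector fields. -/
abbrev VField := Cₛ^∞⟮𝓡 n; Euc n, (fun x : M ↦ TangentSpace (𝓡 n) x)⟯

variable (n M) in
/-- Smooth one-forms. -/
abbrev OneForm :=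
  Cₛ^∞⟮𝓡 n; Euc n →L[ℝ] ℝ, (fun x : M ↦ TangentSpace (𝓡 n) x →L[ℝ] Bundle.Trivial M ℝ x)⟯

/-- The Gram matrix of `g` at `p`. -/
def gram (g : Metric n M) (p : M) : Matrix (Fin n) (Fin n) ℝ :=
  .of fun i j ↦ g.inner p (tangentBasis p i) (tangentBasis p j)

/-- The metric dual of a linear form `l` on `T_pM`: `⟨sharp l, u⟩ = l u` for all `u`. -/
def sharp (g : Metric n M) (p : M) (l : TangentSpace (𝓡 n) p → ℝ) : TangentSpace (𝓡 n) p :=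
  ∑ i, ∑ j, ((gram g p)⁻¹ i j * l (tangentBasis p j)) • tangentBasis p i

/-- The trace `∑_μ b(e_μ, e_μ)` of a bilinear map with respect to `g`, written as
`∑_ij g^{ij} b(∂_i, ∂_j)`. -/
def metricTrace {W : Type*} [AddCommGroup W] [Module ℝ W] (g : Metric n M) (p : M)
    (b : TangentSpace (𝓡 n) p → TangentSpace (𝓡 n) p → W) : W :=
  ∑ i, ∑ j, (gram g p)⁻¹ i j • b (tangentBasis p i) (tangentBasis p j)

/-- `e` is an orthonormal basis of `T_pM`. -/
def IsOrthonormalAt (g : Metric n M) (p : M) (e : Fin n → TangentSpace (𝓡 n) p) : Prop :=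
  ∀ i j, g.inner p (e i) (e j) = if i = j then 1 else 0

/-- The matrix of `g` in the chart at `p`, as a function of the coordinates. -/
def coordMetric (g : Metric n M) (p : M) (y : Euc n) : Matrix (Fin n) (Fin n) ℝ :=
  .of fun i j ↦ g.inner ((extChartAt (𝓡 n) p).symm y)
    (coordVec p y (stdVec i)) (coordVec p y (stdVec j))

/-- The components of a one-form in the chart at `p`, as functions of the coordinates. -/
def coordForm (α : OneForm n M) (p : M) (i : Fin n) (y : Euc n) : ℝ :=
  α ((extChartAt (𝓡 n) p).symm y) (coordVec p y (stdVec i))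

/-- The curvature tensor `R(u, v)w` at `p`. -/
def curvature (g : Metric n M) (p : M) (u v w : TangentSpace (𝓡 n) p) : TangentSpace (𝓡 n) p :=
  coordCurvature (coordMetric g p) (extChartAt (𝓡 n) p p) u v w

/-- The Ricci tensor `Ric(v, w) = tr (u ↦ R(u, v)w)` at `p`. -/
def ricci (g : Metric n M) (p : M) (v w : TangentSpace (𝓡 n) p) : ℝ :=
  metricTrace g p fun u u' ↦ g.inner p (curvature g p u v w) u'

/-- `α` is harmonic: `Δ₁α = 0`. -/
def IsHarmonic (g : Metric n M) (α : OneForm n M) : Prop :=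
  ∀ (p : M) (k : Fin n),
    coordHodgeLaplacian (coordMetric g p) (coordForm α p) k (extChartAt (𝓡 n) p p) = 0

/-- The metric dual `α^♯` of a one-form. -/
def sharpForm (g : Metric n M) (α : OneForm n M) (p : M) : TangentSpace (𝓡 n) p :=
  sharp g p fun u ↦ α p u

/-- The Riemannian measure of the part of `M` covered by the chart at `x`: the image of
`√det(g_ij) dy`. -/
def chartMeasure [MeasurableSpace M] (g : Metric n M) (x : M) : Measure M :=
  ((volume.restrict (extChartAt (𝓡 n) x).target).withDensity fun y ↦
    ENNReal.ofReal (Real.sqrt (coordMetric g x y).det)).map (extChartAt (𝓡 n) x).symm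

variable (n M) in
/-- A smooth partition of unity subordinate to the preferred charts. -/
def chartPartition [T2Space M] [SigmaCompactSpace M] :
    SmoothPartitionOfUnity M (𝓡 n) M Set.univ :=
  (SmoothPartitionOfUnity.exists_isSubordinate_chartAt_source (𝓡 n) M).choose

/-- The Riemannian measure (density) of `g`, glued by a partition of unity. -/
def riemannianMeasure [T2Space M] [SigmaCompactSpace M] [MeasurableSpace M]
    (g : Metric n M) : Measure M :=
  Measure.sum fun x ↦ (chartMeasure g x).withDensity fun q ↦
    ENNReal.ofReal (chartPartition n M x q)

end Manifold

/-! ### Immersions -/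

section Immersion

variable {m n : ℕ} {P M : Type*} [TopologicalSpace P] [ChartedSpace (Euc m) P]
  [IsManifold (𝓡 m) ∞ P] [TopologicalSpace M] [ChartedSpace (Euc n) M] [IsManifold (𝓡 n) ∞ M]

/-- `F : (P, gP) → (M, gM)` is a smooth isometric immersion. -/
structure IsIsometricImmersion (gP : Metric m P) (gM : Metric n M) (F : P → M) : Prop where
  smooth : ContMDiff (𝓡 m) (𝓡 n) ∞ F
  isometric : ∀ (p : P) (u v : TangentSpace (𝓡 m) p),
    gM.inner (F p) (mfderiv (𝓡 m) (𝓡 n) F p u) (mfderiv (𝓡 m) (𝓡 n) F p v) = gP.inner p u v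

/-- The covariant derivative `∇^M_u V` at `p` of a vector field `V` along `F : P → M`, for the
Levi-Civita connection of `gM`: in the chart at `F p` it is `D_u V + Γ(dF u, V)`. -/
def covAlong (gM : Metric n M) (F : P → M) (V : ∀ x : P, TangentSpace (𝓡 n) (F x)) (p : P)
    (u : TangentSpace (𝓡 m) p) : TangentSpace (𝓡 n) (F p) :=
  ((mvfderiv (𝓡 m) (fun x ↦ mvfderiv (𝓡 n) (extChartAt (𝓡 n) (F p)) (F x) (V x)) p u : Euc n) +
    christoffelMap (coordMetric gM (F p)) (extChartAt (𝓡 n) (F p) (F p))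
      (mfderiv (𝓡 m) (𝓡 n) F p u) (V p) : Euc n)

/-- The component `w^⊥` of `w ∈ T_{F p}M` orthogonal to `dF(T_pP)`, for an isometric immersion
`F`. The tangential component is `dF a` with `⟨a, u⟩ = ⟨w, dF u⟩` for all `u ∈ T_pP`. -/
def normalPart (gP : Metric m P) (gM : Metric n M) (F : P → M) (p : P)
    (w : TangentSpace (𝓡 n) (F p)) : TangentSpace (𝓡 n) (F p) :=
  w - mfderiv (𝓡 m) (𝓡 n) F p
    (sharp gP p fun u ↦ gM.inner (F p) w (mfderiv (𝓡 m) (𝓡 n) F p u))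

/-- The second fundamental form `(∇^M_u v)^⊥` of an isometric immersion at `p`, where `v` is
extended by constant components in the chart at `p`. -/
def secondFF (gP : Metric m P) (gM : Metric n M) (F : P → M) (p : P)
    (u v : TangentSpace (𝓡 m) p) : TangentSpace (𝓡 n) (F p) :=
  normalPart gP gM F p
    (covAlong gM F (fun x ↦ mfderiv (𝓡 m) (𝓡 n) F x (coordField p v x)) p u)

/-- The mean curvature vector of `F` vanishes identically. -/
def IsMinimal (gP : Metric m P) (gM : Metric n M) (F : P → M) : Prop :=
  ∀ p, metricTrace gP p (secondFF gP gM F p) = 0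

/-- The squared norm `|A|²` of the second fundamental form. -/
def normSqSecondFF (gP : Metric m P) (gM : Metric n M) (F : P → M) (p : P) : ℝ :=
  metricTrace gP p fun u v ↦ metricTrace gP p fun u' v' ↦
    gM.inner (F p) (secondFF gP gM F p u u') (secondFF gP gM F p v v')

/-- `ν` is a smooth unit normal vector field along `F`. -/
structure IsUnitNormal (gM : Metric n M) (F : P → M)
    (ν : ∀ p : P, TangentSpace (𝓡 n) (F p)) : Prop where
  smooth : ContMDiff (𝓡 m) (𝓡 n).tangent ∞ fun p ↦ (⟨F p, ν p⟩ : TangentBundle (𝓡 n) M)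
  unit : ∀ p, gM.inner (F p) (ν p) (ν p) = 1
  normal : ∀ (p : P) (u : TangentSpace (𝓡 m) p),
    gM.inner (F p) (ν p) (mfderiv (𝓡 m) (𝓡 n) F p u) = 0

/-- The normal connection `∇^⊥_u V = (∇^M_u V)^⊥`. -/
def normalCov (gP : Metric m P) (gM : Metric n M) (F : P → M)
    (V : ∀ x : P, TangentSpace (𝓡 n) (F x)) (p : P) (u : TangentSpace (𝓡 m) p) :
    TangentSpace (𝓡 n) (F p) :=
  normalPart gP gM F p (covAlong gM F V p u)

/-- The integrand `⟨∇^⊥V, ∇^⊥W⟩ - Ric^M(V, W) - |A|²⟨V, W⟩` of the index form. -/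
def indexDensity (gP : Metric m P) (gM : Metric n M) (F : P → M)
    (V W : ∀ x : P, TangentSpace (𝓡 n) (F x)) (p : P) : ℝ :=
  metricTrace gP p (fun u v ↦
      gM.inner (F p) (normalCov gP gM F V p u) (normalCov gP gM F W p v)) -
    ricci gM (F p) (V p) (W p) -
    normSqSecondFF gP gM F p * gM.inner (F p) (V p) (W p)

/-- The index form `Q(V, W)` of a minimal immersion, on normal vector fields. -/
def indexForm [T2Space P] [SigmaCompactSpace P] [MeasurableSpace P]
    (gP : Metric m P) (gM : Metric n M) (F : P → M)
    (V W : ∀ x : P, TangentSpace (𝓡 n) (F x)) : ℝ :=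
  ∫ p, indexDensity gP gM F V W p ∂(riemannianMeasure gP)

end Immersion

/-! ### The Lie algebra of the isometry group -/

section Isometries

variable {n : ℕ} {M : Type*} [TopologicalSpace M] [ChartedSpace (Euc n) M]
  [IsManifold (𝓡 n) ∞ M]

instance : IsManifold (𝓡 n) (minSmoothness ℝ 2) M := by
  rw [minSmoothness_of_isRCLikeNormedField]; infer_instance

instance : IsManifold (𝓡 n) (minSmoothness ℝ 3) M := by
  rw [minSmoothness_of_isRCLikeNormedField]; infer_instance

instance : IsManifold (𝓡 n) (((⊤ : ℕ∞) : ℕ∞ω) + 1) M := by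
  simpa using (inferInstance : IsManifold (𝓡 n) ∞ M)

theorem minSmoothness_two_le : minSmoothness ℝ 2 ≤ (∞ : ℕ∞ω) := by
  rw [minSmoothness_of_isRCLikeNormedField]
  exact ENat.LEInfty.out

/-- The Lie bracket of two smooth vector fields. -/
def VField.bracket (X Y : VField n M) : VField n M where
  toFun := mlieBracket (𝓡 n) X Y
  contMDiff_toFun :=
    ContDiff.mlieBracket_vectorField (m := ⊤) (n := ⊤) X.contMDiff Y.contMDiff (by simp)

theorem contMDiff_metric_apply (g : Metric n M) (Y Z : VField n M) :
    ContMDiff (𝓡 n) 𝓘(ℝ) ∞ (fun x ↦ g.inner x (Y x) (Z x)) := by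
  let _ : Bundle.RiemannianBundle (fun x : M ↦ TangentSpace (𝓡 n) x) := ⟨g.toRiemannianMetric⟩
  exact ContMDiff.inner_bundle (E := fun x : M ↦ TangentSpace (𝓡 n) x) Y.contMDiff Z.contMDiff

theorem contMDiff_deriv (X : VField n M) {f : M → ℝ} (hf : ContMDiff (𝓡 n) 𝓘(ℝ) ∞ f) :
    ContMDiff (𝓡 n) 𝓘(ℝ) ∞ (fun x ↦ mvfderiv (𝓡 n) f x (X x)) := by
  have h1 : ContMDiff (𝓡 n).tangent 𝓘(ℝ).tangent ∞ (tangentMap (𝓡 n) 𝓘(ℝ) f) :=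
    hf.contMDiff_tangentMap (by simp)
  have h2 := h1.comp X.contMDiff
  intro x
  have h3 := (Bundle.contMDiffAt_totalSpace.1 (h2 x)).2
  simpa [tangentMap, mvfderiv] using! h3

/-- The bracket of vector fields acts on functions as the commutator of derivations. -/
theorem deriv_bracket (X Y : VField n M) {f : M → ℝ} (hf : ContMDiff (𝓡 n) 𝓘(ℝ) ∞ f) (x : M) :
    mvfderiv (𝓡 n) f x (mlieBracket (𝓡 n) X Y x) =
      mvfderiv (𝓡 n) (fun y ↦ mvfderiv (𝓡 n) f y (Y y)) x (X x) -
      mvfderiv (𝓡 n) (fun y ↦ mvfderiv (𝓡 n) f y (X y)) x (Y x) := by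
  rcases subsingleton_or_nontrivial (Euc n) with hn | hn
  · have e1 : mlieBracket (𝓡 n) X Y x = 0 := @Subsingleton.elim (Euc n) hn _ _
    have e2 : X x = 0 := @Subsingleton.elim (Euc n) hn _ _
    have e3 : Y x = 0 := @Subsingleton.elim (Euc n) hn _ _
    rw [e1, e2, e3]; simp
  obtain ⟨w, hw⟩ := exists_ne (0 : Euc n)
  let W : Π y : M, TangentSpace (𝓡 n) y :=
    FiberBundle.extend (Euc n) (E := fun y : M ↦ TangentSpace (𝓡 n) y) (x := x) w
  have hWx : W x = w := FiberBundle.extend_apply_self (F := Euc n) _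
  have hWs : ContMDiffAt (𝓡 n) (𝓡 n).tangent ∞
      (fun y ↦ (⟨y, W y⟩ : TangentBundle (𝓡 n) M)) x :=
    FiberBundle.contMDiffAt_extend (k := ∞) (𝓡 n) (Euc n) _
  have hWd : MDifferentiableAt (𝓡 n) (𝓡 n).tangent
      (fun y ↦ (⟨y, W y⟩ : TangentBundle (𝓡 n) M)) x := hWs.mdifferentiableAt (by simp)
  have hWnear : ∀ᶠ y in nhds x, MDifferentiableAt (𝓡 n) (𝓡 n).tangent
      (fun y ↦ (⟨y, W y⟩ : TangentBundle (𝓡 n) M)) y := by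
    obtain ⟨s, hs, hWs⟩ := FiberBundle.exists_contMDiffOn_extend (k := ∞) (𝓡 n) (Euc n)
      (V := fun y : M ↦ TangentSpace (𝓡 n) y) (x₀ := x) w
    filter_upwards [eventually_mem_nhds_iff.2 hs] with y hy
    exact (hWs.contMDiffAt hy).mdifferentiableAt (by simp)
  have hfd : ∀ y, MDifferentiableAt (𝓡 n) 𝓘(ℝ) f y := fun y ↦ hf.mdifferentiableAt (by simp)
  have key : ∀ A B : VField n M,
      mlieBracket (𝓡 n) A (mlieBracket (𝓡 n) B (f • W)) x =
        mvfderiv (𝓡 n) (fun y ↦ mvfderiv (𝓡 n) f y (B y)) x (A x) • W x +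
        mvfderiv (𝓡 n) f x (B x) • mlieBracket (𝓡 n) A W x +
        (mvfderiv (𝓡 n) f x (A x) • mlieBracket (𝓡 n) B W x +
        f x • mlieBracket (𝓡 n) A (mlieBracket (𝓡 n) B W) x) := by
    intro A B
    have hev : mlieBracket (𝓡 n) B (f • W) =ᶠ[nhds x]
        (fun y ↦ mvfderiv (𝓡 n) f y (B y)) • W + f • mlieBracket (𝓡 n) B W := by
      filter_upwards [hWnear] with y hy
      exact mlieBracket_smul_right (hfd y) hy
    have hBW : MDifferentiableAt (𝓡 n) (𝓡 n).tangent
        (fun y ↦ (⟨y, mlieBracket (𝓡 n) B W y⟩ : TangentBundle (𝓡 n) M)) x :=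
      (ContMDiffAt.mlieBracket_vectorField (m := ⊤) (n := ⊤) B.contMDiff.contMDiffAt hWs
        (by simp)).mdifferentiableAt (by simp)
    have hP : MDifferentiableAt (𝓡 n) 𝓘(ℝ) (fun y ↦ mvfderiv (𝓡 n) f y (B y)) x :=
      (contMDiff_deriv B hf).mdifferentiableAt (by simp)
    have hA : (A : Π y : M, TangentSpace (𝓡 n) y) =ᶠ[nhds x] A := Filter.EventuallyEq.rfl
    rw [hA.mlieBracket_vectorField_eq hev, mlieBracket_add_right (hP.smul_section hWd) ((hfd x).smul_section hBW),
      mlieBracket_smul_right hP hWd, mlieBracket_smul_right (hfd x) hBW]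
  have hJ := leibniz_identity_mlieBracket_apply (I := 𝓡 n) (U := X) (V := Y) (W := f • W) (x := x)
    (X.contMDiff.contMDiffAt.of_le minSmoothness_two_le) (Y.contMDiff.contMDiffAt.of_le minSmoothness_two_le)
    ((hf.contMDiffAt.smul_section hWs).of_le minSmoothness_two_le)
  have hJ' := leibniz_identity_mlieBracket_apply (I := 𝓡 n) (U := X) (V := Y) (W := W) (x := x)
    (X.contMDiff.contMDiffAt.of_le minSmoothness_two_le) (Y.contMDiff.contMDiffAt.of_le minSmoothness_two_le)
    (hWs.of_le minSmoothness_two_le)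
  rw [key, key, mlieBracket_smul_right (hfd x) hWd, hJ', smul_add] at hJ
  have hz : (mvfderiv (𝓡 n) f x (mlieBracket (𝓡 n) X Y x) -
      (mvfderiv (𝓡 n) (fun y ↦ mvfderiv (𝓡 n) f y (Y y)) x (X x) -
      mvfderiv (𝓡 n) (fun y ↦ mvfderiv (𝓡 n) f y (X y)) x (Y x))) • W x = 0 := by
    rw [sub_smul, sub_smul, sub_eq_zero, eq_comm, sub_eq_iff_eq_add]
    rw [← sub_eq_zero] at hJ ⊢
    rw [← hJ]
    abel
  rcases smul_eq_zero.1 hz with h | h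
  · exact sub_eq_zero.1 h
  · exact absurd (hWx.symm.trans h) hw

/-- `X` is a Killing field of `g`: `X⟨Y, Z⟩ = ⟨[X, Y], Z⟩ + ⟨Y, [X, Z]⟩` for all vector fields
`Y`, `Z`, that is, `L_X g = 0`. -/
def IsKillingField (g : Metric n M) (X : VField n M) : Prop :=
  ∀ (Y Z : VField n M) (p : M),
    mvfderiv (𝓡 n) (fun x ↦ g.inner x (Y x) (Z x)) p (X p) =
      g.inner p (mlieBracket (𝓡 n) X Y p) (Z p) + g.inner p (Y p) (mlieBracket (𝓡 n) X Z p)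

theorem IsKillingField.bracket {g : Metric n M} {X X' : VField n M} (hX : IsKillingField g X)
    (hX' : IsKillingField g X') : IsKillingField g (X.bracket X') := by
  intro Y Z p
  have hs := contMDiff_metric_apply g Y Z
  have d1 : ∀ Y Z : VField n M, MDifferentiableAt (𝓡 n) 𝓘(ℝ) (fun x ↦ g.inner x (Y x) (Z x)) p :=
    fun Y Z ↦ (contMDiff_metric_apply g Y Z).mdifferentiableAt (by simp)
  have e : ∀ A B : VField n M, IsKillingField g A → IsKillingField g B →
      mvfderiv (𝓡 n) (fun y ↦ mvfderiv (𝓡 n) (fun x ↦ g.inner x (Y x) (Z x)) y (B y)) p (A p) =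
        g.inner p (mlieBracket (𝓡 n) A (mlieBracket (𝓡 n) B Y) p) (Z p) +
        g.inner p (mlieBracket (𝓡 n) B Y p) (mlieBracket (𝓡 n) A Z p) +
        (g.inner p (mlieBracket (𝓡 n) A Y p) (mlieBracket (𝓡 n) B Z p) +
        g.inner p (Y p) (mlieBracket (𝓡 n) A (mlieBracket (𝓡 n) B Z) p)) := by
    intro A B hA hB
    have : (fun y ↦ mvfderiv (𝓡 n) (fun x ↦ g.inner x (Y x) (Z x)) y (B y)) =
        (fun y ↦ g.inner y (B.bracket Y y) (Z y)) + (fun y ↦ g.inner y (Y y) (B.bracket Z y)) :=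
      funext fun y ↦ hB Y Z y
    rw [this, mvfderiv_add (d1 _ _) (d1 _ _)]
    exact congrArg₂ (· + ·) (hA (B.bracket Y) Z p) (hA Y (B.bracket Z) p)
  have hJ : ∀ Z : VField n M, mlieBracket (𝓡 n) (mlieBracket (𝓡 n) X X') Z p =
      mlieBracket (𝓡 n) X (mlieBracket (𝓡 n) X' Z) p -
      mlieBracket (𝓡 n) X' (mlieBracket (𝓡 n) X Z) p := fun Z ↦
    eq_sub_of_add_eq (leibniz_identity_mlieBracket_apply (I := 𝓡 n)
      (X.contMDiff.contMDiffAt.of_le minSmoothness_two_le) (X'.contMDiff.contMDiffAt.of_le minSmoothness_two_le)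
      (Z.contMDiff.contMDiffAt.of_le minSmoothness_two_le)).symm
  have h0 := deriv_bracket X X' hs p
  rw [e X X' hX hX', e X' X hX' hX] at h0
  change mvfderiv (𝓡 n) (fun x ↦ g.inner x (Y x) (Z x)) p (mlieBracket (𝓡 n) X X' p) =
    g.inner p (mlieBracket (𝓡 n) (mlieBracket (𝓡 n) X X') Y p) (Z p) +
    g.inner p (Y p) (mlieBracket (𝓡 n) (mlieBracket (𝓡 n) X X') Z p)
  rw [h0, hJ, hJ, map_sub, map_sub, sub_apply]
  ring

/-- The space of Killing fields of `g`. -/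
def killingFields (g : Metric n M) : Submodule ℝ (VField n M) where
  carrier := {X | IsKillingField g X}
  zero_mem' := by
    intro Y Z p
    simp
  add_mem' := by
    intro X X' hX hX' Y Z p
    have h := hX Y Z p
    have h' := hX' Y Z p
    simp only [ContMDiffSection.coe_add, Pi.add_apply, map_add]
    rw [mlieBracket_add_left X.mdifferentiableAt X'.mdifferentiableAt,
      mlieBracket_add_left X.mdifferentiableAt X'.mdifferentiableAt, h, h', map_add, map_add,
      add_apply]
    ring
  smul_mem' := by
    intro c X hX Y Z p
    have h := hX Y Z p
    simp only [ContMDiffSection.coe_smul, Pi.smul_apply, map_smul]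
    rw [mlieBracket_const_smul_left X.mdifferentiableAt,
      mlieBracket_const_smul_left X.mdifferentiableAt, h, map_smul, map_smul]
    simp [mul_add]

/-- The Lie algebra `𝔤` of the isometry group of a closed Riemannian manifold `(N, g)`. An element
`X` of `𝔤` is represented by its fundamental vector field `X† = d/dt exp(tX) q`; on a closed
(more generally, complete) manifold these are exactly the Killing fields, and the bracket of `𝔤`
is determined by `[X, Y]† = -[X†, Y†]`. -/
def IsometryAlgebra (g : Metric n M) : Type _ := killingFields g

namespace IsometryAlgebra

variable {g : Metric n M}

instance : AddCommGroup (IsometryAlgebra g) := inferInstanceAs (AddCommGroup (killingFields g))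

instance : Module ℝ (IsometryAlgebra g) := inferInstanceAs (Module ℝ (killingFields g))

/-- The fundamental vector field `X†` of `X`. -/
def dagger (X : IsometryAlgebra g) : VField n M := (show killingFields g from X).1

theorem dagger_injective : Function.Injective (dagger : IsometryAlgebra g → VField n M) :=
  Subtype.val_injective

instance : Bracket (IsometryAlgebra g) (IsometryAlgebra g) :=
  ⟨fun X Y ↦ (⟨-X.dagger.bracket Y.dagger,
    (killingFields g).neg_mem (IsKillingField.bracket X.2 Y.2)⟩ : killingFields g)⟩

theorem dagger_lie (X Y : IsometryAlgebra g) : ⁅X, Y⁆.dagger = -X.dagger.bracket Y.dagger := rfl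

theorem dagger_add (X Y : IsometryAlgebra g) : (X + Y).dagger = X.dagger + Y.dagger := rfl

theorem dagger_smul (c : ℝ) (X : IsometryAlgebra g) : (c • X).dagger = c • X.dagger := rfl

instance : LieRing (IsometryAlgebra g) where
  add_lie X Y Z := by
    apply dagger_injective
    ext1 x
    simp only [dagger_lie, dagger_add, ContMDiffSection.coe_add, ContMDiffSection.coe_neg,
      Pi.add_apply, Pi.neg_apply]
    change -mlieBracket (𝓡 n) (X.dagger + Y.dagger : Π y : M, TangentSpace (𝓡 n) y) Z.dagger x =
      -mlieBracket (𝓡 n) X.dagger Z.dagger x + -mlieBracket (𝓡 n) Y.dagger Z.dagger x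
    rw [mlieBracket_add_left X.dagger.mdifferentiableAt Y.dagger.mdifferentiableAt, neg_add]
  lie_add X Y Z := by
    apply dagger_injective
    ext1 x
    simp only [dagger_lie, dagger_add, ContMDiffSection.coe_add, ContMDiffSection.coe_neg,
      Pi.add_apply, Pi.neg_apply]
    change -mlieBracket (𝓡 n) X.dagger (Y.dagger + Z.dagger : Π y : M, TangentSpace (𝓡 n) y) x =
      -mlieBracket (𝓡 n) X.dagger Y.dagger x + -mlieBracket (𝓡 n) X.dagger Z.dagger x
    rw [mlieBracket_add_right Y.dagger.mdifferentiableAt Z.dagger.mdifferentiableAt, neg_add]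
  lie_self X := by
    apply dagger_injective
    ext1 x
    change -mlieBracket (𝓡 n) X.dagger X.dagger x = 0
    simp
  leibniz_lie X Y Z := by
    apply dagger_injective
    ext1 x
    have h := leibniz_identity_mlieBracket_apply (I := 𝓡 n) (x := x)
      (X.dagger.contMDiff.contMDiffAt.of_le minSmoothness_two_le) (Y.dagger.contMDiff.contMDiffAt.of_le minSmoothness_two_le)
      (Z.dagger.contMDiff.contMDiffAt.of_le minSmoothness_two_le)
    change -mlieBracket (𝓡 n) X.dagger (-mlieBracket (𝓡 n) Y.dagger Z.dagger) x =
      -mlieBracket (𝓡 n) (-mlieBracket (𝓡 n) X.dagger Y.dagger) Z.dagger x +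
      -mlieBracket (𝓡 n) Y.dagger (-mlieBracket (𝓡 n) X.dagger Z.dagger) x
    have hd : ∀ A B : VField n M, MDifferentiableAt (𝓡 n) (𝓡 n).tangent
        (fun y ↦ (⟨y, mlieBracket (𝓡 n) A B y⟩ : TangentBundle (𝓡 n) M)) x :=
      fun A B ↦ (A.bracket B).mdifferentiableAt
    have hr : ∀ A B C : VField n M, mlieBracket (𝓡 n) A (-mlieBracket (𝓡 n) B C) x =
        -mlieBracket (𝓡 n) A (mlieBracket (𝓡 n) B C) x := fun A B C ↦ by
      have := mlieBracket_const_smul_right (I := 𝓡 n) (c := (-1 : ℝ)) (V := A) (hd B C)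
      simpa using this
    have hl : mlieBracket (𝓡 n) (-mlieBracket (𝓡 n) X.dagger Y.dagger) Z.dagger x =
        -mlieBracket (𝓡 n) (mlieBracket (𝓡 n) X.dagger Y.dagger) Z.dagger x := by
      have := mlieBracket_const_smul_left (I := 𝓡 n) (c := (-1 : ℝ)) (W := Z.dagger)
        (hd X.dagger Y.dagger)
      simpa using this
    rw [hr, hr, hl, neg_neg, neg_neg, neg_neg, h]

instance : LieAlgebra ℝ (IsometryAlgebra g) where
  lie_smul c X Y := by
    apply dagger_injective
    ext1 x
    simp only [dagger_lie, dagger_smul, ContMDiffSection.coe_smul, ContMDiffSection.coe_neg,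
      Pi.smul_apply, Pi.neg_apply]
    change -mlieBracket (𝓡 n) X.dagger (c • (Y.dagger : Π y : M, TangentSpace (𝓡 n) y)) x =
      c • -mlieBracket (𝓡 n) X.dagger Y.dagger x
    rw [mlieBracket_const_smul_right Y.dagger.mdifferentiableAt, smul_neg]

/-- The linear map `𝔤 → T_pN`, `X ↦ X†(p)`. -/
def evalAt (g : Metric n M) (p : M) : IsometryAlgebra g →ₗ[ℝ] TangentSpace (𝓡 n) p where
  toFun X := X.dagger p
  map_add' _ _ := rfl
  map_smul' _ _ := rfl

end IsometryAlgebra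

/-- `s` is a geodesic symmetry at `p`: an involutive isometry with `p` as an isolated fixed
point. -/
structure IsGeodesicSymmetry (g : Metric n M) (p : M) (s : M → M) : Prop where
  smooth : ContMDiff (𝓡 n) (𝓡 n) ∞ s
  isometric : ∀ (q : M) (u v : TangentSpace (𝓡 n) q),
    g.inner (s q) (mfderiv (𝓡 n) (𝓡 n) s q u) (mfderiv (𝓡 n) (𝓡 n) s q v) = g.inner q u v
  involutive : Function.Involutive s
  fixed : s p = p
  isolated : ∀ᶠ q in nhds p, s q = q → q = p

/-- The `-1`-eigenspace `𝔫_p` of the involution `σ_p` of `𝔤` induced by the geodesic symmetry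
`s = s_p`. As `σ_p` is the differential of `a ↦ s a s`, the fundamental vector field of `σ_p X` is
the push-forward of `X†` by `s`. -/
def minusSpace (g : Metric n M) (s : M → M) : Submodule ℝ (IsometryAlgebra g) where
  carrier := {X | ∀ q, mfderiv (𝓡 n) (𝓡 n) s q (X.dagger q) = -X.dagger (s q)}
  zero_mem' q := by
    change mfderiv (𝓡 n) (𝓡 n) s q 0 = -0
    simp
  add_mem' {X Y} hX hY q := by
    change mfderiv (𝓡 n) (𝓡 n) s q (X.dagger q + Y.dagger q) =
      -(X.dagger (s q) + Y.dagger (s q))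
    rw [map_add, hX q, hY q, neg_add]
  smul_mem' c X hX q := by
    change mfderiv (𝓡 n) (𝓡 n) s q (c • X.dagger q) = -(c • X.dagger (s q))
    rw [map_smul, hX q, smul_neg]

/-- The inner product `⟨X, Y⟩_𝔤 = -B(X, Y)`, where `B` is the Killing form of `𝔤`. -/
def lieInner (g : Metric n M) : LinearMap.BilinForm ℝ (IsometryAlgebra g) :=
  -killingForm ℝ (IsometryAlgebra g)

/-- A connected closed Riemannian manifold `(N, g)` is a semi-simple Riemannian symmetric space,
endowed with its canonical metric. -/
structure IsSemisimpleRSS (g : Metric n M) : Prop where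
  symmetric : ∀ p, ∃ s, IsGeodesicSymmetry g p s
  semisimple : LieAlgebra.IsSemisimple ℝ (IsometryAlgebra g)
  /-- The metric is the canonical one: at every point `p`, it is the restriction of `⟨,⟩_𝔤` to
  `𝔫_p`, transported by the canonical isomorphism `𝔫_p ≃ T_pN`, `X ↦ X†(p)`. -/
  canonical : ∀ p s, IsGeodesicSymmetry g p s →
    Set.BijOn (IsometryAlgebra.evalAt g p) (minusSpace g s) Set.univ ∧
    ∀ X ∈ minusSpace g s, ∀ Y ∈ minusSpace g s,
      g.inner p (X.dagger p) (Y.dagger p) = lieInner g X Y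

end Isometries

/-! ### The test functions -/

section Test

/-- The bilinear form on `∧²V` induced by a bilinear form `b` on `V`:
`⟨x ∧ y, z ∧ w⟩ = b(x, z) b(y, w) - b(x, w) b(y, z)`. -/
def wedgeForm {V : Type*} [AddCommGroup V] [Module ℝ V] (b : LinearMap.BilinForm ℝ V) :
    LinearMap.BilinForm ℝ (⋀[ℝ]^2 V) :=
  exteriorPower.pairingDual ℝ V 2 ∘ₗ exteriorPower.map 2 b

theorem wedgeForm_ιMulti {V : Type*} [AddCommGroup V] [Module ℝ V] (b : LinearMap.BilinForm ℝ V)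
    (x y z w : V) :
    wedgeForm b (exteriorPower.ιMulti ℝ 2 ![x, y]) (exteriorPower.ιMulti ℝ 2 ![z, w]) =
      b x z * b y w - b x w * b y z := by
  simp [wedgeForm, exteriorPower.map_apply_ιMulti, Matrix.det_fin_two]
  ring

/-- The inner product of `g` at `p` as a bilinear form. -/
def metricForm {n : ℕ} {M : Type*} [TopologicalSpace M] [ChartedSpace (Euc n) M]
    [IsManifold (𝓡 n) ∞ M] (g : Metric n M) (p : M) :
    LinearMap.BilinForm ℝ (TangentSpace (𝓡 n) p) :=
  LinearMap.mk₂ ℝ (fun u v ↦ g.inner p u v) (by simp) (by simp) (by simp) (by simp)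

variable {m n d : ℕ} {S M N : Type*}
  [TopologicalSpace S] [ChartedSpace (Euc m) S] [IsManifold (𝓡 m) ∞ S]
  [TopologicalSpace M] [ChartedSpace (Euc n) M] [IsManifold (𝓡 n) ∞ M]
  [TopologicalSpace N] [ChartedSpace (Euc d) N] [IsManifold (𝓡 d) ∞ N]

/-- The linear map `v ↦ Π(v)(q)`, `∧²𝔤 → ∧²T_qN`, with `Π(X ∧ Y) = X† ∧ Y†`. -/
def wedgeDagger (gN : Metric d N) (q : N) :
    ⋀[ℝ]^2 (IsometryAlgebra gN) →ₗ[ℝ] ⋀[ℝ]^2 (TangentSpace (𝓡 d) q) :=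
  exteriorPower.map 2 (IsometryAlgebra.evalAt gN q)

/-- The test function `φ_{T,v} = ⟨ν ∧ T, Π(v)⟩` on `Σ`; tangent vectors of `Σ` and `M` are
regarded as tangent vectors of `N` by means of `f : Σ → M` and `F : M → N`. -/
def testFunction (gN : Metric d N) (F : M → N) (f : S → M)
    (ν : ∀ p : S, TangentSpace (𝓡 n) (f p)) (T : ∀ p : S, TangentSpace (𝓡 m) p)
    (v : ⋀[ℝ]^2 (IsometryAlgebra gN)) (p : S) : ℝ :=
  wedgeForm (metricForm gN (F (f p)))
    (exteriorPower.ιMulti ℝ 2 ![mfderiv (𝓡 n) (𝓡 d) F (f p) (ν p),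
      mfderiv (𝓡 n) (𝓡 d) F (f p) (mfderiv (𝓡 m) (𝓡 n) f p (T p))])
    (wedgeDagger gN (F (f p)) v)

/-- The test variation `Φ(T, v) = φ_{T,v} ν`. -/
def testVariation (gN : Metric d N) (F : M → N) (f : S → M)
    (ν : ∀ p : S, TangentSpace (𝓡 n) (f p)) (T : ∀ p : S, TangentSpace (𝓡 m) p)
    (v : ⋀[ℝ]^2 (IsometryAlgebra gN)) (p : S) : TangentSpace (𝓡 n) (f p) :=
  testFunction gN F f ν T v p • ν p

/-- The quadratic form `q_T(v, w) = Q(Φ(T, v), Φ(T, w))` on `∧²𝔤`. -/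
def testForm [T2Space S] [SigmaCompactSpace S] [MeasurableSpace S]
    (gS : Metric m S) (gM : Metric n M) (gN : Metric d N) (F : M → N) (f : S → M)
    (ν : ∀ p : S, TangentSpace (𝓡 n) (f p)) (T : ∀ p : S, TangentSpace (𝓡 m) p)
    (v w : ⋀[ℝ]^2 (IsometryAlgebra gN)) : ℝ :=
  indexForm gS gM f (testVariation gN F f ν T v) (testVariation gN F f ν T w)

/-- The integrand
`∑_μ (|B(e_μ, T)|² + |B(e_μ, ν)|²|T|²) - (∑_μ ⟨R^M(T, e_μ)e_μ, T⟩ + Ric^M(ν, ν)|T|²)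
  + ∑_μ (⟨R^N(T, e_μ)e_μ, T⟩ + ⟨R^N(ν, e_μ)e_μ, ν⟩|T|²)` at `p`. -/
def curvatureIntegrand (gS : Metric m S) (gM : Metric n M) (gN : Metric d N) (F : M → N)
    (f : S → M) (ν : ∀ p : S, TangentSpace (𝓡 n) (f p)) (T : ∀ p : S, TangentSpace (𝓡 m) p)
    (e : ∀ p : S, Fin m → TangentSpace (𝓡 m) p) (p : S) : ℝ :=
  let df := mfderiv (𝓡 m) (𝓡 n) f p
  let dF := mfderiv (𝓡 n) (𝓡 d) F (f p)
  let B := secondFF gM gN F (f p)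
  let normT := gS.inner p (T p) (T p)
  (∑ μ, (gN.inner (F (f p)) (B (df (e p μ)) (df (T p))) (B (df (e p μ)) (df (T p))) +
      gN.inner (F (f p)) (B (df (e p μ)) (ν p)) (B (df (e p μ)) (ν p)) * normT)) -
    ((∑ μ, gM.inner (f p)
        (curvature gM (f p) (df (T p)) (df (e p μ)) (df (e p μ))) (df (T p))) +
      ricci gM (f p) (ν p) (ν p) * normT) +
    ∑ μ, (gN.inner (F (f p))
        (curvature gN (F (f p)) (dF (df (T p))) (dF (df (e p μ))) (dF (df (e p μ))))
        (dF (df (T p))) +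
      gN.inner (F (f p))
        (curvature gN (F (f p)) (dF (ν p)) (dF (df (e p μ))) (dF (df (e p μ)))) (dF (ν p)) *
        normT)

/-- The integrand
`∑_μ 2 (|B(T, e_μ)|² + |B(ν, e_μ)|²|T|²)
  - ∑_μ (⟨B(T, T), B(e_μ, e_μ)⟩ + ⟨B(ν, ν), B(e_μ, e_μ)⟩|T|²)` at `p`. -/
def secondFFIntegrand (gS : Metric m S) (gM : Metric n M) (gN : Metric d N) (F : M → N)
    (f : S → M) (ν : ∀ p : S, TangentSpace (𝓡 n) (f p)) (T : ∀ p : S, TangentSpace (𝓡 m) p)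
    (e : ∀ p : S, Fin m → TangentSpace (𝓡 m) p) (p : S) : ℝ :=
  let df := mfderiv (𝓡 m) (𝓡 n) f p
  let B := secondFF gM gN F (f p)
  let normT := gS.inner p (T p) (T p)
  (∑ μ, 2 * (gN.inner (F (f p)) (B (df (T p)) (df (e p μ))) (B (df (T p)) (df (e p μ))) +
      gN.inner (F (f p)) (B (ν p) (df (e p μ))) (B (ν p) (df (e p μ))) * normT)) -
    ∑ μ, (gN.inner (F (f p)) (B (df (T p)) (df (T p))) (B (df (e p μ)) (df (e p μ))) +
      gN.inner (F (f p)) (B (ν p) (ν p)) (B (df (e p μ)) (df (e p μ))) * normT)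

end Test

end TraceFormula

end

open TraceFormula

/-! The pairings with an orthogonal basis `X_c` of `𝔤` give a map `J : TN → ℝ^D`, `u ↦ (⟨u,
X_c†⟩)_c`. Under the identification `ℝ^D ≅ 𝔤` it sends `u ∈ T_qN` to its lift in `𝔫_q`. Indeed the
geodesic symmetry at `q` induces an involution of `𝔤` that preserves the Killing form, so `𝔫_q`
(eigenvalue `-1`) is orthogonal to the Killing fields vanishing at `q` (eigenvalue `+1`). As the
metric is canonical, `J` is isometric. Through `J`, tangent fields of `N`, `M` and `Σ` become
vector-valued functions, as they would for an isometric embedding in a Euclidean space.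

`J` need not be the differential of a map, but its exterior derivative is orthogonal to its image,
because the one-form dual to an element of `𝔫_q` is closed at `q`. This is all that Koszul's formula
needs: the tangential part of the derivative of `J` is the Levi-Civita connection
(`Flattening.mvfderiv_J`), and the normal part `II` satisfies the Gauss equation
(`Flattening.inner_curvature`). Both properties pass to immersed manifolds (`Flattening.pullback`).
The difference from an embedding is that `II` need not be symmetric. On `N` it is antisymmetric
(`flattening_II_antisymm`), since it is computed from the covariant derivatives of Killing fields at
their zeros, and these are skew. The Gauss equation then reads `|II(x, y)|² = ⟨R̄(y, x)x, y⟩` on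
`N`, which is how `R̄` enters the trace formula.

The test function `φ_{T,v}` is the inner product of `v` with the bivector `Jν ∧ JT` of the fixed
space `∧²𝔤`. Write `D` for the derivative of vector-valued functions and `A(u, w)` for `⟨A(u, w),
ν⟩`. Parseval's identity gives `∑ φ² = |T|²` and `∑ dφ(u)² = |D_u(Jν) ∧ JT + Jν ∧ D_u(JT)|² =
|D_u(Jν)|²|T|² + |D_u(JT)|² - 2 A(u, T)²`. Here `|D_u(Jν)|² = ∑ A(u, e_μ)² + |II(u, ν)|²` and
`|D_u(JT)|² = |∇_uT|² + A(u, T)² + |II(u, T)|²`, with `II` that of `M`. After summing over `u = e_μ`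
the term `|A|²|T|²` cancels the potential of the index form (`sum_indexDensity`), leaving `|∇T|² - ∑
A(e_μ, T)² + ∑ (|II(e_μ, T)|² + |II(e_μ, ν)|²|T|²) - Ric(ν, ν)|T|²`.

For `T = ω^♯`, Bochner's formula and the Gauss equation of the minimal hypersurface `Σ` turn the
first two terms into `Δ(½|ω|²) - ∑ ⟨R^M(T, e_μ)e_μ, T⟩`. Since `|II(x, y)|²` on `M` is `|B(x, y)|² +
⟨R̄(y, x)x, y⟩`, the trace of the index density is pointwise a Laplacian plus the first integrand
(`sum_indexDensity_eq`), and the Laplacian integrates to zero (`integral_laplacian`). The second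
integrand equals the first by the Gauss equation of `M` in `N`. -/

noncomputable section

namespace TraceFormula

set_option linter.unusedSectionVars false

/-! ### Levi-Civita calculus and Bochner's formula in a coordinate domain. -/

section CoordinateCalculus

variable {n : ℕ}

theorem partialD_mul {f g : Euc n → ℝ} {y : Euc n} (hf : DifferentiableAt ℝ f y)
    (hg : DifferentiableAt ℝ g y) (i : Fin n) :
    partialD i (fun z ↦ f z * g z) y = f y * partialD i g y + partialD i f y * g y := by
  simp only [partialD]
  rw [fderiv_fun_mul hf hg]
  simp [mul_comm]

theorem partialD_sub {f g : Euc n → ℝ} {y : Euc n} (hf : DifferentiableAt ℝ f y)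
    (hg : DifferentiableAt ℝ g y) (i : Fin n) :
    partialD i (fun z ↦ f z - g z) y = partialD i f y - partialD i g y := by
  simp only [partialD]
  rw [fderiv_fun_sub hf hg]
  simp

theorem partialD_neg (f : Euc n → ℝ) (y : Euc n) (i : Fin n) :
    partialD i (fun z ↦ -f z) y = -partialD i f y := by
  simp only [partialD]
  rw [fderiv_fun_neg]
  simp

theorem partialD_const_mul {f : Euc n → ℝ} {y : Euc n} (c : ℝ) (hf : DifferentiableAt ℝ f y)
    (i : Fin n) : partialD i (fun z ↦ c * f z) y = c * partialD i f y := by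
  simp only [partialD]
  rw [fderiv_const_mul hf]
  simp

theorem partialD_sum {ι : Type*} {s : Finset ι} {f : ι → Euc n → ℝ} {y : Euc n}
    (hf : ∀ a ∈ s, DifferentiableAt ℝ (f a) y) (i : Fin n) :
    partialD i (fun z ↦ ∑ a ∈ s, f a z) y = ∑ a ∈ s, partialD i (f a) y := by
  simp only [partialD]
  rw [fderiv_fun_sum hf]
  simp

theorem partialD_congr {f g : Euc n → ℝ} {U : Set (Euc n)} (hU : IsOpen U) {y : Euc n}
    (hy : y ∈ U) (h : ∀ z ∈ U, f z = g z) (i : Fin n) : partialD i f y = partialD i g y := by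
  have : f =ᶠ[nhds y] g := Filter.eventuallyEq_of_mem (hU.mem_nhds hy) h
  simp only [partialD, this.fderiv_eq]

theorem contDiffOn_partialD {f : Euc n → ℝ} {U : Set (Euc n)} (hU : IsOpen U)
    (hf : ContDiffOn ℝ ∞ f U) (i : Fin n) : ContDiffOn ℝ ∞ (partialD i f) U :=
  (hf.fderiv_of_isOpen hU (by simp)).clm_apply contDiffOn_const

theorem partialD_comm {f : Euc n → ℝ} {U : Set (Euc n)} (hU : IsOpen U)
    (hf : ContDiffOn ℝ ∞ f U) {y : Euc n} (hy : y ∈ U) (i j : Fin n) :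
    partialD i (partialD j f) y = partialD j (partialD i f) y := by
  have hd : DifferentiableAt ℝ (fderiv ℝ f) y :=
    ((hf.fderiv_of_isOpen (m := ∞) hU (by simp)).contDiffAt (hU.mem_nhds hy)).differentiableAt
      (by simp)
  have e : ∀ i j : Fin n, partialD i (partialD j f) y =
      fderiv ℝ (fderiv ℝ f) y (stdVec i) (stdVec j) := by
    intro i j
    change fderiv ℝ (fun z ↦ fderiv ℝ f z (stdVec j)) y (stdVec i) = _
    rw [fderiv_clm_apply hd (differentiableAt_const _)]
    simp
  rw [e, e]
  exact (((hf.contDiffAt (hU.mem_nhds hy)).of_le minSmoothness_two_le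
    ).isSymmSndFDerivAt le_rfl) _ _

theorem differentiableAt_of_contDiffOn {E : Type*} [NormedAddCommGroup E] [NormedSpace ℝ E]
    {f : Euc n → E} {U : Set (Euc n)} (hU : IsOpen U)
    (hf : ContDiffOn ℝ ∞ f U) {y : Euc n} (hy : y ∈ U) : DifferentiableAt ℝ f y :=
  (hf.contDiffAt (hU.mem_nhds hy)).differentiableAt (by simp)

/-- `h` is a smooth field of nondegenerate symmetric matrices on the open set `U`. -/
structure IsMetricOn (h : Euc n → Matrix (Fin n) (Fin n) ℝ) (U : Set (Euc n)) : Prop where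
  isOpen : IsOpen U
  smooth : ∀ i j, ContDiffOn ℝ ∞ (fun z ↦ h z i j) U
  symm : ∀ z ∈ U, ∀ i j, h z i j = h z j i
  det_ne_zero : ∀ z ∈ U, (h z).det ≠ 0

theorem contDiffOn_det {h : Euc n → Matrix (Fin n) (Fin n) ℝ} {U : Set (Euc n)}
    (hs : ∀ i j, ContDiffOn ℝ ∞ (fun z ↦ h z i j) U) : ContDiffOn ℝ ∞ (fun z ↦ (h z).det) U := by
  simp only [Matrix.det_apply]
  refine ContDiffOn.sum fun σ _ ↦ ContDiffOn.const_smul _ ?_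
  exact contDiffOn_prod fun i _ ↦ hs _ _

/-- Jacobi's formula for the derivative of a determinant. -/
theorem partialD_det {h : Euc n → Matrix (Fin n) (Fin n) ℝ} {y : Euc n}
    (hs : ∀ i j, DifferentiableAt ℝ (fun z ↦ h z i j) y) (hdet : (h y).det ≠ 0) (k : Fin n) :
    partialD k (fun z ↦ (h z).det) y =
      (h y).det * ∑ i, ∑ j, (h y)⁻¹ j i * partialD k (fun z ↦ h z i j) y := by
  -- The determinant is multilinear in the rows, so its derivative is a sum of determinants with one
  -- row differentiated. Cramer's rule rewrites these with the adjugate, which is `det • h⁻¹`.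
  let D : ContinuousMultilinearMap ℝ (fun _ : Fin n ↦ Fin n → ℝ) ℝ :=
    ⟨(Matrix.detRowAlternating (n := Fin n) (R := ℝ)).toMultilinearMap,
      Continuous.matrix_det (A := fun x : Fin n → Fin n → ℝ ↦ Matrix.of x) continuous_id⟩
  have hd : HasFDerivAt (fun z ↦ (fun i j ↦ h z i j : Fin n → Fin n → ℝ))
      (ContinuousLinearMap.pi fun i ↦ ContinuousLinearMap.pi fun j ↦
        fderiv ℝ (fun z ↦ h z i j) y) y :=
    hasFDerivAt_pi.2 fun i ↦ hasFDerivAt_pi.2 fun j ↦ (hs i j).hasFDerivAt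
  have h1 : HasFDerivAt (fun z ↦ (h z).det) _ y := (D.hasFDerivAt _).comp y hd
  have h2 : fderiv ℝ (fun z ↦ (h z).det) y (stdVec k) =
      ∑ i, ((h y).updateRow i (fun j ↦ partialD k (fun z ↦ h z i j) y)).det := by
    rw [h1.fderiv]
    exact ContinuousMultilinearMap.linearDeriv_apply _ _ _
  have hadj : (h y).adjugate = (h y).det • (h y)⁻¹ := by
    rw [Matrix.inv_def, smul_smul, Ring.inverse_eq_inv', mul_inv_cancel₀ hdet, one_smul]
  rw [partialD, h2, Finset.mul_sum]
  refine Finset.sum_congr rfl fun i _ ↦ ?_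
  rw [← Matrix.cramer_transpose_apply, Matrix.cramer_eq_adjugate_mulVec, ← Matrix.adjugate_transpose,
    hadj]
  simp [Matrix.mulVec, dotProduct, Finset.mul_sum, mul_assoc]

namespace IsMetricOn

variable {h : Euc n → Matrix (Fin n) (Fin n) ℝ} {U : Set (Euc n)} (H : IsMetricOn h U)
include H

theorem contDiffOn_inv (i j : Fin n) : ContDiffOn ℝ ∞ (fun z ↦ (h z)⁻¹ i j) U := by
  simp only [Matrix.inv_def, Ring.inverse_eq_inv', Matrix.smul_apply, smul_eq_mul]
  refine ((contDiffOn_det H.smooth).inv H.det_ne_zero).mul ?_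
  simp only [Matrix.adjugate_apply]
  refine contDiffOn_det fun a b ↦ ?_
  by_cases hab : a = j
  · subst hab
    simpa using contDiffOn_const
  · simpa [Matrix.updateRow_ne hab] using H.smooth a b

theorem contDiffOn_christoffel (k i j : Fin n) : ContDiffOn ℝ ∞ (christoffel h k i j) U := by
  refine contDiffOn_const.mul (ContDiffOn.sum fun l _ ↦ (H.contDiffOn_inv k l).mul ?_)
  exact ((contDiffOn_partialD H.isOpen (H.smooth _ _) _).add
    (contDiffOn_partialD H.isOpen (H.smooth _ _) _)).sub
    (contDiffOn_partialD H.isOpen (H.smooth _ _) _)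

theorem isUnit_det {y : Euc n} (hy : y ∈ U) : IsUnit (h y).det :=
  (H.det_ne_zero y hy).isUnit

theorem inv_symm {y : Euc n} (hy : y ∈ U) (i j : Fin n) : (h y)⁻¹ i j = (h y)⁻¹ j i := by
  have : (h y).transpose = h y := by
    ext a b
    exact H.symm y hy b a
  conv_lhs => rw [← this, ← Matrix.transpose_nonsing_inv]
  rfl

theorem christoffel_symm {y : Euc n} (hy : y ∈ U) (k i j : Fin n) :
    christoffel h k i j y = christoffel h k j i y := by
  simp only [christoffel]
  congr 1
  refine Finset.sum_congr rfl fun l _ ↦ ?_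
  rw [partialD_congr H.isOpen hy (fun z hz ↦ H.symm z hz i j) l]
  ring

/-- Lowering the upper index cancels `h⁻¹`. In this form Koszul's formula can be differentiated and
compared with other expressions of the connection. -/
theorem sum_mul_christoffel {y : Euc n} (hy : y ∈ U) (l i j : Fin n) :
    ∑ k, h y l k * christoffel h k i j y =
      (1 / 2) * (partialD i (fun z ↦ h z j l) y + partialD j (fun z ↦ h z i l) y -
        partialD l (fun z ↦ h z i j) y) := by
  let v : Fin n → ℝ := fun l ↦ (1 / 2) * (partialD i (fun z ↦ h z j l) y +
    partialD j (fun z ↦ h z i l) y - partialD l (fun z ↦ h z i j) y)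
  have e : (fun k ↦ christoffel h k i j y) = (h y)⁻¹.mulVec v := by
    ext k
    simp only [christoffel, Matrix.mulVec, dotProduct, v, Finset.mul_sum]
    refine Finset.sum_congr rfl fun l _ ↦ ?_
    ring
  have e2 : (h y).mulVec (fun k ↦ christoffel h k i j y) = v := by
    rw [e, Matrix.mulVec_mulVec, Matrix.mul_nonsing_inv _ (H.isUnit_det hy), Matrix.one_mulVec]
  exact congrFun e2 l

/-- Metric compatibility of the Levi-Civita connection. -/
theorem partialD_metric {y : Euc n} (hy : y ∈ U) (k i j : Fin n) :
    partialD k (fun z ↦ h z i j) y =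
      ∑ a, h y j a * christoffel h a k i y + ∑ a, h y i a * christoffel h a k j y := by
  rw [H.sum_mul_christoffel hy, H.sum_mul_christoffel hy,
    partialD_congr H.isOpen hy (fun z hz ↦ H.symm z hz j i) k,
    partialD_congr H.isOpen hy (fun z hz ↦ H.symm z hz k j) i,
    partialD_congr H.isOpen hy (fun z hz ↦ H.symm z hz k i) j]
  rw [partialD_congr H.isOpen hy (fun z hz ↦ H.symm z hz i k) j,
    partialD_congr H.isOpen hy (fun z hz ↦ H.symm z hz j k) i,
    partialD_congr H.isOpen hy (fun z hz ↦ H.symm z hz k i) j]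
  ring

/-- Differentiating `h⁻¹h = 1` and inserting metric compatibility of `h` shows that `h⁻¹` is
parallel too. -/
theorem partialD_inv {y : Euc n} (hy : y ∈ U) (k i j : Fin n) :
    partialD k (fun z ↦ (h z)⁻¹ i j) y =
      -(∑ a, (h y)⁻¹ i a * christoffel h j k a y + ∑ a, christoffel h i k a y * (h y)⁻¹ a j) := by
  let D : Matrix (Fin n) (Fin n) ℝ := .of fun i j ↦ partialD k (fun z ↦ (h z)⁻¹ i j) y
  let dH : Matrix (Fin n) (Fin n) ℝ := .of fun i j ↦ partialD k (fun z ↦ h z i j) y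
  let G : Matrix (Fin n) (Fin n) ℝ := .of fun a b ↦ christoffel h a k b y
  have hu := H.isUnit_det hy
  have e1 : dH = G.transpose * h y + h y * G := by
    ext a b
    simp only [dH, G, Matrix.add_apply, Matrix.mul_apply, Matrix.of_apply, Matrix.transpose_apply]
    rw [H.partialD_metric hy]
    congr 1
    refine Finset.sum_congr rfl fun c _ ↦ ?_
    rw [H.symm y hy b c, mul_comm]
  have e2 : D * h y + (h y)⁻¹ * dH = 0 := by
    ext a b
    have hd1 : ∀ c, DifferentiableAt ℝ (fun z ↦ (h z)⁻¹ a c) y := fun c ↦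
      differentiableAt_of_contDiffOn H.isOpen (H.contDiffOn_inv a c) hy
    have hd2 : ∀ c, DifferentiableAt ℝ (fun z ↦ h z c b) y := fun c ↦
      differentiableAt_of_contDiffOn H.isOpen (H.smooth c b) hy
    have : partialD k (fun z ↦ ∑ c, (h z)⁻¹ a c * h z c b) y = 0 := by
      rw [partialD_congr (g := fun _ ↦ (1 : Matrix (Fin n) (Fin n) ℝ) a b) H.isOpen hy]
      · simp [partialD]
      · intro z hz
        rw [← Matrix.mul_apply, Matrix.nonsing_inv_mul _ (H.isUnit_det hz)]
    rw [partialD_sum (fun c _ ↦ (hd1 c).fun_mul (hd2 c))] at this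
    simp only [partialD_mul (hd1 _) (hd2 _)] at this
    rw [Finset.sum_add_distrib] at this
    simp only [D, dH, Matrix.add_apply, Matrix.mul_apply, Matrix.of_apply, Matrix.zero_apply]
    rw [add_comm]
    exact this
  have e3 : D = -((h y)⁻¹ * G.transpose + G * (h y)⁻¹) := by
    have : D * h y * (h y)⁻¹ = -((h y)⁻¹ * dH) * (h y)⁻¹ := by
      rw [eq_neg_of_add_eq_zero_left e2]
    rw [Matrix.mul_assoc, Matrix.mul_nonsing_inv _ hu, Matrix.mul_one] at this
    rw [this, e1, Matrix.mul_add, ← Matrix.mul_assoc (h y)⁻¹ (h y), Matrix.nonsing_inv_mul _ hu,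
      Matrix.one_mul, ← Matrix.mul_assoc, Matrix.neg_mul, Matrix.add_mul, Matrix.mul_assoc _ (h y),
      Matrix.mul_nonsing_inv _ hu, Matrix.mul_one]
  have := congrFun (congrFun e3 i) j
  simpa [D, G, Matrix.mul_apply, add_comm] using this

/-- Differentiating the trace of a covariant two-tensor. -/
theorem partialD_trace {β : Fin n → Fin n → Euc n → ℝ} (hβ : ∀ i j, ContDiffOn ℝ ∞ (β i j) U)
    {y : Euc n} (hy : y ∈ U) (k : Fin n) :
    partialD k (fun z ↦ ∑ i, ∑ j, (h z)⁻¹ i j * β i j z) y =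
      ∑ i, ∑ j, (h y)⁻¹ i j * covTwoForm h β k i j y := by
  have hd1 : ∀ i j, DifferentiableAt ℝ (fun z ↦ (h z)⁻¹ i j) y := fun i j ↦
    differentiableAt_of_contDiffOn H.isOpen (H.contDiffOn_inv i j) hy
  have hd2 : ∀ i j, DifferentiableAt ℝ (β i j) y := fun i j ↦
    differentiableAt_of_contDiffOn H.isOpen (hβ i j) hy
  rw [partialD_sum fun i _ ↦ DifferentiableAt.fun_sum fun j _ ↦ (hd1 i j).fun_mul (hd2 i j)]
  simp only [partialD_sum (s := Finset.univ) (fun j _ ↦ (hd1 _ j).fun_mul (hd2 _ j)),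
    partialD_mul (hd1 _ _) (hd2 _ _), H.partialD_inv hy, covTwoForm]
  have e1 : ∑ i, ∑ j, (∑ a, (h y)⁻¹ i a * christoffel h j k a y) * β i j y =
      ∑ i, ∑ j, (h y)⁻¹ i j * ∑ a, christoffel h a k j y * β i a y := by
    refine Finset.sum_congr rfl fun i _ ↦ ?_
    simp only [Finset.sum_mul, Finset.mul_sum]
    rw [Finset.sum_comm]
    simp only [mul_assoc]
  have e2 : ∑ i, ∑ j, (∑ a, christoffel h i k a y * (h y)⁻¹ a j) * β i j y =
      ∑ i, ∑ j, (h y)⁻¹ i j * ∑ a, christoffel h a k i y * β a j y := by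
    rw [Finset.sum_comm, Finset.sum_comm (f := fun i j ↦ (h y)⁻¹ i j * _)]
    refine Finset.sum_congr rfl fun j _ ↦ ?_
    simp only [Finset.sum_mul, Finset.mul_sum]
    rw [Finset.sum_comm]
    refine Finset.sum_congr rfl fun a _ ↦ Finset.sum_congr rfl fun b _ ↦ ?_
    ring
  simp only [neg_mul, add_mul, mul_sub, Finset.sum_add_distrib, Finset.sum_sub_distrib,
    Finset.sum_neg_distrib, mul_add, e1, e2, neg_add_rev]
  ring

variable {α : Fin n → Euc n → ℝ} (hα : ∀ i, ContDiffOn ℝ ∞ (α i) U)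
include hα

theorem contDiffOn_covForm (i j : Fin n) : ContDiffOn ℝ ∞ (covForm h α i j) U :=
  (contDiffOn_partialD H.isOpen (hα j) i).sub
    (ContDiffOn.sum fun a _ ↦ (H.contDiffOn_christoffel a i j).mul (hα a))

omit hα in
theorem extDerivOne_eq {y : Euc n} (hy : y ∈ U) (i j : Fin n) :
    extDerivOne α i j y = covForm h α i j y - covForm h α j i y := by
  simp only [extDerivOne, covForm, H.christoffel_symm hy _ i j]
  ring

theorem covTwoForm_extDerivOne {y : Euc n} (hy : y ∈ U) (i j k : Fin n) :
    covTwoForm h (extDerivOne α) i j k y =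
      covTwoForm h (covForm h α) i j k y - covTwoForm h (covForm h α) i k j y := by
  have hd : ∀ j k, DifferentiableAt ℝ (covForm h α j k) y := fun j k ↦
    differentiableAt_of_contDiffOn H.isOpen (H.contDiffOn_covForm hα j k) hy
  simp only [covTwoForm, partialD_congr H.isOpen hy (fun z hz ↦ H.extDerivOne_eq (α := α) hz j k),
    partialD_sub (hd _ _) (hd _ _), H.extDerivOne_eq hy, mul_sub, Finset.sum_add_distrib,
    Finset.sum_sub_distrib]
  ring

/-- The Ricci identity for one-forms. -/
theorem covTwoForm_covForm_comm {y : Euc n} (hy : y ∈ U) (i k j : Fin n) :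
    covTwoForm h (covForm h α) i k j y - covTwoForm h (covForm h α) k i j y =
      -∑ a, curvatureCoeff h a i k j y * α a y := by
  have hd1 : ∀ a i j, DifferentiableAt ℝ (christoffel h a i j) y := fun a i j ↦
    differentiableAt_of_contDiffOn H.isOpen (H.contDiffOn_christoffel a i j) hy
  have hd2 : ∀ a, DifferentiableAt ℝ (α a) y := fun a ↦
    differentiableAt_of_contDiffOn H.isOpen (hα a) hy
  have hd3 : ∀ a k, DifferentiableAt ℝ (partialD k (α a)) y := fun a k ↦
    differentiableAt_of_contDiffOn H.isOpen (contDiffOn_partialD H.isOpen (hα a) k) hy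
  have e : ∀ i k, partialD i (covForm h α k j) y = partialD i (partialD k (α j)) y -
      ∑ a, (christoffel h a k j y * partialD i (α a) y +
        partialD i (christoffel h a k j) y * α a y) := by
    intro i k
    change partialD i (fun z ↦ partialD k (α j) z - ∑ a, christoffel h a k j z * α a z) y = _
    rw [partialD_sub (hd3 _ _) (DifferentiableAt.fun_sum fun a _ ↦ (hd1 a k j).fun_mul (hd2 a)),
      partialD_sum fun a _ ↦ (hd1 a k j).fun_mul (hd2 a)]
    simp only [partialD_mul (hd1 _ _ _) (hd2 _)]
  have e2 : ∀ i k, ∑ a, christoffel h a i j y * covForm h α k a y =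
      ∑ a, christoffel h a i j y * partialD k (α a) y -
        ∑ a, (∑ b, christoffel h a k b y * christoffel h b i j y) * α a y := by
    intro i k
    simp only [covForm, mul_sub, Finset.sum_sub_distrib, Finset.mul_sum, Finset.sum_mul]
    congr 1
    rw [Finset.sum_comm]
    refine Finset.sum_congr rfl fun a _ ↦ Finset.sum_congr rfl fun b _ ↦ ?_
    ring
  simp only [covTwoForm, e, Finset.sum_add_distrib, e2, curvatureCoeff, sub_mul, add_mul,
    Finset.sum_sub_distrib, partialD_comm H.isOpen (hα j) hy k i, H.christoffel_symm hy _ k i]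
  ring

/-- For a harmonic one-form, the rough Laplacian is given by the curvature. -/
theorem trace_covTwoForm_of_harmonic {y : Euc n} (hy : y ∈ U)
    (hharm : ∀ k, coordHodgeLaplacian h α k y = 0) (k : Fin n) :
    ∑ i, ∑ j, (h y)⁻¹ i j * covTwoForm h (covForm h α) i j k y =
      -∑ i, ∑ j, (h y)⁻¹ i j * ∑ a, curvatureCoeff h a i k j y * α a y := by
  have h0 := hharm k
  have e1 : partialD k (codiffOne h α) y =
      -∑ i, ∑ j, (h y)⁻¹ i j * covTwoForm h (covForm h α) k i j y := by
    rw [← H.partialD_trace (H.contDiffOn_covForm hα) hy, ← partialD_neg]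
    rfl
  -- The Ricci identity reorders `∇_i∇_k α_j` in the term coming from `δd`. The reordered trace
  -- `h^{ij}∇_k∇_i α_j` is cancelled by `dδ`, and only the curvature and the rough Laplacian remain.
  have e2 : ∀ i j, (h y)⁻¹ i j * covTwoForm h (covForm h α) i k j y =
      (h y)⁻¹ i j * covTwoForm h (covForm h α) k i j y -
      (h y)⁻¹ i j * ∑ a, curvatureCoeff h a i k j y * α a y := by
    intro i j
    rw [← mul_sub]
    congr 1
    linarith [H.covTwoForm_covForm_comm hα hy i k j]
  rw [coordHodgeLaplacian, e1, codiffTwo] at h0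
  simp only [H.covTwoForm_extDerivOne hα hy, mul_sub, Finset.sum_sub_distrib, e2] at h0
  linarith

end IsMetricOn

/-- The Laplacian `∑_ij h^{ij} (∂_i ∂_j f - ∑_k Γ^k_ij ∂_k f)` of a function. -/
def coordLaplacian (h : Euc n → Matrix (Fin n) (Fin n) ℝ) (f : Euc n → ℝ) (y : Euc n) : ℝ :=
  ∑ i, ∑ j, (h y)⁻¹ i j *
    (partialD i (partialD j f) y - ∑ k, christoffel h k i j y * partialD k f y)

/-- The function `½ |α|²`. -/
def coordHalfNormSq (h : Euc n → Matrix (Fin n) (Fin n) ℝ) (α : Fin n → Euc n → ℝ) (y : Euc n) :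
    ℝ :=
  (1 / 2) * ∑ i, ∑ j, (h y)⁻¹ i j * (α i y * α j y)

namespace IsMetricOn

variable {h : Euc n → Matrix (Fin n) (Fin n) ℝ} {U : Set (Euc n)} (H : IsMetricOn h U)
include H

section Bochner

variable {α : Fin n → Euc n → ℝ} (hα : ∀ i, ContDiffOn ℝ ∞ (α i) U)
include hα

theorem partialD_halfNormSq {y : Euc n} (hy : y ∈ U) (k : Fin n) :
    partialD k (coordHalfNormSq h α) y =
      ∑ i, ∑ j, (h y)⁻¹ i j * (α i y * covForm h α k j y) := by
  have hd2 : ∀ a, DifferentiableAt ℝ (α a) y := fun a ↦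
    differentiableAt_of_contDiffOn H.isOpen (hα a) hy
  have hs : ∀ i j, ContDiffOn ℝ ∞ (fun z ↦ α i z * α j z) U := fun i j ↦ (hα i).mul (hα j)
  have hs' : ContDiffOn ℝ ∞ (fun z ↦ ∑ i, ∑ j, (h z)⁻¹ i j * (α i z * α j z)) U :=
    ContDiffOn.sum fun i _ ↦ ContDiffOn.sum fun j _ ↦ (H.contDiffOn_inv i j).mul (hs i j)
  have e1 : partialD k (coordHalfNormSq h α) y = (1 / 2) * ∑ i, ∑ j, (h y)⁻¹ i j *
      (covForm h α k i y * α j y + α i y * covForm h α k j y) := by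
    change partialD k (fun z ↦ (1 / 2) * ∑ i, ∑ j, (h z)⁻¹ i j * (α i z * α j z)) y = _
    rw [partialD_const_mul _ (differentiableAt_of_contDiffOn H.isOpen hs' hy),
      H.partialD_trace (β := fun i j z ↦ α i z * α j z) hs hy]
    congr 1
    refine Finset.sum_congr rfl fun i _ ↦ Finset.sum_congr rfl fun j _ ↦ ?_
    congr 1
    simp only [covTwoForm, partialD_mul (hd2 _) (hd2 _), covForm, sub_mul, mul_sub,
      Finset.sum_add_distrib, Finset.sum_mul, Finset.mul_sum, mul_assoc, mul_left_comm (α i y)]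
    ring
  have e2 : ∑ i, ∑ j, (h y)⁻¹ i j * (covForm h α k i y * α j y) =
      ∑ i, ∑ j, (h y)⁻¹ i j * (α i y * covForm h α k j y) := by
    rw [Finset.sum_comm]
    refine Finset.sum_congr rfl fun i _ ↦ Finset.sum_congr rfl fun j _ ↦ ?_
    rw [H.inv_symm hy]
    ring
  rw [e1]
  simp only [mul_add, Finset.sum_add_distrib, e2]
  ring

/-- Since `h⁻¹` is parallel, this is the product rule for covariant derivatives, applied once more
to the formula for the gradient. -/
theorem hessian_halfNormSq {y : Euc n} (hy : y ∈ U) (l k : Fin n) :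
    partialD l (partialD k (coordHalfNormSq h α)) y -
        ∑ a, christoffel h a l k y * partialD a (coordHalfNormSq h α) y =
      ∑ i, ∑ j, (h y)⁻¹ i j * (covForm h α l i y * covForm h α k j y) +
      ∑ i, ∑ j, (h y)⁻¹ i j * (α i y * covTwoForm h (covForm h α) l k j y) := by
  have hd2 : ∀ a, DifferentiableAt ℝ (α a) y := fun a ↦
    differentiableAt_of_contDiffOn H.isOpen (hα a) hy
  have hd3 : ∀ j k, DifferentiableAt ℝ (covForm h α j k) y := fun j k ↦
    differentiableAt_of_contDiffOn H.isOpen (H.contDiffOn_covForm hα j k) hy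
  have hs : ∀ i j, ContDiffOn ℝ ∞ (fun z ↦ α i z * covForm h α k j z) U := fun i j ↦
    (hα i).mul (H.contDiffOn_covForm hα k j)
  rw [partialD_congr H.isOpen hy (fun z hz ↦ H.partialD_halfNormSq hα hz k),
    H.partialD_trace (β := fun i j z ↦ α i z * covForm h α k j z) hs hy]
  have e1 : ∀ i j, covTwoForm h (fun i j z ↦ α i z * covForm h α k j z) l i j y =
      covForm h α l i y * covForm h α k j y + (α i y * covTwoForm h (covForm h α) l k j y +
        α i y * ∑ a, christoffel h a l k y * covForm h α a j y) := by
    intro i j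
    have : covForm h α l i y * covForm h α k j y =
        partialD l (α i) y * covForm h α k j y -
          ∑ a, christoffel h a l i y * (α a y * covForm h α k j y) := by
      conv_lhs => rw [covForm, sub_mul, Finset.sum_mul]
      simp only [mul_assoc]
    simp only [covTwoForm, partialD_mul (hd2 _) (hd3 _ _), this, Finset.sum_add_distrib,
      Finset.mul_sum, mul_sub, mul_add, mul_left_comm (α i y)]
    ring
  have e2 : ∑ a, christoffel h a l k y * partialD a (coordHalfNormSq h α) y =
      ∑ i, ∑ j, (h y)⁻¹ i j * (α i y * ∑ a, christoffel h a l k y * covForm h α a j y) := by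
    simp only [H.partialD_halfNormSq hα hy, Finset.mul_sum]
    rw [Finset.sum_comm]
    refine Finset.sum_congr rfl fun i _ ↦ ?_
    rw [Finset.sum_comm]
    refine Finset.sum_congr rfl fun j _ ↦ Finset.sum_congr rfl fun a _ ↦ ?_
    ring
  simp only [e1, e2, mul_add, Finset.sum_add_distrib]
  ring

/-- Bochner's formula for a harmonic one-form. -/
theorem coordLaplacian_halfNormSq {y : Euc n} (hy : y ∈ U)
    (hharm : ∀ k, coordHodgeLaplacian h α k y = 0) :
    coordLaplacian h (coordHalfNormSq h α) y =
      ∑ l, ∑ k, (h y)⁻¹ l k * ∑ i, ∑ j, (h y)⁻¹ i j * (covForm h α l i y * covForm h α k j y) -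
      ∑ i, ∑ j, (h y)⁻¹ i j * (α i y *
        ∑ l, ∑ k, (h y)⁻¹ l k * ∑ a, curvatureCoeff h a l j k y * α a y) := by
  simp only [coordLaplacian, H.hessian_halfNormSq hα hy, mul_add, Finset.sum_add_distrib]
  rw [sub_eq_add_neg]
  congr 1
  have e : ∀ j, ∑ l, ∑ k, (h y)⁻¹ l k * ∑ a, curvatureCoeff h a l j k y * α a y =
      -∑ l, ∑ k, (h y)⁻¹ l k * covTwoForm h (covForm h α) l k j y := by
    intro j
    rw [H.trace_covTwoForm_of_harmonic hα hy hharm, neg_neg]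
  simp only [e, mul_neg, Finset.sum_neg_distrib, neg_neg]
  simp only [Finset.mul_sum]
  -- Packing each pair of indices into one lets a single exchange of sums swap the two traces.
  calc ∑ l, ∑ k, ∑ i, ∑ j, (h y)⁻¹ l k * ((h y)⁻¹ i j * (α i y * covTwoForm h (covForm h α) l k j y))
      = ∑ x : Fin n × Fin n, ∑ z : Fin n × Fin n, (h y)⁻¹ x.1 x.2 *
          ((h y)⁻¹ z.1 z.2 * (α z.1 y * covTwoForm h (covForm h α) x.1 x.2 z.2 y)) := by
        simp only [Fintype.sum_prod_type]
    _ = ∑ z : Fin n × Fin n, ∑ x : Fin n × Fin n, (h y)⁻¹ z.1 z.2 *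
          (α z.1 y * ((h y)⁻¹ x.1 x.2 * covTwoForm h (covForm h α) x.1 x.2 z.2 y)) := by
        rw [Finset.sum_comm]
        refine Finset.sum_congr rfl fun i _ ↦ Finset.sum_congr rfl fun j _ ↦ ?_
        ring
    _ = _ := by simp only [Fintype.sum_prod_type]

end Bochner

/-- The Laplacian in divergence form. -/
theorem sqrt_det_mul_coordLaplacian (hpos : ∀ z ∈ U, 0 < (h z).det) {f : Euc n → ℝ}
    (hf : ContDiffOn ℝ ∞ f U) {y : Euc n} (hy : y ∈ U) :
    ∑ i, partialD i (fun z ↦ Real.sqrt (h z).det * ∑ j, (h z)⁻¹ i j * partialD j f z) y =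
      Real.sqrt (h y).det * coordLaplacian h f y := by
  have hdh : ∀ i j, DifferentiableAt ℝ (fun z ↦ h z i j) y := fun i j ↦
    differentiableAt_of_contDiffOn H.isOpen (H.smooth i j) hy
  have hdi : ∀ i j, DifferentiableAt ℝ (fun z ↦ (h z)⁻¹ i j) y := fun i j ↦
    differentiableAt_of_contDiffOn H.isOpen (H.contDiffOn_inv i j) hy
  have hdf : ∀ j, DifferentiableAt ℝ (partialD j f) y := fun j ↦
    differentiableAt_of_contDiffOn H.isOpen (contDiffOn_partialD H.isOpen hf j) hy
  have hdd : DifferentiableAt ℝ (fun z ↦ (h z).det) y :=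
    differentiableAt_of_contDiffOn H.isOpen (contDiffOn_det H.smooth) hy
  have hds : DifferentiableAt ℝ (fun z ↦ Real.sqrt (h z).det) y := hdd.sqrt (H.det_ne_zero y hy)
  have hsq : Real.sqrt (h y).det * Real.sqrt (h y).det = (h y).det :=
    Real.mul_self_sqrt (hpos y hy).le
  have hs0 : Real.sqrt (h y).det ≠ 0 := (Real.sqrt_pos.2 (hpos y hy)).ne'
  -- Jacobi's formula with metric compatibility: `∂_i log √det h = ∑_a Γ^a_ia`.
  have e1 : ∀ i, partialD i (fun z ↦ Real.sqrt (h z).det) y =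
      Real.sqrt (h y).det * ∑ a, christoffel h a i a y := by
    intro i
    have hdet := partialD_det hdh (H.det_ne_zero y hy) i
    have h2 : partialD i (fun z ↦ Real.sqrt (h z).det) y =
        1 / (2 * Real.sqrt (h y).det) * partialD i (fun z ↦ (h z).det) y := by
      simp only [partialD]
      rw [(hdd.hasFDerivAt.sqrt (H.det_ne_zero y hy)).fderiv]
      simp
    have h3 : ∑ a, ∑ b, (h y)⁻¹ b a * partialD i (fun z ↦ h z a b) y =
        2 * ∑ a, christoffel h a i a y := by
      have hc : ∀ c a, ∑ b, (h y)⁻¹ a b * ∑ k, h y b k * christoffel h k i c y =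
          christoffel h a i c y := by
        intro c a
        have : (h y)⁻¹.mulVec ((h y).mulVec (fun k ↦ christoffel h k i c y)) =
            fun k ↦ christoffel h k i c y := by
          rw [Matrix.mulVec_mulVec, Matrix.nonsing_inv_mul _ (H.isUnit_det hy), Matrix.one_mulVec]
        exact congrFun this a
      simp only [H.partialD_metric hy, mul_add, Finset.sum_add_distrib, two_mul]
      congr 1
      · refine Finset.sum_congr rfl fun a _ ↦ ?_
        simp only [H.inv_symm hy _ a, hc]
      · rw [Finset.sum_comm]
        exact Finset.sum_congr rfl fun a _ ↦ hc a a
    rw [h2, hdet, h3, div_mul_eq_mul_div, one_mul, div_eq_iff (mul_ne_zero two_ne_zero hs0)]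
    linear_combination (-(2 * ∑ a, christoffel h a i a y)) * hsq
  have e2 : ∀ i, partialD i (fun z ↦ Real.sqrt (h z).det * ∑ j, (h z)⁻¹ i j * partialD j f z) y =
      Real.sqrt (h y).det * (∑ j, ((h y)⁻¹ i j * partialD i (partialD j f) y -
        (∑ a, (h y)⁻¹ i a * christoffel h j i a y + ∑ a, christoffel h i i a y * (h y)⁻¹ a j) *
          partialD j f y) + (∑ a, christoffel h a i a y) * ∑ j, (h y)⁻¹ i j * partialD j f y) := by
    intro i
    rw [partialD_mul hds (DifferentiableAt.fun_sum fun j _ ↦ (hdi i j).fun_mul (hdf j)), e1,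
      partialD_sum fun j _ ↦ (hdi i j).fun_mul (hdf j)]
    simp only [partialD_mul (hdi _ _) (hdf _), H.partialD_inv hy]
    rw [mul_assoc, ← mul_add]
    congr 2
    refine Finset.sum_congr rfl fun j _ ↦ ?_
    ring
  simp only [e2, ← Finset.mul_sum, coordLaplacian]
  congr 1
  -- The derivative of `√det h` cancels one half of the derivative of `h⁻¹`. The other half is the
  -- Christoffel term of the Laplacian.
  have e3 : ∑ i, (∑ a, christoffel h a i a y) * ∑ j, (h y)⁻¹ i j * partialD j f y =
      ∑ i, ∑ j, (∑ a, christoffel h i i a y * (h y)⁻¹ a j) * partialD j f y := by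
    simp only [Finset.sum_mul, Finset.mul_sum]
    calc ∑ i, ∑ j, ∑ a, christoffel h a i a y * ((h y)⁻¹ i j * partialD j f y)
        = ∑ i, ∑ a, ∑ j, christoffel h a i a y * ((h y)⁻¹ i j * partialD j f y) :=
          Finset.sum_congr rfl fun i _ ↦ Finset.sum_comm
      _ = ∑ a, ∑ i, ∑ j, christoffel h a i a y * ((h y)⁻¹ i j * partialD j f y) := Finset.sum_comm
      _ = ∑ a, ∑ j, ∑ i, christoffel h a i a y * ((h y)⁻¹ i j * partialD j f y) :=
          Finset.sum_congr rfl fun i _ ↦ Finset.sum_comm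
      _ = _ := by
        refine Finset.sum_congr rfl fun a _ ↦ Finset.sum_congr rfl fun j _ ↦
          Finset.sum_congr rfl fun i _ ↦ ?_
        rw [H.christoffel_symm hy]
        ring
  have e4 : ∑ i, ∑ j, (∑ a, (h y)⁻¹ i a * christoffel h j i a y) * partialD j f y =
      ∑ i, ∑ j, (h y)⁻¹ i j * ∑ k, christoffel h k i j y * partialD k f y := by
    refine Finset.sum_congr rfl fun i _ ↦ ?_
    simp only [Finset.sum_mul, Finset.mul_sum]
    rw [Finset.sum_comm]
    simp only [mul_assoc]
  simp only [mul_sub, add_mul, Finset.sum_add_distrib, Finset.sum_sub_distrib, e3, e4]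
  ring

end IsMetricOn

end CoordinateCalculus

/-! ### Linear algebra of a tangent space: Gram matrices, traces and metric duals. -/

section TangentAlgebra

variable {n : ℕ} {M : Type*} [TopologicalSpace M] [ChartedSpace (Euc n) M]
  [IsManifold (𝓡 n) ∞ M]

/-- The Gram matrix of a family of tangent vectors. -/
def gramOf (g : Metric n M) (p : M) (E : Fin n → TangentSpace (𝓡 n) p) :
    Matrix (Fin n) (Fin n) ℝ :=
  .of fun i j ↦ g.inner p (E i) (E j)

theorem inner_ext (g : Metric n M) {p : M} {v w : TangentSpace (𝓡 n) p}
    (h : ∀ u, g.inner p v u = g.inner p w u) : v = w := by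
  by_contra hne
  have := g.pos p (v - w) (sub_ne_zero.2 hne)
  rw [map_sub (g.inner p), sub_apply, h, sub_self] at this
  exact lt_irrefl _ this

theorem linearIndependent_of_gramOf_det_ne_zero (g : Metric n M) {p : M}
    {E : Fin n → TangentSpace (𝓡 n) p} (hE : (gramOf g p E).det ≠ 0) : LinearIndependent ℝ E := by
  rw [Fintype.linearIndependent_iff]
  intro c hc
  have : (gramOf g p E).mulVec c = 0 := by
    ext i
    have := congrArg (fun w ↦ g.inner p (E i) w) hc
    simpa [gramOf, Matrix.mulVec, dotProduct, map_sum, mul_comm] using this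
  exact congrFun (Matrix.eq_zero_of_mulVec_eq_zero hE this)

theorem gramOf_det_pos_of_linearIndependent (g : Metric n M) {p : M}
    {E : Fin n → TangentSpace (𝓡 n) p} (hE : LinearIndependent ℝ E) : 0 < (gramOf g p E).det := by
  apply Matrix.PosDef.det_pos
  refine Matrix.PosDef.of_dotProduct_mulVec_pos ?_ ?_
  · ext i j
    simp [gramOf, g.symm p (E i)]
  · intro c hc
    have e : star c ⬝ᵥ (gramOf g p E).mulVec c =
        g.inner p (∑ i, c i • E i) (∑ i, c i • E i) := by
      simp [gramOf, Matrix.mulVec, dotProduct, map_sum, Finset.mul_sum, mul_comm]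
      exact Finset.sum_congr rfl fun i _ ↦ Finset.sum_congr rfl fun j _ ↦ by
        rw [g.symm p (E i)]
    rw [e]
    apply g.pos
    intro h0
    exact hc (funext (Fintype.linearIndependent_iff.1 hE c h0))

theorem finrank_tangentSpace (p : M) : Module.finrank ℝ (TangentSpace (𝓡 n) p) = n :=
  (finrank_euclideanSpace_fin : Module.finrank ℝ (Euc n) = n)

instance (p : M) : FiniteDimensional ℝ (TangentSpace (𝓡 n) p) :=
  inferInstanceAs (FiniteDimensional ℝ (Euc n))

theorem span_eq_top_of_gramOf_det_ne_zero (g : Metric n M) {p : M}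
    {E : Fin n → TangentSpace (𝓡 n) p} (hE : (gramOf g p E).det ≠ 0) :
    Submodule.span ℝ (Set.range E) = ⊤ :=
  (linearIndependent_of_gramOf_det_ne_zero g hE).span_eq_top_of_card_eq_finrank'
    (by simp [finrank_tangentSpace])

/-- Reconstruction of a tangent vector from its inner products with a basis. -/
theorem sum_gramOf_inv_inner_smul (g : Metric n M) {p : M}
    {E : Fin n → TangentSpace (𝓡 n) p} (hE : (gramOf g p E).det ≠ 0) (u : TangentSpace (𝓡 n) p) :
    ∑ i, ∑ j, ((gramOf g p E)⁻¹ i j * g.inner p u (E j)) • E i = u := by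
  apply inner_ext g
  intro w
  have hw : w ∈ Submodule.span ℝ (Set.range E) := by
    rw [span_eq_top_of_gramOf_det_ne_zero g hE]; trivial
  induction hw using Submodule.span_induction with
  | zero => simp
  | add x y _ _ hx hy => rw [map_add, hx, hy, map_add]
  | smul a x _ hx => rw [map_smul, hx, map_smul]
  | mem x hx =>
    obtain ⟨k, rfl⟩ := hx
    have e : ((gramOf g p E) * (gramOf g p E)⁻¹).mulVec (fun j ↦ g.inner p u (E j)) k =
        g.inner p u (E k) := by
      rw [Matrix.mul_nonsing_inv _ hE.isUnit, Matrix.one_mulVec]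
    rw [← e, ← Matrix.mulVec_mulVec]
    simp only [map_sum, map_smul, sum_apply, smul_apply, Matrix.mulVec, dotProduct, gramOf,
      Matrix.of_apply, smul_eq_mul]
    refine Finset.sum_congr rfl fun i _ ↦ ?_
    rw [Finset.mul_sum]
    refine Finset.sum_congr rfl fun j _ ↦ ?_
    rw [g.symm p (E i) (E k)]
    ring

theorem gram_eq_gramOf (g : Metric n M) (p : M) : gram g p = gramOf g p (tangentBasis p) := rfl

theorem linearIndependent_tangentBasis (p : M) : LinearIndependent ℝ (tangentBasis (n := n) p) := by
  have := (EuclideanSpace.basisFun (Fin n) ℝ).toBasis.linearIndependent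
  convert! this using 1
  ext i
  simp only [tangentBasis, OrthonormalBasis.coe_toBasis, EuclideanSpace.basisFun_apply]
  rfl

theorem gram_det_pos (g : Metric n M) (p : M) : 0 < (gram g p).det :=
  gramOf_det_pos_of_linearIndependent g (linearIndependent_tangentBasis p)

theorem gram_inv_symm (g : Metric n M) (p : M) (i j : Fin n) :
    (gram g p)⁻¹ i j = (gram g p)⁻¹ j i := by
  have : (gram g p).transpose = gram g p := by
    ext a b
    exact g.symm p _ _
  conv_lhs => rw [← this, ← Matrix.transpose_nonsing_inv]
  rfl

/-- The sum of `B(a_i, b_i)` over a pair of dual frames does not depend on the frames. -/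
theorem metricTrace_eq_sum (g : Metric n M) {p : M} {W : Type*} [AddCommGroup W] [Module ℝ W]
    (B : TangentSpace (𝓡 n) p →ₗ[ℝ] TangentSpace (𝓡 n) p →ₗ[ℝ] W) {ι : Type*} [Fintype ι]
    (a b : ι → TangentSpace (𝓡 n) p) (hab : ∀ u, ∑ i, g.inner p u (a i) • b i = u) :
    metricTrace g p (fun u v ↦ B u v) = ∑ i, B (a i) (b i) := by
  have hd := (gram_det_pos g p).ne'
  -- Duality of two frames is symmetric: the operator `u ↦ ∑ ⟨u, b_i⟩ a_i` is the adjoint of the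
  -- identity.
  have hba : ∀ u, ∑ i, g.inner p u (b i) • a i = u := by
    intro u
    apply inner_ext g
    intro w
    conv_rhs => rw [← hab w]
    simp only [map_sum, map_smul, sum_apply, smul_apply, smul_eq_mul]
    refine Finset.sum_congr rfl fun i _ ↦ ?_
    rw [g.symm p w (a i), mul_comm]
  have e : ∀ i, B (a i) (b i) = ∑ k, ∑ j, (gram g p)⁻¹ k j •
      B (g.inner p (b i) (tangentBasis p j) • a i) (tangentBasis p k) := by
    intro i
    conv_lhs => rw [← sum_gramOf_inv_inner_smul g (gram_eq_gramOf g p ▸ hd) (b i)]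
    simp only [map_sum, map_smul, smul_smul, LinearMap.smul_apply]
    rfl
  simp only [e, metricTrace]
  rw [Finset.sum_comm (γ := ι)]
  rw [Finset.sum_comm]
  refine Finset.sum_congr rfl fun k _ ↦ ?_
  rw [Finset.sum_comm (γ := ι)]
  refine Finset.sum_congr rfl fun j _ ↦ ?_
  rw [← Finset.smul_sum, gram_inv_symm]
  congr 1
  conv_lhs => rw [← hba (tangentBasis p j)]
  simp only [map_sum, LinearMap.sum_apply, g.symm p (tangentBasis p j)]

theorem metricTrace_eq_gramOf (g : Metric n M) {p : M} {W : Type*} [AddCommGroup W] [Module ℝ W]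
    (B : TangentSpace (𝓡 n) p →ₗ[ℝ] TangentSpace (𝓡 n) p →ₗ[ℝ] W)
    {E : Fin n → TangentSpace (𝓡 n) p} (hE : (gramOf g p E).det ≠ 0) :
    metricTrace g p (fun u v ↦ B u v) = ∑ i, ∑ j, (gramOf g p E)⁻¹ i j • B (E i) (E j) := by
  rw [metricTrace_eq_sum g B (ι := Fin n × Fin n) (fun x ↦ E x.2)
    (fun x ↦ (gramOf g p E)⁻¹ x.1 x.2 • E x.1)]
  · rw [Fintype.sum_prod_type, Finset.sum_comm]
    simp only [map_smul]
    have : (gramOf g p E).transpose = gramOf g p E := by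
      ext a b
      exact g.symm p _ _
    have hs : ∀ i j, (gramOf g p E)⁻¹ i j = (gramOf g p E)⁻¹ j i := by
      intro i j
      conv_lhs => rw [← this, ← Matrix.transpose_nonsing_inv]
      rfl
    exact Finset.sum_congr rfl fun i _ ↦ Finset.sum_congr rfl fun j _ ↦ by rw [hs]
  · intro u
    rw [Fintype.sum_prod_type]
    simp only [smul_smul, mul_comm]
    simpa only [mul_comm] using sum_gramOf_inv_inner_smul g hE u

theorem metricTrace_eq_orthonormal (g : Metric n M) {p : M} {W : Type*} [AddCommGroup W]
    [Module ℝ W] (B : TangentSpace (𝓡 n) p →ₗ[ℝ] TangentSpace (𝓡 n) p →ₗ[ℝ] W)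
    {e : Fin n → TangentSpace (𝓡 n) p} (he : IsOrthonormalAt g p e) :
    metricTrace g p (fun u v ↦ B u v) = ∑ i, B (e i) (e i) := by
  have hG : gramOf g p e = 1 := by
    ext i j
    simp [gramOf, he i j, Matrix.one_apply]
  rw [metricTrace_eq_gramOf g B (E := e) (by simp [hG]), hG]
  simp [Matrix.one_apply]

theorem inner_sharp (g : Metric n M) (p : M) (l : TangentSpace (𝓡 n) p →ₗ[ℝ] ℝ)
    (u : TangentSpace (𝓡 n) p) : g.inner p (sharp g p fun w ↦ l w) u = l u := by
  conv_rhs => rw [← sum_gramOf_inv_inner_smul g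
    (gram_eq_gramOf g p ▸ (gram_det_pos g p).ne') u]
  simp only [sharp, map_sum, map_smul, sum_apply, smul_apply, smul_eq_mul]
  rw [Finset.sum_comm]
  refine Finset.sum_congr rfl fun i _ ↦ Finset.sum_congr rfl fun j _ ↦ ?_
  rw [gram_inv_symm, g.symm p u, gram_eq_gramOf]
  ring

end TangentAlgebra

/-! ### Coordinate vector fields and the metric in a chart. -/

section Charts

variable {n : ℕ} {M : Type*} [TopologicalSpace M] [ChartedSpace (Euc n) M]
  [IsManifold (𝓡 n) ∞ M]

theorem contMDiffOn_mfderiv_apply {k : ℕ} {φ : Euc k → M} {U : Set (Euc k)} (hU : IsOpen U)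
    (hφ : ContMDiffOn 𝓘(ℝ, Euc k) (𝓡 n) ∞ φ U) (v : Euc k) :
    ContMDiffOn 𝓘(ℝ, Euc k) (𝓡 n).tangent ∞
      (fun z ↦ (⟨φ z, mfderiv 𝓘(ℝ, Euc k) (𝓡 n) φ z v⟩ : TangentBundle (𝓡 n) M)) U := by
  have h1 := hφ.contMDiffOn_tangentMapWithin (m := ∞) (by simp) hU.uniqueMDiffOn
  have h2 : ContMDiff 𝓘(ℝ, Euc k) 𝓘(ℝ, Euc k).tangent ∞
      (fun z : Euc k ↦ (⟨z, v⟩ : TangentBundle 𝓘(ℝ, Euc k) (Euc k))) :=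
    contMDiff_vectorSpace_iff_contDiff.2 contDiff_const
  have h3 := h1.comp (h2.contMDiffOn (s := U)) (fun z hz ↦ hz)
  refine h3.congr fun z hz ↦ ?_
  simp only [Function.comp_def, tangentMapWithin]
  rw [mfderivWithin_of_isOpen hU hz]

theorem mdifferentiableAt_extChartAt_symm {p : M} {y : Euc n}
    (hy : y ∈ (extChartAt (𝓡 n) p).target) :
    MDifferentiableAt 𝓘(ℝ, Euc n) (𝓡 n) (extChartAt (𝓡 n) p).symm y :=
  ((contMDiffOn_extChartAt_symm (n := ∞) p).contMDiffAt
    ((isOpen_extChartAt_target p).mem_nhds hy)).mdifferentiableAt (by simp)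

theorem mfderiv_extChartAt_coordVec {p : M} {y : Euc n} (hy : y ∈ (extChartAt (𝓡 n) p).target)
    (v : Euc n) :
    mfderiv (𝓡 n) 𝓘(ℝ, Euc n) (extChartAt (𝓡 n) p) ((extChartAt (𝓡 n) p).symm y)
      (coordVec p y v) = v := by
  have h := mfderiv_extChartAt_comp_mfderivWithin_extChartAt_symm (I := 𝓡 n) hy
  have h2 := congrArg (fun L ↦ L v) h
  simpa [coordVec, mfderivWithin_univ] using! h2

theorem coordVec_mfderiv_extChartAt {p : M} {y : Euc n} (hy : y ∈ (extChartAt (𝓡 n) p).target)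
    (v : TangentSpace (𝓡 n) ((extChartAt (𝓡 n) p).symm y)) :
    coordVec p y (mfderiv (𝓡 n) 𝓘(ℝ, Euc n) (extChartAt (𝓡 n) p)
      ((extChartAt (𝓡 n) p).symm y) v) = v := by
  have h := mfderivWithin_extChartAt_symm_comp_mfderiv_extChartAt (I := 𝓡 n) hy
  have h2 := congrArg (fun L ↦ L v) h
  simpa [coordVec, mfderivWithin_univ] using! h2

/-- A tangent vector at `p` is its vector of components in the preferred chart at `p`, so this chart
has the identity as derivative at its centre. -/
theorem coordVec_self (p : M) (v : Euc n) :
    (coordVec p (extChartAt (𝓡 n) p p) v : Euc n) = v := by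
  have h := mfderivWithin_range_extChartAt_symm (I := 𝓡 n) (x := p)
  have h2 := congrArg (fun L ↦ L v) h
  simpa [coordVec, mfderivWithin_univ] using! h2

theorem coordField_eq_coordVec {p : M} {y : Euc n} (hy : y ∈ (extChartAt (𝓡 n) p).target)
    (v : Euc n) : coordField p v ((extChartAt (𝓡 n) p).symm y) = coordVec p y v := by
  have hs : (extChartAt (𝓡 n) p).symm y ∈ (extChartAt (𝓡 n) p).source :=
    (extChartAt (𝓡 n) p).map_target hy
  have hi := isInvertible_mfderiv_extChartAt (I := 𝓡 n) hs
  rw [coordField]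
  have := hi.inverse_apply_eq.2 (mfderiv_extChartAt_coordVec hy v).symm
  exact this

theorem linearIndependent_coordVec {p : M} {y : Euc n} (hy : y ∈ (extChartAt (𝓡 n) p).target) :
    LinearIndependent ℝ (fun i : Fin n ↦ coordVec p y (stdVec i)) := by
  have h0 : LinearIndependent ℝ (fun i : Fin n ↦ (stdVec i : Euc n)) :=
    linearIndependent_tangentBasis p
  let L : Euc n →ₗ[ℝ] TangentSpace (𝓡 n) ((extChartAt (𝓡 n) p).symm y) :=
    (mfderiv 𝓘(ℝ, Euc n) (𝓡 n) (extChartAt (𝓡 n) p).symm y).toLinearMap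
  have hinj : LinearMap.ker L = ⊥ := by
    rw [LinearMap.ker_eq_bot]
    intro a b hab
    rw [← mfderiv_extChartAt_coordVec hy a, ← mfderiv_extChartAt_coordVec hy b]
    exact congrArg _ hab
  exact h0.map' L hinj

theorem coordMetric_eq_gramOf (g : Metric n M) (p : M) (y : Euc n) :
    coordMetric g p y = gramOf g _ (fun i ↦ coordVec p y (stdVec i)) := rfl

theorem coordMetric_det_pos (g : Metric n M) {p : M} {y : Euc n}
    (hy : y ∈ (extChartAt (𝓡 n) p).target) : 0 < (coordMetric g p y).det :=
  gramOf_det_pos_of_linearIndependent g (linearIndependent_coordVec hy)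

/-- Going to the chart and back returns `p` only propositionally. All tangent spaces are copies of
`ℝⁿ`, so the base point can be replaced while the components are kept. -/
theorem inner_congr_base (g : Metric n M) {p q : M} (h : p = q) (u v : Euc n) :
    g.inner p (show TangentSpace (𝓡 n) p from u) (show TangentSpace (𝓡 n) p from v) =
      g.inner q (show TangentSpace (𝓡 n) q from u) (show TangentSpace (𝓡 n) q from v) := by
  subst h
  rfl

theorem coordMetric_self (g : Metric n M) (p : M) :
    coordMetric g p (extChartAt (𝓡 n) p p) = gram g p := by
  ext i j
  simp only [coordMetric, gram, Matrix.of_apply]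
  have h1 := coordVec_self p (stdVec i)
  have h2 := coordVec_self p (stdVec j)
  refine (inner_congr_base g (extChartAt_to_inv p) _ _).trans ?_
  rw [h1, h2]
  rfl

theorem contMDiffOn_coordVec (p : M) (v : Euc n) :
    ContMDiffOn 𝓘(ℝ, Euc n) (𝓡 n).tangent ∞
      (fun y ↦ (⟨(extChartAt (𝓡 n) p).symm y, coordVec p y v⟩ : TangentBundle (𝓡 n) M))
      (extChartAt (𝓡 n) p).target :=
  contMDiffOn_mfderiv_apply (isOpen_extChartAt_target p) (contMDiffOn_extChartAt_symm p) v

theorem contMDiffOn_inner (g : Metric n M) {k : ℕ} {U : Set (Euc k)} {φ : Euc k → M}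
    {V W : ∀ y, TangentSpace (𝓡 n) (φ y)}
    (hV : ContMDiffOn 𝓘(ℝ, Euc k) (𝓡 n).tangent ∞ (fun y ↦ (⟨φ y, V y⟩ : TangentBundle (𝓡 n) M)) U)
    (hW : ContMDiffOn 𝓘(ℝ, Euc k) (𝓡 n).tangent ∞ (fun y ↦ (⟨φ y, W y⟩ : TangentBundle (𝓡 n) M)) U) :
    ContDiffOn ℝ ∞ (fun y ↦ g.inner (φ y) (V y) (W y)) U := by
  let _ : Bundle.RiemannianBundle (fun x : M ↦ TangentSpace (𝓡 n) x) := ⟨g.toRiemannianMetric⟩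
  rw [← contMDiffOn_iff_contDiffOn]
  exact ContMDiffOn.inner_bundle (E := fun x : M ↦ TangentSpace (𝓡 n) x) hV hW

theorem isMetricOn_coordMetric (g : Metric n M) (p : M) :
    IsMetricOn (coordMetric g p) (extChartAt (𝓡 n) p).target where
  isOpen := isOpen_extChartAt_target p
  smooth _ _ := contMDiffOn_inner g (contMDiffOn_coordVec p _) (contMDiffOn_coordVec p _)
  symm _ _ _ _ := g.symm _ _ _
  det_ne_zero _ hz := (coordMetric_det_pos g hz).ne'

variable {E : Type*} [NormedAddCommGroup E] [NormedSpace ℝ E]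

theorem mvfderiv_coordVec {F : M → E} {p : M} {y : Euc n} (hy : y ∈ (extChartAt (𝓡 n) p).target)
    (hF : MDifferentiableAt (𝓡 n) 𝓘(ℝ, E) F ((extChartAt (𝓡 n) p).symm y)) (v : Euc n) :
    mvfderiv (𝓡 n) F ((extChartAt (𝓡 n) p).symm y) (coordVec p y v) =
      fderiv ℝ (fun z ↦ F ((extChartAt (𝓡 n) p).symm z)) y v := by
  have h := mfderiv_comp_apply y hF (mdifferentiableAt_extChartAt_symm hy) v
  rw [← mfderiv_eq_fderiv]
  exact h.symm

theorem mvfderiv_eq_fderiv_center {F : M → E} {p : M} (hF : MDifferentiableAt (𝓡 n) 𝓘(ℝ, E) F p)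
    (v : TangentSpace (𝓡 n) p) :
    mvfderiv (𝓡 n) F p v =
      fderiv ℝ (fun z ↦ F ((extChartAt (𝓡 n) p).symm z)) (extChartAt (𝓡 n) p p) v := by
  rw [hF.mvfderiv]
  simp only [mfld_simps, fderivWithin_univ]
  rfl

theorem differentiableAt_comp_extChartAt_symm {F : M → E} {p : M}
    (hF : MDifferentiableAt (𝓡 n) 𝓘(ℝ, E) F p) :
    DifferentiableAt ℝ (fun z ↦ F ((extChartAt (𝓡 n) p).symm z)) (extChartAt (𝓡 n) p p) := by
  have h := (mdifferentiableAt_iff _ _).1 hF |>.2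
  simpa [writtenInExtChartAt, Function.comp_def, mfld_simps, differentiableWithinAt_univ] using! h

theorem contDiffOn_comp_extChartAt_symm {F : M → E} (hF : ContMDiff (𝓡 n) 𝓘(ℝ, E) ∞ F) (p : M) :
    ContDiffOn ℝ ∞ (fun z ↦ F ((extChartAt (𝓡 n) p).symm z)) (extChartAt (𝓡 n) p).target := by
  rw [← contMDiffOn_iff_contDiffOn]
  exact hF.comp_contMDiffOn (contMDiffOn_extChartAt_symm p)

end Charts

/-! ### Connection and curvature from a linear map into a flat space, in coordinates. -/

section FlatFrame

variable {n : ℕ} {E : Type*} [NormedAddCommGroup E] [NormedSpace ℝ E]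

/-- A smooth field of linear maps `J_z : ℝⁿ → E` on `U` that pulls the bilinear form `b` of `E` back
to the metric `h`, and whose exterior derivative is orthogonal to the image of `J`. -/
structure IsFlatFrame (b : E →L[ℝ] E →L[ℝ] ℝ) (h : Euc n → Matrix (Fin n) (Fin n) ℝ)
    (J : Euc n → Euc n →L[ℝ] E) (U : Set (Euc n)) : Prop where
  symm_form : ∀ x y, b x y = b y x
  metric : IsMetricOn h U
  smooth : ContDiffOn ℝ ∞ J U
  gram : ∀ z ∈ U, ∀ i j, h z i j = b (J z (stdVec i)) (J z (stdVec j))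
  torsion : ∀ z ∈ U, ∀ i j k, b (fderiv ℝ J z (stdVec i) (stdVec j) -
    fderiv ℝ J z (stdVec j) (stdVec i)) (J z (stdVec k)) = 0

theorem partialD_bilin (b : E →L[ℝ] E →L[ℝ] ℝ) {u v : Euc n → E} {y : Euc n}
    (hu : DifferentiableAt ℝ u y) (hv : DifferentiableAt ℝ v y) (i : Fin n) :
    partialD i (fun z ↦ b (u z) (v z)) y =
      b (u y) (fderiv ℝ v y (stdVec i)) + b (fderiv ℝ u y (stdVec i)) (v y) := by
  have := (b.hasFDerivAt_of_bilinear hu.hasFDerivAt hv.hasFDerivAt).fderiv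
  rw [partialD, this]
  simp

namespace IsFlatFrame

variable {b : E →L[ℝ] E →L[ℝ] ℝ} {h : Euc n → Matrix (Fin n) (Fin n) ℝ}
  {J : Euc n → Euc n →L[ℝ] E} {U : Set (Euc n)} (H : IsFlatFrame b h J U)
include H

theorem differentiableAt {y : Euc n} (hy : y ∈ U) : DifferentiableAt ℝ J y :=
  differentiableAt_of_contDiffOn H.metric.isOpen H.smooth hy

theorem differentiableAt_apply {y : Euc n} (hy : y ∈ U) (v : Euc n) :
    DifferentiableAt ℝ (fun z ↦ J z v) y :=
  (H.differentiableAt hy).clm_apply (differentiableAt_const v)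

theorem fderiv_apply {y : Euc n} (hy : y ∈ U) (u v : Euc n) :
    fderiv ℝ (fun z ↦ J z v) y u = fderiv ℝ J y u v := by
  rw [fderiv_clm_apply (H.differentiableAt hy) (differentiableAt_const v)]
  simp

theorem partialD_metric {y : Euc n} (hy : y ∈ U) (i j l : Fin n) :
    partialD i (fun z ↦ h z j l) y =
      b (J y (stdVec j)) (fderiv ℝ J y (stdVec i) (stdVec l)) +
        b (fderiv ℝ J y (stdVec i) (stdVec j)) (J y (stdVec l)) := by
  rw [partialD_congr H.metric.isOpen hy (fun z hz ↦ H.gram z hz j l),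
    partialD_bilin b (H.differentiableAt_apply hy _) (H.differentiableAt_apply hy _),
    H.fderiv_apply hy, H.fderiv_apply hy]

/-- Each of the three derivatives in Koszul's formula contributes two terms. The three instances of
the torsion condition cancel all but the tangential part of `∂_i J(e_j)`. -/
theorem sum_mul_christoffel {y : Euc n} (hy : y ∈ U) (l i j : Fin n) :
    ∑ k, h y l k * christoffel h k i j y =
      b (fderiv ℝ J y (stdVec i) (stdVec j)) (J y (stdVec l)) := by
  rw [H.metric.sum_mul_christoffel hy, H.partialD_metric hy, H.partialD_metric hy,
    H.partialD_metric hy]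
  have t1 := H.torsion y hy i j l
  have t2 := H.torsion y hy i l j
  have t3 := H.torsion y hy j l i
  simp only [map_sub, sub_apply] at t1 t2 t3
  rw [H.symm_form (J y (stdVec j)) (fderiv ℝ J y (stdVec i) (stdVec l)),
    H.symm_form (J y (stdVec i)) (fderiv ℝ J y (stdVec j) (stdVec l)),
    H.symm_form (J y (stdVec i)) (fderiv ℝ J y (stdVec l) (stdVec j))]
  linarith

theorem christoffel_eq {y : Euc n} (hy : y ∈ U) (k i j : Fin n) :
    christoffel h k i j y =
      ∑ l, (h y)⁻¹ k l * b (fderiv ℝ J y (stdVec i) (stdVec j)) (J y (stdVec l)) := by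
  have e : (h y)⁻¹.mulVec ((h y).mulVec (fun k ↦ christoffel h k i j y)) =
      fun k ↦ christoffel h k i j y := by
    rw [Matrix.mulVec_mulVec, Matrix.nonsing_inv_mul _ (H.metric.isUnit_det hy),
      Matrix.one_mulVec]
  rw [← congrFun e k]
  simp only [Matrix.mulVec, dotProduct, H.sum_mul_christoffel hy]

/-- The Gauss equation in coordinates. -/
theorem sum_mul_curvatureCoeff {y : Euc n} (hy : y ∈ U) (m i j k : Fin n) :
    ∑ l, h y m l * curvatureCoeff h l i j k y =
      (b (fderiv ℝ J y (stdVec j) (stdVec k)) (fderiv ℝ J y (stdVec i) (stdVec m)) -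
        ∑ l, christoffel h l j k y * b (J y (stdVec l)) (fderiv ℝ J y (stdVec i) (stdVec m))) -
      (b (fderiv ℝ J y (stdVec i) (stdVec k)) (fderiv ℝ J y (stdVec j) (stdVec m)) -
        ∑ l, christoffel h l i k y * b (J y (stdVec l)) (fderiv ℝ J y (stdVec j) (stdVec m))) := by
  have hU := H.metric.isOpen
  have hdh : ∀ i j, DifferentiableAt ℝ (fun z ↦ h z i j) y := fun i j ↦
    differentiableAt_of_contDiffOn hU (H.metric.smooth i j) hy
  have hdc : ∀ l i j, DifferentiableAt ℝ (christoffel h l i j) y := fun l i j ↦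
    differentiableAt_of_contDiffOn hU (H.metric.contDiffOn_christoffel l i j) hy
  have hd2 : DifferentiableAt ℝ (fderiv ℝ J) y :=
    differentiableAt_of_contDiffOn hU (H.smooth.fderiv_of_isOpen (m := ∞) hU (by simp)) hy
  have hd3 : ∀ j k : Fin n, DifferentiableAt ℝ (fun z ↦ fderiv ℝ J z (stdVec j) (stdVec k)) y :=
    fun j k ↦ (hd2.clm_apply (differentiableAt_const _)).clm_apply (differentiableAt_const _)
  have hf3 : ∀ i j k : Fin n, fderiv ℝ (fun z ↦ fderiv ℝ J z (stdVec j) (stdVec k)) y (stdVec i) =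
      fderiv ℝ (fderiv ℝ J) y (stdVec i) (stdVec j) (stdVec k) := by
    intro i j k
    rw [fderiv_clm_apply (hd2.clm_apply (differentiableAt_const _)) (differentiableAt_const _),
      fderiv_clm_apply hd2 (differentiableAt_const _)]
    simp
  have hsymm : ∀ i j k : Fin n, fderiv ℝ (fderiv ℝ J) y (stdVec i) (stdVec j) (stdVec k) =
      fderiv ℝ (fderiv ℝ J) y (stdVec j) (stdVec i) (stdVec k) := by
    intro i j k
    rw [(((H.smooth.contDiffAt (hU.mem_nhds hy)).of_le minSmoothness_two_le
      ).isSymmSndFDerivAt le_rfl) _ _]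
  -- One half of the curvature, from differentiating the lowered Christoffel symbols `b(∂_j J(e_k),
  -- J(e_m))`. Its second derivative of `J` is symmetric in `i` and `j`, so it disappears from the
  -- difference of the two halves.
  have key : ∀ i j, ∑ l, h y m l * (partialD i (christoffel h l j k) y +
        ∑ a, christoffel h l i a y * christoffel h a j k y) =
      b (fderiv ℝ (fderiv ℝ J) y (stdVec i) (stdVec j) (stdVec k)) (J y (stdVec m)) +
      (b (fderiv ℝ J y (stdVec j) (stdVec k)) (fderiv ℝ J y (stdVec i) (stdVec m)) -
        ∑ l, christoffel h l j k y * b (J y (stdVec l)) (fderiv ℝ J y (stdVec i) (stdVec m))) := by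
    intro i j
    have e1 : partialD i (fun z ↦ ∑ l, h z m l * christoffel h l j k z) y =
        b (fderiv ℝ J y (stdVec j) (stdVec k)) (fderiv ℝ J y (stdVec i) (stdVec m)) +
        b (fderiv ℝ (fderiv ℝ J) y (stdVec i) (stdVec j) (stdVec k)) (J y (stdVec m)) := by
      rw [partialD_congr hU hy (fun z hz ↦ H.sum_mul_christoffel hz m j k),
        partialD_bilin b (hd3 _ _) (H.differentiableAt_apply hy _), hf3, H.fderiv_apply hy]
    rw [partialD_sum fun l _ ↦ (hdh m l).fun_mul (hdc l j k)] at e1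
    simp only [partialD_mul (hdh _ _) (hdc _ _ _), H.partialD_metric hy, add_mul,
      Finset.sum_add_distrib] at e1
    have e2 : ∑ l, b (J y (stdVec m)) (fderiv ℝ J y (stdVec i) (stdVec l)) *
        christoffel h l j k y =
        ∑ l, h y m l * ∑ a, christoffel h l i a y * christoffel h a j k y := by
      simp only [H.symm_form (J y (stdVec m)), ← H.sum_mul_christoffel hy, Finset.sum_mul,
        Finset.mul_sum]
      rw [Finset.sum_comm]
      simp only [mul_assoc]
    have e3 : ∑ l, b (fderiv ℝ J y (stdVec i) (stdVec m)) (J y (stdVec l)) *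
        christoffel h l j k y =
        ∑ l, christoffel h l j k y * b (J y (stdVec l)) (fderiv ℝ J y (stdVec i) (stdVec m)) :=
      Finset.sum_congr rfl fun l _ ↦ by rw [H.symm_form, mul_comm]
    rw [e2, e3] at e1
    simp only [mul_add, Finset.sum_add_distrib]
    linarith
  have k1 := key i j
  have k2 := key j i
  rw [hsymm j i k] at k2
  have : ∑ l, h y m l * curvatureCoeff h l i j k y =
      ∑ l, h y m l * (partialD i (christoffel h l j k) y +
        ∑ a, christoffel h l i a y * christoffel h a j k y) -
      ∑ l, h y m l * (partialD j (christoffel h l i k) y +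
        ∑ a, christoffel h l j a y * christoffel h a i k y) := by
    rw [← Finset.sum_sub_distrib]
    refine Finset.sum_congr rfl fun l _ ↦ ?_
    rw [curvatureCoeff, Finset.sum_sub_distrib]
    ring
  rw [this, k1, k2]
  ring

end IsFlatFrame

end FlatFrame

/-! ### Flattenings of a Riemannian manifold and their second fundamental form. -/

/-- The bilinear form `∑_c ε_c x_c y_c` on `ℝ^D`. -/
def weightedForm {D : ℕ} (ε : Fin D → ℝ) : (Fin D → ℝ) →L[ℝ] (Fin D → ℝ) →L[ℝ] ℝ :=
  ∑ c, ε c • (ContinuousLinearMap.proj c : (Fin D → ℝ) →L[ℝ] ℝ).smulRight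
    (ContinuousLinearMap.proj c : (Fin D → ℝ) →L[ℝ] ℝ)

theorem weightedForm_apply {D : ℕ} (ε x y : Fin D → ℝ) :
    weightedForm ε x y = ∑ c, ε c * (x c * y c) := by
  simp [weightedForm]

theorem weightedForm_symm {D : ℕ} (ε x y : Fin D → ℝ) :
    weightedForm ε x y = weightedForm ε y x := by
  simp only [weightedForm_apply, mul_comm (x _)]

/-- A fibrewise linear smooth map `J : TM → ℝ^D` that pulls `∑_c ε_c x_c y_c` back to `g`, and whose
exterior derivative is orthogonal to the image of `J`. -/
structure Flattening {n : ℕ} {M : Type*} [TopologicalSpace M] [ChartedSpace (Euc n) M]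
    [IsManifold (𝓡 n) ∞ M] (g : Metric n M) (D : ℕ) where
  -- No sign is prescribed for the weights: positivity is only used for the Riemannian metrics.
  ε : Fin D → ℝ
  J : ∀ p : M, TangentSpace (𝓡 n) p →L[ℝ] (Fin D → ℝ)
  smooth : ContMDiff (𝓡 n).tangent 𝓘(ℝ, Fin D → ℝ) ∞
    (fun z : TangentBundle (𝓡 n) M ↦ J z.1 z.2)
  isometric : ∀ (p : M) (u v : TangentSpace (𝓡 n) p),
    weightedForm ε (J p u) (J p v) = g.inner p u v
  -- Closedness is required along every smooth map from an open subset of some `ℝ^k`, and against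
  -- all vectors tangent to `M`. In this form the condition is inherited by immersed manifolds and
  -- yields the symmetry of `B`.
  torsionFree : ∀ (k : ℕ) (U : Set (Euc k)) (φ : Euc k → M), IsOpen U →
    ContMDiffOn 𝓘(ℝ, Euc k) (𝓡 n) ∞ φ U → ∀ y ∈ U, ∀ (u v : Euc k)
    (w : TangentSpace (𝓡 n) (φ y)),
    weightedForm ε
      (fderiv ℝ (fun z ↦ J (φ z) (mfderiv 𝓘(ℝ, Euc k) (𝓡 n) φ z v)) y u -
        fderiv ℝ (fun z ↦ J (φ z) (mfderiv 𝓘(ℝ, Euc k) (𝓡 n) φ z u)) y v) (J (φ y) w) = 0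

namespace Flattening

variable {n D : ℕ} {M : Type*} [TopologicalSpace M] [ChartedSpace (Euc n) M]
  [IsManifold (𝓡 n) ∞ M] {g : Metric n M} (Φ : Flattening g D)

/-- The ambient bilinear form. -/
def form : (Fin D → ℝ) →L[ℝ] (Fin D → ℝ) →L[ℝ] ℝ := weightedForm Φ.ε

theorem form_symm (x y : Fin D → ℝ) : Φ.form x y = Φ.form y x := weightedForm_symm _ _ _

theorem form_J (p : M) (u v : TangentSpace (𝓡 n) p) :
    Φ.form (Φ.J p u) (Φ.J p v) = g.inner p u v := Φ.isometric p u v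

/-- The map `J` in the chart at `p`. -/
def loc (p : M) (y : Euc n) : Euc n →L[ℝ] (Fin D → ℝ) :=
  (Φ.J ((extChartAt (𝓡 n) p).symm y)).comp
    (mfderiv 𝓘(ℝ, Euc n) (𝓡 n) (extChartAt (𝓡 n) p).symm y)

theorem loc_apply (p : M) (y v : Euc n) :
    Φ.loc p y v = Φ.J ((extChartAt (𝓡 n) p).symm y) (coordVec p y v) := rfl

theorem loc_self (p : M) (v : TangentSpace (𝓡 n) p) :
    Φ.loc p (extChartAt (𝓡 n) p p) v = Φ.J p v := by
  have e : ∀ q, q = p → ∀ w : Euc n, w = v → Φ.J q (show TangentSpace (𝓡 n) q from w) = Φ.J p v := by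
    rintro q rfl w rfl
    rfl
  exact e _ (extChartAt_to_inv p) _ (coordVec_self p v)

theorem contDiffOn_loc (p : M) : ContDiffOn ℝ ∞ (Φ.loc p) (extChartAt (𝓡 n) p).target := by
  rw [contDiffOn_clm_apply]
  intro v
  rw [← contMDiffOn_iff_contDiffOn]
  exact Φ.smooth.comp_contMDiffOn (contMDiffOn_coordVec p v)

theorem isFlatFrame (p : M) :
    IsFlatFrame Φ.form (coordMetric g p) (Φ.loc p) (extChartAt (𝓡 n) p).target where
  symm_form := Φ.form_symm
  metric := isMetricOn_coordMetric g p
  smooth := Φ.contDiffOn_loc p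
  gram _ _ _ _ := (Φ.form_J _ _ _).symm
  torsion z hz i j k := by
    have h := Φ.torsionFree n _ _ (isOpen_extChartAt_target p) (contMDiffOn_extChartAt_symm p) z hz
      (stdVec i) (stdVec j) (coordVec p z (stdVec k))
    have hd := differentiableAt_of_contDiffOn (isOpen_extChartAt_target p) (Φ.contDiffOn_loc p) hz
    have e : ∀ u v : Euc n, fderiv ℝ (fun z ↦ Φ.loc p z v) z u = fderiv ℝ (Φ.loc p) z u v := by
      intro u v
      rw [fderiv_clm_apply hd (differentiableAt_const v)]
      simp
    rw [← e, ← e]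
    exact h

/-- The orthogonal projection of `ℝ^D` onto the image of `J`. -/
def proj (p : M) : (Fin D → ℝ) →ₗ[ℝ] TangentSpace (𝓡 n) p where
  toFun z := sharp g p fun w ↦ Φ.form z (Φ.J p w)
  map_add' x y := by
    apply inner_ext g
    intro u
    have e : ∀ z, g.inner p (sharp g p fun w ↦ Φ.form z (Φ.J p w)) u = Φ.form z (Φ.J p u) :=
      fun z ↦ inner_sharp g p ((Φ.form z).toLinearMap ∘ₗ (Φ.J p).toLinearMap) u
    rw [e, map_add (g.inner p), add_apply, e, e, map_add, add_apply]
  map_smul' c x := by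
    apply inner_ext g
    intro u
    have e : ∀ z, g.inner p (sharp g p fun w ↦ Φ.form z (Φ.J p w)) u = Φ.form z (Φ.J p u) :=
      fun z ↦ inner_sharp g p ((Φ.form z).toLinearMap ∘ₗ (Φ.J p).toLinearMap) u
    rw [e, map_smul (g.inner p), smul_apply, RingHom.id_apply, e, map_smul, smul_apply]

theorem inner_proj (p : M) (z : Fin D → ℝ) (u : TangentSpace (𝓡 n) p) :
    g.inner p (Φ.proj p z) u = Φ.form z (Φ.J p u) :=
  inner_sharp g p ((Φ.form z).toLinearMap ∘ₗ (Φ.J p).toLinearMap) u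

theorem proj_J (p : M) (u : TangentSpace (𝓡 n) p) : Φ.proj p (Φ.J p u) = u := by
  apply inner_ext g
  intro w
  rw [inner_proj, form_J]

/-- The normal component with respect to the image of `J`. -/
def nrm (p : M) : (Fin D → ℝ) →ₗ[ℝ] (Fin D → ℝ) :=
  LinearMap.id - (Φ.J p).toLinearMap ∘ₗ Φ.proj p

theorem nrm_apply (p : M) (z : Fin D → ℝ) : Φ.nrm p z = z - Φ.J p (Φ.proj p z) := rfl

theorem eq_add_nrm (p : M) (z : Fin D → ℝ) : z = Φ.J p (Φ.proj p z) + Φ.nrm p z := by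
  rw [nrm_apply]; abel

theorem nrm_J (p : M) (u : TangentSpace (𝓡 n) p) : Φ.nrm p (Φ.J p u) = 0 := by
  rw [nrm_apply, proj_J, sub_self]

theorem form_nrm_J (p : M) (z : Fin D → ℝ) (u : TangentSpace (𝓡 n) p) :
    Φ.form (Φ.nrm p z) (Φ.J p u) = 0 := by
  rw [nrm_apply, map_sub, sub_apply, form_J, inner_proj, sub_self]

theorem form_J_nrm (p : M) (z : Fin D → ℝ) (u : TangentSpace (𝓡 n) p) :
    Φ.form (Φ.J p u) (Φ.nrm p z) = 0 := by
  rw [form_symm, form_nrm_J]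

theorem nrm_eq_self {p : M} {z : Fin D → ℝ} (h : ∀ u, Φ.form z (Φ.J p u) = 0) : Φ.nrm p z = z := by
  have : Φ.proj p z = 0 := by
    apply inner_ext g
    intro u
    rw [inner_proj, h]
    simp
  rw [nrm_apply, this, map_zero, sub_zero]

/-- The second fundamental form of the flattening: the normal part of the derivative of `J`. -/
def II (p : M) : TangentSpace (𝓡 n) p →ₗ[ℝ] TangentSpace (𝓡 n) p →ₗ[ℝ] (Fin D → ℝ) :=
  LinearMap.mk₂ ℝ (fun u v ↦ Φ.nrm p (fderiv ℝ (Φ.loc p) (extChartAt (𝓡 n) p p) u v))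
    (fun u u' v ↦ by
      rw [← map_add]
      congr 1
      exact congrArg (fun L ↦ L v) (map_add (fderiv ℝ (Φ.loc p) (extChartAt (𝓡 n) p p)) u u'))
    (fun c u v ↦ by
      rw [← map_smul]
      congr 1
      exact congrArg (fun L ↦ L v) (map_smul (fderiv ℝ (Φ.loc p) (extChartAt (𝓡 n) p p)) c u))
    (fun u v v' ↦ by
      rw [← map_add]
      congr 1
      exact map_add (fderiv ℝ (Φ.loc p) (extChartAt (𝓡 n) p p) u) v v')
    (fun c u v ↦ by
      rw [← map_smul]
      congr 1
      exact map_smul (fderiv ℝ (Φ.loc p) (extChartAt (𝓡 n) p p) u) c v)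

theorem II_apply (p : M) (u v : TangentSpace (𝓡 n) p) :
    Φ.II p u v = Φ.nrm p (fderiv ℝ (Φ.loc p) (extChartAt (𝓡 n) p p) u v) := rfl

theorem form_II_J (p : M) (u v w : TangentSpace (𝓡 n) p) : Φ.form (Φ.II p u v) (Φ.J p w) = 0 :=
  Φ.form_nrm_J _ _ _

theorem form_J_II (p : M) (u v w : TangentSpace (𝓡 n) p) : Φ.form (Φ.J p w) (Φ.II p u v) = 0 :=
  Φ.form_J_nrm _ _ _

end Flattening

/-! ### The Gauss formula and the Gauss equation of a flattening. -/

namespace Flattening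

variable {n D : ℕ} {M : Type*} [TopologicalSpace M] [ChartedSpace (Euc n) M]
  [IsManifold (𝓡 n) ∞ M] {g : Metric n M} (Φ : Flattening g D)

theorem eq_sum_stdVec (u : Euc n) : u = ∑ i, u i • stdVec i := by
  ext j
  simp [Pi.single_apply]

theorem sum_smul_stdVec_apply (c : Fin n → ℝ) (k : Fin n) :
    (∑ i, c i • (stdVec i : Euc n)) k = c k := by
  simp [Pi.single_apply]

/-- The Christoffel symbols at the centre of a chart are the tangential part of the derivative of
`J`. -/
theorem christoffelMap_eq_proj (p : M) (u v : Euc n) :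
    christoffelMap (coordMetric g p) (extChartAt (𝓡 n) p p) u v =
      Φ.proj p (fderiv ℝ (Φ.loc p) (extChartAt (𝓡 n) p p) u v) := by
  have hy := mem_extChartAt_target (I := 𝓡 n) p
  set y := extChartAt (𝓡 n) p p
  have e1 : ∀ z, (Φ.proj p z : Euc n) =
      ∑ k, (∑ l, (gram g p)⁻¹ k l * Φ.form z (Φ.J p (tangentBasis p l))) • (stdVec k : Euc n) := by
    intro z
    simp only [Finset.sum_smul]
    rfl
  have e2 : fderiv ℝ (Φ.loc p) y u v =
      ∑ i, ∑ j, (u i * v j) • fderiv ℝ (Φ.loc p) y (stdVec i) (stdVec j) := by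
    conv_lhs => rw [eq_sum_stdVec u, eq_sum_stdVec v]
    simp only [map_sum, map_smul, sum_apply, smul_apply, Finset.smul_sum, smul_smul]
    rw [Finset.sum_comm]
    simp only [mul_comm]
  ext k
  rw [e1, sum_smul_stdVec_apply, e2]
  simp only [christoffelMap, (Φ.isFlatFrame p).christoffel_eq hy, map_sum, map_smul, sum_apply,
    smul_apply, smul_eq_mul, Finset.mul_sum, Finset.sum_mul]
  rw [Finset.sum_comm (f := fun l i ↦ ∑ j, (gram g p)⁻¹ k l * _)]
  refine Finset.sum_congr rfl fun i _ ↦ ?_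
  rw [Finset.sum_comm (f := fun l j ↦ (gram g p)⁻¹ k l * _)]
  refine Finset.sum_congr rfl fun j _ ↦ Finset.sum_congr rfl fun l _ ↦ ?_
  have e3 : Φ.J p (tangentBasis p l) = Φ.loc p y (stdVec l) := (Φ.loc_self p _).symm
  rw [coordMetric_self, e3]
  ring

/-- Differentiability of a field along `F` is defined through the trivialization of the tangent
bundle at `F p`, which near `F p` is the derivative of the chart. -/
theorem mdifferentiableAt_coord {m : ℕ} {P : Type*} [TopologicalSpace P] [ChartedSpace (Euc m) P]
    [IsManifold (𝓡 m) ∞ P] {F : P → M} {V : ∀ x, TangentSpace (𝓡 n) (F x)} {p : P}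
    (hV : MDifferentiableAt (𝓡 m) (𝓡 n).tangent
      (fun x ↦ (⟨F x, V x⟩ : TangentBundle (𝓡 n) M)) p) :
    MDifferentiableAt (𝓡 m) (𝓡 n) F p ∧
    MDifferentiableAt (𝓡 m) 𝓘(ℝ, Euc n)
      (fun x ↦ mvfderiv (𝓡 n) (extChartAt (𝓡 n) (F p)) (F x) (V x)) p := by
  have h := (mdifferentiableAt_totalSpace (𝓡 n) _).1 hV
  refine ⟨h.1, h.2.congr_of_eventuallyEq ?_⟩
  have hs : ∀ᶠ x in nhds p, F x ∈ (chartAt (Euc n) (F p)).source :=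
    h.1.continuousAt.eventually_mem ((chartAt _ (F p)).open_source.mem_nhds (mem_chart_source _ _))
  filter_upwards [hs] with x hx
  have := TangentBundle.continuousLinearMapAt_trivializationAt (I := 𝓡 n) hx
  have h2 := congrArg (fun L ↦ L (V x)) this
  refine h2.symm.trans ?_
  exact congrFun (Bundle.Trivialization.coe_linearMapAt_of_mem _ (by simpa using hx)) (V x)

theorem loc_mvfderiv_extChartAt {q x : M} {y : Euc n} (hy : y ∈ (extChartAt (𝓡 n) q).target)
    (hx : (extChartAt (𝓡 n) q).symm y = x) (v : TangentSpace (𝓡 n) x) :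
    Φ.loc q y (mvfderiv (𝓡 n) (extChartAt (𝓡 n) q) x v) = Φ.J x v := by
  subst hx
  rw [loc_apply]
  exact congrArg _ (coordVec_mfderiv_extChartAt hy v)

/-- The Gauss formula: the derivative of `J V` along a map splits into the covariant derivative of `V`
and the second fundamental form. -/
theorem mvfderiv_J {m : ℕ} {P : Type*} [TopologicalSpace P] [ChartedSpace (Euc m) P]
    [IsManifold (𝓡 m) ∞ P] {F : P → M} {V : ∀ x, TangentSpace (𝓡 n) (F x)} {p : P}
    (hV : MDifferentiableAt (𝓡 m) (𝓡 n).tangent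
      (fun x ↦ (⟨F x, V x⟩ : TangentBundle (𝓡 n) M)) p) (u : TangentSpace (𝓡 m) p) :
    mvfderiv (𝓡 m) (fun x ↦ Φ.J (F x) (V x)) p u =
      Φ.J (F p) (covAlong g F V p u) + Φ.II (F p) (mfderiv (𝓡 m) (𝓡 n) F p u) (V p) := by
  obtain ⟨hF, hw⟩ := mdifferentiableAt_coord hV
  set q := F p with hq
  set y := extChartAt (𝓡 n) q q with hydef
  have hy : y ∈ (extChartAt (𝓡 n) q).target := mem_extChartAt_target (I := 𝓡 n) q
  set ψ := extChartAt (𝓡 n) q with hψ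
  let a : P → Euc n := fun x ↦ ψ (F x)
  let w : P → Euc n := fun x ↦ mvfderiv (𝓡 n) ψ (F x) (V x)
  have hψd : MDifferentiableAt (𝓡 n) 𝓘(ℝ, Euc n) ψ (F p) :=
    mdifferentiableAt_extChartAt (mem_chart_source _ _)
  have ha : MDifferentiableAt (𝓡 m) 𝓘(ℝ, Euc n) a p := hψd.comp p hF
  have hs : ∀ᶠ x in nhds p, F x ∈ ψ.source :=
    hF.continuousAt.eventually_mem ((isOpen_extChartAt_source (I := 𝓡 n) q).mem_nhds
      (mem_extChartAt_source (I := 𝓡 n) q))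
  -- Near `p`, `J V` is the coordinate expression of `J` at the coordinates `a` of the base point,
  -- applied to the components `w` of `V`. The product rule then has two terms, with derivatives of
  -- `w` and of `J`.
  have hJV : (fun x ↦ Φ.J (F x) (V x)) =ᶠ[nhds p] fun x ↦ Φ.loc q (a x) (w x) := by
    filter_upwards [hs] with x hx
    exact (Φ.loc_mvfderiv_extChartAt (ψ.map_source hx) (ψ.left_inv hx) (V x)).symm
  have hloc : DifferentiableAt ℝ (Φ.loc q) y := (Φ.isFlatFrame q).differentiableAt hy
  set y0 := extChartAt (𝓡 m) p p with hy0
  have hback : (extChartAt (𝓡 m) p).symm y0 = p := extChartAt_to_inv p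
  let A : Euc m → Euc n := fun z ↦ a ((extChartAt (𝓡 m) p).symm z)
  let W : Euc m → Euc n := fun z ↦ w ((extChartAt (𝓡 m) p).symm z)
  have hA : DifferentiableAt ℝ A y0 := differentiableAt_comp_extChartAt_symm ha
  have hW : DifferentiableAt ℝ W y0 := differentiableAt_comp_extChartAt_symm hw
  have hA0 : A y0 = y := by simp only [A, hback]; rfl
  have hW0 : W y0 = V p := by
    simp only [W, hback]
    change mvfderiv (𝓡 n) ψ (F p) (V p) = V p
    have := mfderiv_extChartAt_self (I := 𝓡 n) (x := q)
    exact congrArg (fun L ↦ L (V p)) this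
  have hlocA : DifferentiableAt ℝ (fun z ↦ Φ.loc q (A z)) y0 :=
    DifferentiableAt.comp y0 (g := Φ.loc q) (by rwa [hA0]) hA
  have hchart : Filter.Tendsto (extChartAt (𝓡 m) p).symm (nhds y0) (nhds p) := by
    have := continuousAt_extChartAt_symm (I := 𝓡 m) p
    rwa [ContinuousAt, extChartAt_to_inv] at this
  have hdJV : DifferentiableAt ℝ (fun z ↦ Φ.loc q (A z) (W z)) y0 := hlocA.clm_apply hW
  have hM : MDifferentiableAt (𝓡 m) 𝓘(ℝ, Fin D → ℝ) (fun x ↦ Φ.J (F x) (V x)) p :=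
    (Φ.smooth.mdifferentiableAt (by simp)).comp p hV
  rw [mvfderiv_eq_fderiv_center hM]
  have hev : (fun z ↦ Φ.J (F ((extChartAt (𝓡 m) p).symm z)) (V ((extChartAt (𝓡 m) p).symm z)))
      =ᶠ[nhds y0] fun z ↦ Φ.loc q (A z) (W z) := hchart.eventually hJV
  rw [hev.fderiv_eq, fderiv_clm_apply hlocA hW]
  have hcomp : fderiv ℝ (fun z ↦ Φ.loc q (A z)) y0 = (fderiv ℝ (Φ.loc q) y).comp (fderiv ℝ A y0) := by
    have := fderiv_comp y0 (g := Φ.loc q) (by rwa [hA0]) hA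
    rw [hA0] at this
    exact this
  have hdA : fderiv ℝ A y0 u = mfderiv (𝓡 m) (𝓡 n) F p u := by
    rw [← mvfderiv_eq_fderiv_center ha]
    have h1 := mfderiv_comp_apply p hψd hF u
    refine h1.trans ?_
    have := mfderiv_extChartAt_self (I := 𝓡 n) (x := q)
    exact congrArg (fun L ↦ L (mfderiv (𝓡 m) (𝓡 n) F p u)) this
  have hdW : fderiv ℝ W y0 u = mvfderiv (𝓡 m) w p u := (mvfderiv_eq_fderiv_center hw u).symm
  have hcov : covAlong g F V p u = (fderiv ℝ W y0 u : Euc n) +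
      (christoffelMap (coordMetric g q) y (mfderiv (𝓡 m) (𝓡 n) F p u) (V p) : Euc n) := by
    rw [hdW]
    rfl
  have hJcov : Φ.J q (covAlong g F V p u) = Φ.loc q y (fderiv ℝ W y0 u) +
      Φ.J q (Φ.proj q (fderiv ℝ (Φ.loc q) y (mfderiv (𝓡 m) (𝓡 n) F p u) (V p))) := by
    rw [hcov]
    refine (map_add (Φ.J q) _ _).trans ?_
    congr 1
    · exact (Φ.loc_self q _).symm
    · exact congrArg (Φ.J q) (Φ.christoffelMap_eq_proj q _ _)
  rw [hJcov, add_assoc, II_apply]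
  -- The tangential part of the derivative of `J` is the Christoffel term of `∇V`, and its normal
  -- part is `II`.
  have e1 := Φ.eq_add_nrm q (fderiv ℝ (Φ.loc q) y (mfderiv (𝓡 m) (𝓡 n) F p u) (V p))
  rw [← e1, hcomp, hA0, hW0]
  have e2 : (Φ.loc q y ∘SL fderiv ℝ W y0 + (fderiv ℝ (Φ.loc q) y ∘SL fderiv ℝ A y0).flip (V p)) u =
      Φ.loc q y (fderiv ℝ W y0 u) + fderiv ℝ (Φ.loc q) y (fderiv ℝ A y0 u) (V p) := rfl
  rw [e2, hdA]

theorem sum_mul_J_eq_J_proj (p : M) (j k : Fin n) :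
    ∑ l, christoffel (coordMetric g p) l j k (extChartAt (𝓡 n) p p) •
        Φ.loc p (extChartAt (𝓡 n) p p) (stdVec l) =
      Φ.J p (Φ.proj p (fderiv ℝ (Φ.loc p) (extChartAt (𝓡 n) p p) (stdVec j) (stdVec k))) := by
  rw [← Φ.christoffelMap_eq_proj p (stdVec j) (stdVec k)]
  refine Eq.trans ?_ (Φ.loc_self p _)
  conv_rhs => rw [eq_sum_stdVec (christoffelMap _ _ _ _)]
  rw [map_sum]
  refine Finset.sum_congr rfl fun l _ ↦ ?_
  rw [map_smul]
  congr 1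
  simp [christoffelMap]

theorem form_nrm_nrm (p : M) (x y : Fin D → ℝ) :
    Φ.form (Φ.nrm p x) (Φ.nrm p y) = Φ.form x y - Φ.form (Φ.J p (Φ.proj p x)) y := by
  conv_lhs => rw [Φ.nrm_apply p y, map_sub, form_nrm_J, sub_zero, nrm_apply, map_sub, sub_apply]

theorem linear_eq_sum (f : Euc n →ₗ[ℝ] ℝ) (u : Euc n) : f u = ∑ i, u i * f (stdVec i) := by
  conv_lhs => rw [eq_sum_stdVec u]
  simp

/-- Both sides are multilinear in `u, v, w, z`, so the identity on the standard basis suffices. -/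
theorem curvature_expansion {E : Type*} [NormedAddCommGroup E] [NormedSpace ℝ E]
    (b : E →L[ℝ] E →L[ℝ] ℝ) (G : Euc n →ₗ[ℝ] Euc n →ₗ[ℝ] ℝ) (B : Euc n →ₗ[ℝ] Euc n →ₗ[ℝ] E)
    (R : Fin n → Fin n → Fin n → Fin n → ℝ)
    (h : ∀ i j k m, ∑ l, G (stdVec l) (stdVec m) * R l i j k =
      b (B (stdVec j) (stdVec k)) (B (stdVec i) (stdVec m)) -
        b (B (stdVec i) (stdVec k)) (B (stdVec j) (stdVec m))) (u v w z : Euc n) :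
    G (WithLp.toLp 2 fun l ↦ ∑ i, ∑ j, ∑ k, R l i j k * u i * v j * w k) z =
      b (B v w) (B u z) - b (B u w) (B v z) := by
  have e : ∀ u v w z, b (B v w) (B u z) = ∑ m, z m * ∑ i, u i * ∑ j, v j * ∑ k, w k *
      b (B (stdVec j) (stdVec k)) (B (stdVec i) (stdVec m)) := by
    intro u v w z
    refine (linear_eq_sum ((b (B v w)).toLinearMap ∘ₗ B u) z).trans ?_
    refine Finset.sum_congr rfl fun m _ ↦ congrArg _ ?_
    refine (linear_eq_sum ((b (B v w)).toLinearMap ∘ₗ B.flip (stdVec m)) u).trans ?_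
    refine Finset.sum_congr rfl fun i _ ↦ congrArg _ ?_
    refine (linear_eq_sum ((b.flip (B (stdVec i) (stdVec m))).toLinearMap ∘ₗ B.flip w) v).trans ?_
    refine Finset.sum_congr rfl fun j _ ↦ congrArg _ ?_
    exact linear_eq_sum ((b.flip (B (stdVec i) (stdVec m))).toLinearMap ∘ₗ B (stdVec j)) w
  have e' : ∀ u v w z, b (B u w) (B v z) = ∑ m, z m * ∑ i, u i * ∑ j, v j * ∑ k, w k *
      b (B (stdVec i) (stdVec k)) (B (stdVec j) (stdVec m)) := by
    intro u v w z
    refine (linear_eq_sum ((b (B u w)).toLinearMap ∘ₗ B v) z).trans ?_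
    refine Finset.sum_congr rfl fun m _ ↦ congrArg _ ?_
    refine (linear_eq_sum ((b.flip (B v (stdVec m))).toLinearMap ∘ₗ B.flip w) u).trans ?_
    refine Finset.sum_congr rfl fun i _ ↦ congrArg _ ?_
    refine (linear_eq_sum ((b (B (stdVec i) w)).toLinearMap ∘ₗ B.flip (stdVec m)) v).trans ?_
    refine Finset.sum_congr rfl fun j _ ↦ congrArg _ ?_
    exact linear_eq_sum ((b.flip (B (stdVec j) (stdVec m))).toLinearMap ∘ₗ B (stdVec i)) w
  rw [e, e', linear_eq_sum, ← Finset.sum_sub_distrib]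
  refine Finset.sum_congr rfl fun m _ ↦ ?_
  rw [← mul_sub]
  congr 1
  refine (linear_eq_sum (G.flip (stdVec m)) _).trans ?_
  simp only [← Finset.sum_sub_distrib, ← mul_sub, ← h, LinearMap.flip_apply, Finset.mul_sum,
    Finset.sum_mul]
  rw [Finset.sum_comm]
  refine Finset.sum_congr rfl fun i _ ↦ ?_
  rw [Finset.sum_comm]
  refine Finset.sum_congr rfl fun j _ ↦ ?_
  rw [Finset.sum_comm]
  refine Finset.sum_congr rfl fun k _ ↦ Finset.sum_congr rfl fun l _ ↦ ?_
  ring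

/-- The Gauss equation. -/
theorem inner_curvature (p : M) (u v w z : TangentSpace (𝓡 n) p) :
    g.inner p (curvature g p u v w) z =
      Φ.form (Φ.II p v w) (Φ.II p u z) - Φ.form (Φ.II p u w) (Φ.II p v z) := by
  have hy := mem_extChartAt_target (I := 𝓡 n) p
  set y := extChartAt (𝓡 n) p p with hydef
  have hII : ∀ i j, Φ.II p (tangentBasis p i) (tangentBasis p j) =
      Φ.nrm p (fderiv ℝ (Φ.loc p) y (stdVec i) (stdVec j)) := fun i j ↦ rfl
  have hbasis : ∀ i j k m : Fin n, ∑ l, gram g p l m * curvatureCoeff (coordMetric g p) l i j k y =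
      Φ.form (Φ.II p (tangentBasis p j) (tangentBasis p k))
        (Φ.II p (tangentBasis p i) (tangentBasis p m)) -
      Φ.form (Φ.II p (tangentBasis p i) (tangentBasis p k))
        (Φ.II p (tangentBasis p j) (tangentBasis p m)) := by
    intro i j k m
    have h := (Φ.isFlatFrame p).sum_mul_curvatureCoeff hy m i j k
    simp only [(isMetricOn_coordMetric g p).symm y hy m] at h
    rw [hydef, coordMetric_self, ← hydef] at h
    -- The Christoffel sums in the coordinate formula are pairings with the tangential parts.
    -- Subtracting them leaves the pairings of the normal parts.
    rw [h, hII, hII, hII, hII, form_nrm_nrm, form_nrm_nrm, hydef,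
      ← sum_mul_J_eq_J_proj, ← sum_mul_J_eq_J_proj]
    simp only [map_sum, map_smul, sum_apply, smul_apply, smul_eq_mul]
  exact curvature_expansion Φ.form
    (metricForm g p) (Φ.II p) (fun l i j k ↦ curvatureCoeff (coordMetric g p) l i j k y) hbasis u v w z

end Flattening

/-! ### Restriction of a flattening to an immersed manifold. -/

namespace Flattening

variable {m n D : ℕ} {P M : Type*} [TopologicalSpace P] [ChartedSpace (Euc m) P]
  [IsManifold (𝓡 m) ∞ P] [TopologicalSpace M] [ChartedSpace (Euc n) M]
  [IsManifold (𝓡 n) ∞ M] {gP : Metric m P} {g : Metric n M} (Φ : Flattening g D)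
  {F : P → M} (hF : IsIsometricImmersion gP g F)

/-- The flattening induced by an isometric immersion. -/
def pullback : Flattening gP D where
  ε := Φ.ε
  J p := (Φ.J (F p)).comp (mfderiv (𝓡 m) (𝓡 n) F p)
  smooth := Φ.smooth.comp (hF.smooth.contMDiff_tangentMap (by simp))
  isometric p u v := (Φ.isometric _ _ _).trans (hF.isometric p u v)
  torsionFree k U φ hU hφ y hy u v w := by
    have hc : ContMDiffOn 𝓘(ℝ, Euc k) (𝓡 n) ∞ (F ∘ φ) U := hF.smooth.comp_contMDiffOn hφ
    have e : ∀ v, (fun z ↦ Φ.J ((F ∘ φ) z) (mfderiv 𝓘(ℝ, Euc k) (𝓡 n) (F ∘ φ) z v)) =ᶠ[nhds y]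
        fun z ↦ Φ.J (F (φ z)) (mfderiv (𝓡 m) (𝓡 n) F (φ z) (mfderiv 𝓘(ℝ, Euc k) (𝓡 m) φ z v)) := by
      intro v
      filter_upwards [hU.mem_nhds hy] with z hz
      have hd : MDifferentiableAt 𝓘(ℝ, Euc k) (𝓡 m) φ z :=
        (hφ.contMDiffAt (hU.mem_nhds hz)).mdifferentiableAt (by simp)
      exact congrArg _ (mfderiv_comp_apply z (hF.smooth.mdifferentiableAt (by simp)) hd v)
    have h := Φ.torsionFree k U (F ∘ φ) hU hc y hy u v (mfderiv (𝓡 m) (𝓡 n) F (φ y) w)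
    rw [(e u).fderiv_eq, (e v).fderiv_eq] at h
    exact h

theorem pullback_J (p : P) (u : TangentSpace (𝓡 m) p) :
    (Φ.pullback hF).J p u = Φ.J (F p) (mfderiv (𝓡 m) (𝓡 n) F p u) := rfl

theorem pullback_form : (Φ.pullback hF).form = Φ.form := rfl

theorem proj_nrm (p : M) (z : Fin D → ℝ) : Φ.proj p (Φ.nrm p z) = 0 := by
  rw [nrm_apply, map_sub, proj_J, sub_self]

theorem proj_II (p : M) (u v : TangentSpace (𝓡 n) p) : Φ.proj p (Φ.II p u v) = 0 :=
  Φ.proj_nrm _ _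

/-- Both sides subtract the image of the same vector of `T_pP`, because `J` preserves inner
products. -/
theorem J_normalPart (p : P) (w : TangentSpace (𝓡 n) (F p)) :
    Φ.J (F p) (normalPart gP g F p w) = (Φ.pullback hF).nrm p (Φ.J (F p) w) := by
  rw [nrm_apply, pullback_J, normalPart, map_sub]
  congr 3
  apply inner_ext gP
  intro u
  rw [inner_proj]
  exact (inner_sharp gP p ((g.inner (F p) w).toLinearMap ∘ₗ
    (mfderiv (𝓡 m) (𝓡 n) F p).toLinearMap) u).trans (Φ.form_J _ _ _).symm

theorem coordField_self (p : M) (v : TangentSpace (𝓡 n) p) : coordField p v p = v := by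
  have key : ∀ L : Euc n →L[ℝ] Euc n, L = .id ℝ (Euc n) → L.inverse v = v := by
    rintro L rfl
    rw [ContinuousLinearMap.inverse_id]
    rfl
  exact key _ (mfderiv_extChartAt_self (I := 𝓡 n) (x := p))

theorem mdifferentiableAt_coordField (p : M) (v : TangentSpace (𝓡 n) p) :
    MDifferentiableAt (𝓡 n) (𝓡 n).tangent
      (fun x ↦ (⟨x, coordField p v x⟩ : TangentBundle (𝓡 n) M)) p := by
  have hy := mem_extChartAt_target (I := 𝓡 n) p
  have h := (contMDiffOn_coordVec p v).contMDiffAt ((isOpen_extChartAt_target p).mem_nhds hy)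
  have h1 := (h.mdifferentiableAt (by simp)).comp p
    (mdifferentiableAt_extChartAt (I := 𝓡 n) (mem_chart_source _ p))
  refine h1.congr_of_eventuallyEq ?_
  filter_upwards [(isOpen_extChartAt_source (I := 𝓡 n) p).mem_nhds
    (mem_extChartAt_source (I := 𝓡 n) p)] with x hx
  have hyx := (extChartAt (𝓡 n) p).map_source hx
  have e := (extChartAt (𝓡 n) p).left_inv hx
  have := coordField_eq_coordVec hyx v
  simp only [Function.comp]
  rw [← this]
  rw [e]

/-- The derivative of `J` along a coordinate field. -/
theorem mvfderiv_J_coordField (p : M) (u v : TangentSpace (𝓡 n) p) :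
    mvfderiv (𝓡 n) (fun x ↦ Φ.J x (coordField p v x)) p u =
      fderiv ℝ (Φ.loc p) (extChartAt (𝓡 n) p p) u v := by
  have hy := mem_extChartAt_target (I := 𝓡 n) p
  have hM : MDifferentiableAt (𝓡 n) 𝓘(ℝ, Fin D → ℝ) (fun x ↦ Φ.J x (coordField p v x)) p :=
    (Φ.smooth.mdifferentiableAt (by simp)).comp p (mdifferentiableAt_coordField p v)
  rw [mvfderiv_eq_fderiv_center hM]
  refine Eq.trans ?_ ((Φ.isFlatFrame p).fderiv_apply hy u v)
  refine congrArg (fun L : Euc n →L[ℝ] (Fin D → ℝ) ↦ L u) (Filter.EventuallyEq.fderiv_eq ?_)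
  filter_upwards [(isOpen_extChartAt_target (I := 𝓡 n) p).mem_nhds hy] with z hz
  exact congrArg _ (coordField_eq_coordVec hz v)

/-- The second fundamental form of the composition of a flattening with an immersion. -/
theorem II_pullback (p : P) (u v : TangentSpace (𝓡 m) p) :
    (Φ.pullback hF).II p u v = Φ.J (F p) (secondFF gP g F p u v) +
      Φ.II (F p) (mfderiv (𝓡 m) (𝓡 n) F p u) (mfderiv (𝓡 m) (𝓡 n) F p v) := by
  have hV : MDifferentiableAt (𝓡 m) (𝓡 n).tangent (fun x ↦ (⟨F x, mfderiv (𝓡 m) (𝓡 n) F x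
      (coordField p v x)⟩ : TangentBundle (𝓡 n) M)) p :=
    ((hF.smooth.contMDiff_tangentMap (m := ∞) (by simp)).mdifferentiableAt (by simp)).comp p
      (mdifferentiableAt_coordField p v)
  have h1 := Φ.mvfderiv_J hV u
  have h2 := (Φ.pullback hF).mvfderiv_J_coordField p u v
  rw [II_apply, ← h2]
  refine (congrArg _ h1).trans ?_
  rw [map_add, secondFF, J_normalPart Φ hF, coordField_self]
  congr 1
  -- The `II` of the target is orthogonal to `J(TM)`, hence to the smaller space `J(dF(TP))`, so
  -- projecting away from the latter does not change it.
  exact nrm_eq_self _ fun w ↦ Φ.form_II_J _ _ _ _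

/-- This shows that the second fundamental form is bilinear, which is not evident from its
definition by coordinate extensions. -/
theorem secondFF_eq_proj (p : P) (u v : TangentSpace (𝓡 m) p) :
    secondFF gP g F p u v = Φ.proj (F p) ((Φ.pullback hF).II p u v) := by
  rw [II_pullback, map_add, proj_J, proj_II, add_zero]

/-- The second fundamental form of a flattening is symmetric up to terms normal to `J`. -/
theorem form_pullback_II_symm (p : P) (u v : TangentSpace (𝓡 m) p) (w : TangentSpace (𝓡 n) (F p)) :
    Φ.form ((Φ.pullback hF).II p u v) (Φ.J (F p) w) =
      Φ.form ((Φ.pullback hF).II p v u) (Φ.J (F p) w) := by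
  set Ψ := Φ.pullback hF
  have hy := mem_extChartAt_target (I := 𝓡 m) p
  have hU := isOpen_extChartAt_target (I := 𝓡 m) p
  set y := extChartAt (𝓡 m) p p
  have hp : (extChartAt (𝓡 m) p).symm y = p := extChartAt_to_inv p
  -- Closedness of `J` along the composite of `F` with the inverse chart, tested against all of
  -- `T_{F p}M` and not only against vectors tangent to `P`.
  have key : ∀ (u v : Euc m) (w : TangentSpace (𝓡 n) (F p)), Φ.form (fderiv ℝ (Ψ.loc p) y u v -
      fderiv ℝ (Ψ.loc p) y v u) (Φ.J (F p) w) = 0 := by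
    intro u v
    have hc : ContMDiffOn 𝓘(ℝ, Euc m) (𝓡 n) ∞ (F ∘ (extChartAt (𝓡 m) p).symm)
        (extChartAt (𝓡 m) p).target := hF.smooth.comp_contMDiffOn (contMDiffOn_extChartAt_symm p)
    have h := Φ.torsionFree m _ _ hU hc y hy u v
    have e : ∀ v, (fun z ↦ Φ.J ((F ∘ (extChartAt (𝓡 m) p).symm) z)
        (mfderiv 𝓘(ℝ, Euc m) (𝓡 n) (F ∘ (extChartAt (𝓡 m) p).symm) z v)) =ᶠ[nhds y]
        fun z ↦ Ψ.loc p z v := by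
      intro v
      filter_upwards [hU.mem_nhds hy] with z hz
      have hd : MDifferentiableAt 𝓘(ℝ, Euc m) (𝓡 m) (extChartAt (𝓡 m) p).symm z :=
        mdifferentiableAt_extChartAt_symm hz
      exact congrArg _ (mfderiv_comp_apply z (hF.smooth.mdifferentiableAt (by simp)) hd v)
    rw [(e u).fderiv_eq, (e v).fderiv_eq, (Ψ.isFlatFrame p).fderiv_apply hy,
      (Ψ.isFlatFrame p).fderiv_apply hy] at h
    have h' : ∀ q : P, q = p → (∀ w : TangentSpace (𝓡 n) (F q), Φ.form (fderiv ℝ (Ψ.loc p) y u v -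
      fderiv ℝ (Ψ.loc p) y v u) (Φ.J (F q) w) = 0) → ∀ w : TangentSpace (𝓡 n) (F p),
      Φ.form (fderiv ℝ (Ψ.loc p) y u v - fderiv ℝ (Ψ.loc p) y v u) (Φ.J (F p) w) = 0 := by
      rintro q rfl h; exact h
    exact h' _ hp h
  have hz : Ψ.proj p (fderiv ℝ (Ψ.loc p) y u v - fderiv ℝ (Ψ.loc p) y v u) = 0 := by
    apply inner_ext gP
    intro w
    rw [inner_proj]
    exact (key _ _ _).trans (by simp)
  rw [← sub_eq_zero, ← sub_apply, ← map_sub, II_apply, II_apply, ← map_sub, nrm_apply]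
  erw [hz]
  rw [map_zero, sub_zero]
  exact key u v w

include Φ hF in
theorem secondFF_symm (p : P) (u v : TangentSpace (𝓡 m) p) :
    secondFF gP g F p u v = secondFF gP g F p v u := by
  apply inner_ext g
  intro w
  rw [Φ.secondFF_eq_proj hF, Φ.secondFF_eq_proj hF, inner_proj, inner_proj,
    form_pullback_II_symm]

end Flattening

/-! ### Smoothness of metric duals. -/

section SmoothSharp

variable {n : ℕ} {M : Type*} [TopologicalSpace M] [ChartedSpace (Euc n) M]
  [IsManifold (𝓡 n) ∞ M]

theorem contMDiffOn_coordField (p : M) (v : Euc n) :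
    ContMDiffOn (𝓡 n) (𝓡 n).tangent ∞
      (fun x ↦ (⟨x, coordField p v x⟩ : TangentBundle (𝓡 n) M)) (extChartAt (𝓡 n) p).source := by
  have h := (contMDiffOn_coordVec p v).comp (contMDiffOn_extChartAt (I := 𝓡 n) (x := p) (n := ∞))
    (fun x hx ↦ (extChartAt (𝓡 n) p).map_source (by simpa using hx))
  rw [← extChartAt_source (𝓡 n)] at h
  refine h.congr fun x hx ↦ ?_
  have hyx := (extChartAt (𝓡 n) p).map_source hx
  have e := (extChartAt (𝓡 n) p).left_inv hx
  have := coordField_eq_coordVec hyx v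
  simp only [Function.comp]
  rw [← this, e]

theorem coordMetric_eq_gramOf_coordField (g : Metric n M) {p x : M}
    (hx : x ∈ (extChartAt (𝓡 n) p).source) :
    coordMetric g p (extChartAt (𝓡 n) p x) =
      gramOf g x (fun i ↦ coordField p (stdVec i) x) := by
  have key : ∀ y ∈ (extChartAt (𝓡 n) p).target, coordMetric g p y =
      gramOf g ((extChartAt (𝓡 n) p).symm y)
        (fun i ↦ coordField p (stdVec i) ((extChartAt (𝓡 n) p).symm y)) := by
    intro y hy
    simp only [coordMetric_eq_gramOf, coordField_eq_coordVec hy]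
  rw [key _ ((extChartAt (𝓡 n) p).map_source hx), (extChartAt (𝓡 n) p).left_inv hx]

theorem sharp_eq_gramOf (g : Metric n M) {p : M} (l : TangentSpace (𝓡 n) p →ₗ[ℝ] ℝ)
    {E : Fin n → TangentSpace (𝓡 n) p} (hE : (gramOf g p E).det ≠ 0) :
    sharp g p (fun u ↦ l u) = ∑ i, ∑ j, ((gramOf g p E)⁻¹ i j * l (E j)) • E i := by
  rw [← sum_gramOf_inv_inner_smul g hE (sharp g p fun u ↦ l u)]
  simp only [inner_sharp]

/-- In the coordinate frame of the chart at `p` the coefficients are those of the inverse metric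
matrix times the values of `l` on the frame, all smooth. -/
theorem contMDiff_sharp (g : Metric n M) (l : ∀ p : M, TangentSpace (𝓡 n) p →ₗ[ℝ] ℝ)
    (hl : ∀ (p : M) (v : Euc n), ContMDiffOn (𝓡 n) 𝓘(ℝ) ∞ (fun x ↦ l x (coordField p v x))
      (extChartAt (𝓡 n) p).source) :
    ContMDiff (𝓡 n) (𝓡 n).tangent ∞
      (fun x ↦ (⟨x, sharp g x (fun u ↦ l x u)⟩ : TangentBundle (𝓡 n) M)) := by
  intro p
  have hs : (extChartAt (𝓡 n) p).source ∈ nhds p := extChartAt_source_mem_nhds p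
  have hinv : ∀ i j, ContMDiffOn (𝓡 n) 𝓘(ℝ) ∞
      (fun x ↦ (coordMetric g p (extChartAt (𝓡 n) p x))⁻¹ i j) (extChartAt (𝓡 n) p).source := by
    intro i j
    have h1 := (contMDiffOn_iff_contDiffOn.2 ((isMetricOn_coordMetric g p).contDiffOn_inv i j)).comp
      (contMDiffOn_extChartAt (I := 𝓡 n) (x := p) (n := ∞))
      (fun x hx ↦ (extChartAt (𝓡 n) p).map_source (by simpa using hx))
    rw [← extChartAt_source (𝓡 n)] at h1
    exact h1
  have h : ContMDiffOn (𝓡 n) (𝓡 n).tangent ∞ (fun x ↦ (⟨x, ∑ i, ∑ j,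
      ((coordMetric g p (extChartAt (𝓡 n) p x))⁻¹ i j * l x (coordField p (stdVec j) x)) •
        coordField p (stdVec i) x⟩ : TangentBundle (𝓡 n) M)) (extChartAt (𝓡 n) p).source :=
    ContMDiffOn.sum_section fun i _ ↦ ContMDiffOn.sum_section fun j _ ↦
      ((hinv i j).mul (hl p _)).smul_section (contMDiffOn_coordField p _)
  refine (h.congr fun x hx ↦ ?_).contMDiffAt hs
  have hd : (gramOf g x (fun i ↦ coordField p (stdVec i) x)).det ≠ 0 := by
    rw [← coordMetric_eq_gramOf_coordField g hx]
    exact (coordMetric_det_pos g ((extChartAt (𝓡 n) p).map_source hx)).ne'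
  rw [sharp_eq_gramOf g (l x) hd, coordMetric_eq_gramOf_coordField g hx]

theorem contMDiffOn_oneForm_apply (α : OneForm n M) {V : ∀ x : M, TangentSpace (𝓡 n) x} {s : Set M}
    (hV : ContMDiffOn (𝓡 n) (𝓡 n).tangent ∞ (fun x ↦ (⟨x, V x⟩ : TangentBundle (𝓡 n) M)) s) :
    ContMDiffOn (𝓡 n) 𝓘(ℝ) ∞ (fun x ↦ α x (V x)) s := by
  have h := ContMDiffOn.clm_bundle_apply (E₁ := fun x : M ↦ TangentSpace (𝓡 n) x)
    (E₂ := Bundle.Trivial M ℝ) (b := fun x ↦ x) (ϕ := fun x ↦ α x) α.contMDiff.contMDiffOn hV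
  intro x hx
  exact (Bundle.contMDiffWithinAt_totalSpace.1 (h x hx)).2

theorem contMDiff_sharpForm (g : Metric n M) (α : OneForm n M) :
    ContMDiff (𝓡 n) (𝓡 n).tangent ∞
      (fun x ↦ (⟨x, sharpForm g α x⟩ : TangentBundle (𝓡 n) M)) :=
  contMDiff_sharp g (fun x ↦ (α x).toLinearMap) fun p v ↦
    contMDiffOn_oneForm_apply α (contMDiffOn_coordField p v)

theorem inner_sharpForm (g : Metric n M) (α : OneForm n M) (p : M) (u : TangentSpace (𝓡 n) p) :
    g.inner p (sharpForm g α p) u = α p u :=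
  inner_sharp g p (α p).toLinearMap u

theorem contDiffOn_coordForm (α : OneForm n M) (p : M) (i : Fin n) :
    ContDiffOn ℝ ∞ (coordForm α p i) (extChartAt (𝓡 n) p).target := by
  rw [← contMDiffOn_iff_contDiffOn]
  have h := (contMDiffOn_oneForm_apply α (contMDiffOn_coordField p (stdVec i))).comp
    (contMDiffOn_extChartAt_symm (I := 𝓡 n) (n := ∞) p)
    (fun y hy ↦ (extChartAt (𝓡 n) p).map_target hy)
  refine h.congr fun y hy ↦ ?_
  exact congrArg _ (coordField_eq_coordVec hy _).symm

theorem contMDiff_mvfderiv {E : Type*} [NormedAddCommGroup E] [NormedSpace ℝ E] (X : VField n M)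
    {f : M → E} (hf : ContMDiff (𝓡 n) 𝓘(ℝ, E) ∞ f) :
    ContMDiff (𝓡 n) 𝓘(ℝ, E) ∞ (fun x ↦ mvfderiv (𝓡 n) f x (X x)) := by
  have h1 : ContMDiff (𝓡 n).tangent 𝓘(ℝ, E).tangent ∞ (tangentMap (𝓡 n) 𝓘(ℝ, E) f) :=
    hf.contMDiff_tangentMap (by simp)
  have h2 := h1.comp X.contMDiff
  intro x
  have h3 := (Bundle.contMDiffAt_totalSpace.1 (h2 x)).2
  simpa [tangentMap, mvfderiv] using! h3

end SmoothSharp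

/-! ### The global weighted frame of a flattening. -/

namespace Flattening

variable {n D : ℕ} {M : Type*} [TopologicalSpace M] [ChartedSpace (Euc n) M]
  [IsManifold (𝓡 n) ∞ M] {g : Metric n M} (Φ : Flattening g D)

theorem contMDiffOn_J_apply {V : ∀ x : M, TangentSpace (𝓡 n) x} {s : Set M}
    (hV : ContMDiffOn (𝓡 n) (𝓡 n).tangent ∞ (fun x ↦ (⟨x, V x⟩ : TangentBundle (𝓡 n) M)) s) :
    ContMDiffOn (𝓡 n) 𝓘(ℝ, Fin D → ℝ) ∞ (fun x ↦ Φ.J x (V x)) s :=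
  Φ.smooth.comp_contMDiffOn hV

theorem contMDiff_J (V : VField n M) :
    ContMDiff (𝓡 n) 𝓘(ℝ, Fin D → ℝ) ∞ (fun x ↦ Φ.J x (V x)) :=
  Φ.smooth.comp V.contMDiff

theorem contMDiffOn_J_coordField (c : Fin D) (p : M) (v : Euc n) :
    ContMDiffOn (𝓡 n) 𝓘(ℝ) ∞ (fun x ↦ Φ.J x (coordField p v x) c) (extChartAt (𝓡 n) p).source :=
  (ContinuousLinearMap.proj (R := ℝ) (φ := fun _ : Fin D ↦ ℝ) c).contMDiff.comp_contMDiffOn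
    (Φ.contMDiffOn_J_apply (contMDiffOn_coordField p v))

/-- The components of `J`. -/
def component (c : Fin D) (p : M) : TangentSpace (𝓡 n) p →ₗ[ℝ] ℝ :=
  LinearMap.proj c ∘ₗ (Φ.J p).toLinearMap

/-- The vector fields dual to the components of `J`. -/
def frame (c : Fin D) : VField n M where
  toFun p := sharp g p fun u ↦ Φ.component c p u
  contMDiff_toFun := contMDiff_sharp g (Φ.component c) (Φ.contMDiffOn_J_coordField c)

theorem inner_frame (c : Fin D) (p : M) (u : TangentSpace (𝓡 n) p) :
    g.inner p (Φ.frame c p) u = Φ.J p u c :=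
  inner_sharp g p (Φ.component c p) u

theorem proj_eq_sum (p : M) (z : Fin D → ℝ) : Φ.proj p z = ∑ c, (Φ.ε c * z c) • Φ.frame c p := by
  apply inner_ext g
  intro u
  rw [inner_proj]
  simp only [map_sum, map_smul, sum_apply, smul_apply, inner_frame, smul_eq_mul, form,
    weightedForm_apply, mul_assoc]

theorem sum_frame (p : M) (u : TangentSpace (𝓡 n) p) :
    ∑ c, (Φ.ε c * Φ.J p u c) • Φ.frame c p = u := by
  rw [← proj_eq_sum, proj_J]

/-- The fields dual to the components of `J` form a frame that is its own dual up to the weights.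
Traces thus become finite sums over globally smooth fields, which proves continuity without local
orthonormal frames. -/
theorem metricTrace_eq_frame {W : Type*} [AddCommGroup W] [Module ℝ W] (p : M)
    (B : TangentSpace (𝓡 n) p →ₗ[ℝ] TangentSpace (𝓡 n) p →ₗ[ℝ] W) :
    metricTrace g p (fun u v ↦ B u v) = ∑ c, Φ.ε c • B (Φ.frame c p) (Φ.frame c p) := by
  rw [metricTrace_eq_sum g B (fun c ↦ Φ.frame c p) (fun c ↦ Φ.ε c • Φ.frame c p)]
  · simp
  · intro u
    simp only [g.symm p u, inner_frame, smul_smul]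
    simpa only [mul_comm] using Φ.sum_frame p u

/-- By the Gauss formula, `II` is the normal part of the derivative of a smooth vector-valued
function along a smooth field. -/
theorem continuous_II_frame (c d : Fin D) :
    Continuous (fun p ↦ Φ.II p (Φ.frame c p) (Φ.frame d p)) := by
  have e : ∀ p, Φ.II p (Φ.frame c p) (Φ.frame d p) =
      Φ.nrm p (mvfderiv (𝓡 n) (fun x ↦ Φ.J x (Φ.frame d x)) p (Φ.frame c p)) := by
    intro p
    have h := Φ.mvfderiv_J (F := fun x ↦ x) (Φ.frame d).mdifferentiableAt (p := p) (Φ.frame c p)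
    refine Eq.trans ?_ (congrArg _ h.symm)
    have hid : mfderiv (𝓡 n) (𝓡 n) (fun x : M ↦ x) p = .id ℝ _ := mfderiv_id
    rw [map_add, nrm_J, zero_add, hid, nrm_eq_self Φ (fun u ↦ Φ.form_II_J _ _ _ _)]
    rfl
  simp only [e, nrm_apply, proj_eq_sum, map_sum, map_smul]
  have h1 := (contMDiff_mvfderiv (Φ.frame c) (Φ.contMDiff_J (Φ.frame d))).continuous
  exact h1.sub (continuous_finsetSum _ fun i _ ↦ ((continuous_const.mul
    ((continuous_apply i).comp h1)).smul (Φ.contMDiff_J _).continuous))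

theorem continuous_II {Q : Type*} [TopologicalSpace Q] {q : Q → M} (hq : Continuous q)
    {V W : ∀ x, TangentSpace (𝓡 n) (q x)} (hV : Continuous fun x ↦ Φ.J (q x) (V x))
    (hW : Continuous fun x ↦ Φ.J (q x) (W x)) : Continuous fun x ↦ Φ.II (q x) (V x) (W x) := by
  have e : ∀ x, Φ.II (q x) (V x) (W x) = ∑ c, ∑ d, ((Φ.ε c * Φ.J (q x) (V x) c) *
      (Φ.ε d * Φ.J (q x) (W x) d)) • Φ.II (q x) (Φ.frame c (q x)) (Φ.frame d (q x)) := by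
    intro x
    conv_lhs => rw [← Φ.sum_frame (q x) (V x), ← Φ.sum_frame (q x) (W x)]
    simp only [map_sum, map_smul, LinearMap.sum_apply, LinearMap.smul_apply, Finset.smul_sum,
      smul_smul]
    rw [Finset.sum_comm]
    simp only [mul_comm]
  simp only [e]
  exact continuous_finsetSum _ fun c _ ↦ continuous_finsetSum _ fun d _ ↦
    (((continuous_const.mul ((continuous_apply c).comp hV)).mul
      (continuous_const.mul ((continuous_apply d).comp hW))).smul
      ((Φ.continuous_II_frame c d).comp hq))

end Flattening

/-! ### Covariant derivatives of dual one-forms. -/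

namespace Flattening

variable {n D : ℕ} {M : Type*} [TopologicalSpace M] [ChartedSpace (Euc n) M]
  [IsManifold (𝓡 n) ∞ M] {g : Metric n M} (Φ : Flattening g D)

theorem contDiffOn_J_loc (T : VField n M) (x : M) :
    ContDiffOn ℝ ∞ (fun z ↦ Φ.J ((extChartAt (𝓡 n) x).symm z) (T ((extChartAt (𝓡 n) x).symm z)))
      (extChartAt (𝓡 n) x).target :=
  contDiffOn_comp_extChartAt_symm (Φ.contMDiff_J T) x

/-- The covariant derivative of the one-form dual to `T`, in terms of the derivative of `J T`. -/
theorem covForm_eq (T : VField n M) (x : M) {a : Fin n → Euc n → ℝ}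
    (ha : ∀ j, ∀ z ∈ (extChartAt (𝓡 n) x).target, a j z =
      g.inner ((extChartAt (𝓡 n) x).symm z) (T ((extChartAt (𝓡 n) x).symm z))
        (coordVec x z (stdVec j)))
    {y : Euc n} (hy : y ∈ (extChartAt (𝓡 n) x).target) (i j : Fin n) :
    covForm (coordMetric g x) a i j y =
      Φ.form (mvfderiv (𝓡 n) (fun p ↦ Φ.J p (T p)) ((extChartAt (𝓡 n) x).symm y)
        (coordVec x y (stdVec i))) (Φ.J ((extChartAt (𝓡 n) x).symm y) (coordVec x y (stdVec j))) := by
  have H := Φ.isFlatFrame x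
  have hU := isOpen_extChartAt_target (I := 𝓡 n) x
  set G : Euc n → (Fin D → ℝ) := fun z ↦
    Φ.J ((extChartAt (𝓡 n) x).symm z) (T ((extChartAt (𝓡 n) x).symm z)) with hG
  have ha' : ∀ j, ∀ z ∈ (extChartAt (𝓡 n) x).target, a j z = Φ.form (G z) (Φ.loc x z (stdVec j)) :=
    fun j z hz ↦ (ha j z hz).trans (Φ.form_J _ _ _).symm
  rw [mvfderiv_coordVec hy ((Φ.contMDiff_J T).mdifferentiableAt (by simp)), covForm,
    partialD_congr hU hy (ha' j), partialD_bilin Φ.form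
      (differentiableAt_of_contDiffOn hU (Φ.contDiffOn_J_loc T x) hy)
      (H.differentiableAt_apply hy _), H.fderiv_apply hy]
  obtain ⟨c, hc⟩ : ∃ c : Fin n → ℝ, G y = ∑ l, c l • Φ.loc x y (stdVec l) := by
    have hE := coordMetric_det_pos g hy
    rw [coordMetric_eq_gramOf] at hE
    have h := sum_gramOf_inv_inner_smul g hE.ne' (T ((extChartAt (𝓡 n) x).symm y))
    simp only [← Finset.sum_smul] at h
    obtain ⟨c, hc⟩ : ∃ c : Fin n → ℝ, T ((extChartAt (𝓡 n) x).symm y) =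
      ∑ l, c l • coordVec x y (stdVec l) := ⟨_, h.symm⟩
    refine ⟨c, (congrArg (Φ.J _) hc).trans ?_⟩
    simp only [map_sum, map_smul]
    rfl
  -- As `J T` is tangential, the Christoffel term of the covariant derivative equals the term of the
  -- product rule in which `J(e_j)` is differentiated, and the two cancel.
  have e : ∑ k, christoffel (coordMetric g x) k i j y * a k y =
      Φ.form (G y) (fderiv ℝ (Φ.loc x) y (stdVec i) (stdVec j)) := by
    simp only [fun k ↦ ha' k y hy, hc, map_sum, map_smul, sum_apply, smul_apply, smul_eq_mul]
    rw [show (∑ l, c l * Φ.form (Φ.loc x y (stdVec l)) (fderiv ℝ (Φ.loc x) y (stdVec i) (stdVec j))) =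
      ∑ l, c l * ∑ k, coordMetric g x y l k * christoffel (coordMetric g x) k i j y from
      Finset.sum_congr rfl fun l _ ↦ by rw [H.sum_mul_christoffel hy, H.symm_form]]
    simp only [Finset.mul_sum, H.gram y hy]
    rw [Finset.sum_comm]
    refine Finset.sum_congr rfl fun l _ ↦ Finset.sum_congr rfl fun k _ ↦ ?_
    ring
  rw [e, add_sub_cancel_left]
  rfl

/-- The bilinear form `(u, w) ↦ ⟨∇_u T, w⟩`. -/
def covBilin (T : VField n M) (p : M) :
    TangentSpace (𝓡 n) p →ₗ[ℝ] TangentSpace (𝓡 n) p →ₗ[ℝ] ℝ :=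
  LinearMap.mk₂ ℝ (fun u w ↦ Φ.form (mvfderiv (𝓡 n) (fun p ↦ Φ.J p (T p)) p u) (Φ.J p w))
    (fun _ _ _ ↦ by rw [map_add, map_add, add_apply])
    (fun _ _ _ ↦ by rw [map_smul, map_smul, smul_apply])
    (fun _ _ _ ↦ by rw [map_add, map_add])
    (fun _ _ _ ↦ by rw [map_smul, map_smul])

theorem covBilin_apply (T : VField n M) (p : M) (u w : TangentSpace (𝓡 n) p) :
    Φ.covBilin T p u w = Φ.form (mvfderiv (𝓡 n) (fun p ↦ Φ.J p (T p)) p u) (Φ.J p w) := rfl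

end Flattening

/-! ### The Laplacian of a function on a manifold. -/

section Laplacian

variable {n D : ℕ} {M : Type*} [TopologicalSpace M] [ChartedSpace (Euc n) M]
  [IsManifold (𝓡 n) ∞ M]

/-- The Laplacian of a function. -/
def laplacian (g : Metric n M) (f : M → ℝ) (p : M) : ℝ :=
  coordLaplacian (coordMetric g p) (fun y ↦ f ((extChartAt (𝓡 n) p).symm y)) (extChartAt (𝓡 n) p p)

/-- The gradient of a smooth function. -/
def gradient (g : Metric n M) {f : M → ℝ} (hf : ContMDiff (𝓡 n) 𝓘(ℝ) ∞ f) : VField n M where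
  toFun p := sharp g p fun u ↦ (mvfderiv (𝓡 n) f p).toLinearMap u
  contMDiff_toFun := by
    refine contMDiff_sharp g (fun p ↦ (mvfderiv (𝓡 n) f p).toLinearMap) fun p v ↦ ?_
    have h1 : ContMDiff (𝓡 n).tangent 𝓘(ℝ).tangent ∞ (tangentMap (𝓡 n) 𝓘(ℝ) f) :=
      hf.contMDiff_tangentMap (by simp)
    have h2 := h1.comp_contMDiffOn (contMDiffOn_coordField p v)
    intro x hx
    have h3 := (Bundle.contMDiffWithinAt_totalSpace.1 (h2 x hx)).2
    simpa [tangentMap, mvfderiv] using! h3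

theorem inner_gradient (g : Metric n M) {f : M → ℝ} (hf : ContMDiff (𝓡 n) 𝓘(ℝ) ∞ f) (p : M)
    (u : TangentSpace (𝓡 n) p) : g.inner p (gradient g hf p) u = mvfderiv (𝓡 n) f p u :=
  inner_sharp g p (mvfderiv (𝓡 n) f p).toLinearMap u

variable {g : Metric n M} (Φ : Flattening g D) {f : M → ℝ} (hf : ContMDiff (𝓡 n) 𝓘(ℝ) ∞ f)

/-- The right-hand side is the trace of `∇ grad f`, in which the chart enters only through the base
point. Hence coordinate Laplacians in different charts agree. -/
theorem coordLaplacian_eq_metricTrace (x : M) {y : Euc n} (hy : y ∈ (extChartAt (𝓡 n) x).target) :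
    coordLaplacian (coordMetric g x) (fun y ↦ f ((extChartAt (𝓡 n) x).symm y)) y =
      metricTrace g ((extChartAt (𝓡 n) x).symm y)
        (fun u w ↦ Φ.covBilin (gradient g hf) ((extChartAt (𝓡 n) x).symm y) u w) := by
  have hE := coordMetric_det_pos g hy
  rw [coordMetric_eq_gramOf] at hE
  rw [metricTrace_eq_gramOf g _ hE.ne', ← coordMetric_eq_gramOf]
  simp only [Flattening.covBilin_apply, smul_eq_mul]
  have h := fun i j ↦ Φ.covForm_eq (gradient g hf) x
    (a := fun j ↦ partialD j (fun y ↦ f ((extChartAt (𝓡 n) x).symm y)))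
    (fun j z hz ↦ ((inner_gradient g hf _ _).trans
      (mvfderiv_coordVec hz (hf.mdifferentiableAt (by simp)) _)).symm) hy i j
  simp only [← h]
  rfl

theorem metricTrace_congr_base {g : Metric n M} (B : ∀ p : M, TangentSpace (𝓡 n) p →ₗ[ℝ]
    TangentSpace (𝓡 n) p →ₗ[ℝ] ℝ) {p q : M} (h : p = q) :
    metricTrace g p (fun u w ↦ B p u w) = metricTrace g q (fun u w ↦ B q u w) := by
  subst h; rfl

theorem laplacian_eq_metricTrace (p : M) :
    laplacian g f p = metricTrace g p (fun u w ↦ Φ.covBilin (gradient g hf) p u w) := by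
  rw [laplacian, coordLaplacian_eq_metricTrace Φ hf p (mem_extChartAt_target (I := 𝓡 n) p)]
  exact metricTrace_congr_base (Φ.covBilin (gradient g hf)) (extChartAt_to_inv (I := 𝓡 n) p)

include Φ hf in
theorem coordLaplacian_eq_laplacian (x : M) {y : Euc n} (hy : y ∈ (extChartAt (𝓡 n) x).target) :
    coordLaplacian (coordMetric g x) (fun y ↦ f ((extChartAt (𝓡 n) x).symm y)) y =
      laplacian g f ((extChartAt (𝓡 n) x).symm y) := by
  rw [coordLaplacian_eq_metricTrace Φ hf x hy, ← laplacian_eq_metricTrace]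

include Φ hf in
theorem continuous_laplacian : Continuous (laplacian g f) := by
  have e : laplacian g f = fun p ↦ ∑ c, Φ.ε c *
      Φ.form (mvfderiv (𝓡 n) (fun p ↦ Φ.J p (gradient g hf p)) p (Φ.frame c p))
        (Φ.J p (Φ.frame c p)) := by
    ext p
    rw [laplacian_eq_metricTrace Φ hf, Φ.metricTrace_eq_frame]
    rfl
  rw [e]
  refine continuous_finsetSum _ fun c _ ↦ continuous_const.mul ?_
  exact (Φ.form.continuous.comp (contMDiff_mvfderiv (Φ.frame c)
    (Φ.contMDiff_J (gradient g hf))).continuous).clm_apply (Φ.contMDiff_J (Φ.frame c)).continuous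

end Laplacian

/-! ### The divergence theorem in a coordinate domain. -/

section Divergence

variable {n : ℕ}

/-- The integral of a partial derivative of a compactly supported function vanishes. -/
theorem setIntegral_partialD_eq_zero {U K : Set (Euc n)} (hU : IsOpen U) (hK : IsCompact K)
    (hKU : K ⊆ U) {W : Euc n → ℝ} (hW : ContDiffOn ℝ ∞ W U) (hWK : ∀ z ∈ U, z ∉ K → W z = 0)
    (i : Fin n) : ∫ z in U, partialD i W z = 0 := by
  classical
  -- Extension by zero stays smooth, since `W` vanishes on `U` outside the compact set `K ⊆ U`.
  set W' : Euc n → ℝ := U.indicator W with hW'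
  have hzero : ∀ z ∉ K, W' z = 0 := by
    intro z hz
    by_cases hzU : z ∈ U
    · rw [hW', Set.indicator_of_mem hzU, hWK z hzU hz]
    · rw [hW', Set.indicator_of_notMem hzU]
  have hevU : ∀ z ∈ U, W' =ᶠ[nhds z] W := fun z hz ↦ by
    filter_upwards [hU.mem_nhds hz] with x hx
    exact Set.indicator_of_mem hx W
  have hsm : ContDiff ℝ ∞ W' := by
    rw [contDiff_iff_contDiffAt]
    intro z
    by_cases hz : z ∈ U
    · exact (hW.contDiffAt (hU.mem_nhds hz)).congr_of_eventuallyEq (hevU z hz)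
    · have : W' =ᶠ[nhds z] fun _ ↦ 0 := by
        filter_upwards [hK.isClosed.isOpen_compl.mem_nhds fun h ↦ hz (hKU h)] with x hx
        exact hzero x hx
      exact contDiffAt_const.congr_of_eventuallyEq this
  have hcs : HasCompactSupport W' := HasCompactSupport.intro hK fun z hz ↦ hzero z hz
  have hcs' : HasCompactSupport (fun z ↦ fderiv ℝ W' z (stdVec i)) := hcs.fderiv_apply ℝ _
  -- Integration by parts against the constant function `1`.
  have hint : ∫ z, 1 * fderiv ℝ W' z (stdVec i) = -∫ z, fderiv ℝ (fun _ ↦ (1 : ℝ)) z (stdVec i) * W' z := by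
    apply integral_mul_fderiv_eq_neg_fderiv_mul_of_integrable
    · simp
    · simpa using ((hsm.continuous_fderiv (by simp)).clm_apply
        continuous_const).integrable_of_hasCompactSupport hcs'
    · simpa using hsm.continuous.integrable_of_hasCompactSupport hcs
    · exact fun _ _ ↦ differentiableAt_const _
    · exact fun _ _ ↦ (hsm.differentiable (by simp)).differentiableAt
  have e : ∫ z in U, partialD i W z = ∫ z, fderiv ℝ W' z (stdVec i) := by
    refine Eq.trans ?_ (setIntegral_eq_integral_of_forall_compl_eq_zero (s := U) ?_)
    · refine setIntegral_congr_fun hU.measurableSet fun z hz ↦ ?_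
      simp only [partialD, (hevU z hz).fderiv_eq]
    · intro z hz
      have : W' =ᶠ[nhds z] fun _ ↦ 0 := by
        filter_upwards [hK.isClosed.isOpen_compl.mem_nhds fun h ↦ hz (hKU h)] with x hx
        exact hzero x hx
      rw [this.fderiv_eq]
      simp
  rw [e]
  simpa using hint

theorem coordLaplacian_congr {h : Euc n → Matrix (Fin n) (Fin n) ℝ} {f f' : Euc n → ℝ} {y : Euc n}
    (hff : f =ᶠ[nhds y] f') : coordLaplacian h f y = coordLaplacian h f' y := by
  have h1 : ∀ j, partialD j f =ᶠ[nhds y] partialD j f' := fun j ↦ by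
    filter_upwards [hff.fderiv (𝕜 := ℝ)] with z hz
    simp only [partialD, hz]
  have h2 : ∀ i j, partialD i (partialD j f) y = partialD i (partialD j f') y := fun i j ↦ by
    rw [partialD, (h1 j).fderiv_eq, partialD]
  have h3 : ∀ j, partialD j f y = partialD j f' y := fun j ↦ (h1 j).self_of_nhds
  simp only [coordLaplacian, h2, h3]

theorem coordLaplacian_zero {h : Euc n → Matrix (Fin n) (Fin n) ℝ} {y : Euc n} :
    coordLaplacian h (fun _ ↦ 0) y = 0 := by
  have : ∀ j, partialD j (fun _ : Euc n ↦ (0 : ℝ)) = fun _ ↦ 0 := fun j ↦ by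
    ext z; simp [partialD]
  simp [coordLaplacian, this]

theorem coordLaplacian_sum {h : Euc n → Matrix (Fin n) (Fin n) ℝ} {U : Set (Euc n)} (hU : IsOpen U)
    {ι : Type*} (t : Finset ι) {f : ι → Euc n → ℝ} (hf : ∀ a, ContDiffOn ℝ ∞ (f a) U) {y : Euc n}
    (hy : y ∈ U) :
    coordLaplacian h (fun z ↦ ∑ a ∈ t, f a z) y = ∑ a ∈ t, coordLaplacian h (f a) y := by
  have h1 : ∀ j, ∀ z ∈ U, partialD j (fun z ↦ ∑ a ∈ t, f a z) z = ∑ a ∈ t, partialD j (f a) z :=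
    fun j z hz ↦ partialD_sum (fun a _ ↦ differentiableAt_of_contDiffOn hU (hf a) hz) j
  have h2 : ∀ i j, partialD i (partialD j (fun z ↦ ∑ a ∈ t, f a z)) y =
      ∑ a ∈ t, partialD i (partialD j (f a)) y := fun i j ↦ by
    rw [partialD_congr hU hy (h1 j)]
    exact partialD_sum (fun a _ ↦
      differentiableAt_of_contDiffOn hU (contDiffOn_partialD hU (hf a) j) hy) i
  symm
  refine Finset.sum_comm.trans (Finset.sum_congr rfl fun i _ ↦ Finset.sum_comm.trans
    (Finset.sum_congr rfl fun j _ ↦ ?_))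
  rw [← Finset.mul_sum, Finset.sum_sub_distrib, h2, Finset.sum_comm]
  simp only [h1 _ y hy, Finset.mul_sum]

end Divergence

/-! ### The Riemannian measure and the integral of a Laplacian. -/

section Measure

variable {n : ℕ} {M : Type*} [TopologicalSpace M] [ChartedSpace (Euc n) M]
  [IsManifold (𝓡 n) ∞ M] [MeasurableSpace M] [BorelSpace M] (g : Metric n M)

theorem continuousOn_sqrt_det (x : M) :
    ContinuousOn (fun y ↦ Real.sqrt (coordMetric g x y).det) (extChartAt (𝓡 n) x).target :=
  (contDiffOn_det (isMetricOn_coordMetric g x).smooth).continuousOn.sqrt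

theorem aemeasurable_sqrt_det (x : M) :
    AEMeasurable (fun y ↦ ENNReal.ofReal (Real.sqrt (coordMetric g x y).det))
      (volume.restrict (extChartAt (𝓡 n) x).target) :=
  ((continuousOn_sqrt_det g x).aemeasurable
    (isOpen_extChartAt_target x).measurableSet).ennreal_ofReal

theorem aemeasurable_extChartAt_symm (x : M) :
    AEMeasurable (extChartAt (𝓡 n) x).symm
      ((volume.restrict (extChartAt (𝓡 n) x).target).withDensity fun y ↦
        ENNReal.ofReal (Real.sqrt (coordMetric g x y).det)) :=
  ((continuousOn_extChartAt_symm x).aemeasurable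
    (isOpen_extChartAt_target x).measurableSet).mono_ac (withDensity_absolutelyContinuous _ _)

theorem measurableSet_target_inter_preimage (x : M) {A : Set M} (hA : MeasurableSet A) :
    MeasurableSet ((extChartAt (𝓡 n) x).target ∩ (extChartAt (𝓡 n) x).symm ⁻¹' A) := by
  have h1 : Measurable ((extChartAt (𝓡 n) x).target.domRestrict (extChartAt (𝓡 n) x).symm) :=
    (continuousOn_iff_continuous_domRestrict.1 (continuousOn_extChartAt_symm x)).measurable
  have h2 := (isOpen_extChartAt_target (I := 𝓡 n) x).measurableSet.subtype_image (h1 hA)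
  convert h2 using 1
  ext z
  constructor
  · rintro ⟨h1, h2⟩
    exact ⟨⟨z, h1⟩, h2, rfl⟩
  · rintro ⟨⟨w, hw⟩, hA, rfl⟩
    exact ⟨hw, hA⟩

theorem chartMeasure_apply (x : M) {A : Set M} (hA : MeasurableSet A) :
    chartMeasure g x A =
      ∫⁻ y in (extChartAt (𝓡 n) x).target ∩ (extChartAt (𝓡 n) x).symm ⁻¹' A,
        ENNReal.ofReal (Real.sqrt (coordMetric g x y).det) := by
  have hT := (isOpen_extChartAt_target (I := 𝓡 n) x).measurableSet
  rw [chartMeasure, Measure.map_apply_of_aemeasurable (aemeasurable_extChartAt_symm g x) hA,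
    ← restrict_withDensity hT, Measure.restrict_apply' hT, Set.inter_comm,
    withDensity_apply _ (measurableSet_target_inter_preimage x hA)]

theorem coordField_mfderiv {y q : M} (hq : q ∈ (extChartAt (𝓡 n) y).source)
    (w : TangentSpace (𝓡 n) q) :
    coordField y (mvfderiv (𝓡 n) (extChartAt (𝓡 n) y) q w) q = w := by
  have key : ∀ z ∈ (extChartAt (𝓡 n) y).target,
      ∀ w : TangentSpace (𝓡 n) ((extChartAt (𝓡 n) y).symm z),
      coordField y (mvfderiv (𝓡 n) (extChartAt (𝓡 n) y) ((extChartAt (𝓡 n) y).symm z) w)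
        ((extChartAt (𝓡 n) y).symm z) = w := by
    intro z hz w
    rw [coordField_eq_coordVec hz]
    exact coordVec_mfderiv_extChartAt hz w
  have h := key _ ((extChartAt (𝓡 n) y).map_source hq)
  rw [(extChartAt (𝓡 n) y).left_inv hq] at h
  exact h w

/-- The transformation law of the metric under a change of charts. -/
theorem coordMetric_change {x y : M} {z : Euc n} (hz : z ∈ (extChartAt (𝓡 n) x).target)
    (hq : (extChartAt (𝓡 n) x).symm z ∈ (extChartAt (𝓡 n) y).source) :
    Real.sqrt (coordMetric g x z).det =
      |(fderiv ℝ (fun z ↦ extChartAt (𝓡 n) y ((extChartAt (𝓡 n) x).symm z)) z).det| *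
        Real.sqrt (coordMetric g y (extChartAt (𝓡 n) y ((extChartAt (𝓡 n) x).symm z))).det := by
  set τ := fderiv ℝ (fun z ↦ extChartAt (𝓡 n) y ((extChartAt (𝓡 n) x).symm z)) z with hτ
  set q := (extChartAt (𝓡 n) x).symm z with hqdef
  let A : Matrix (Fin n) (Fin n) ℝ := .of fun k i ↦ τ (stdVec i) k
  have hA : τ.det = A.det := by
    rw [ContinuousLinearMap.det, ← LinearMap.det_toMatrix (EuclideanSpace.basisFun (Fin n) ℝ).toBasis]
    congr 1
  have hvec : ∀ i, coordVec x z (stdVec i) = ∑ k, A k i • coordField y (stdVec k) q := by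
    intro i
    have hd : MDifferentiableAt (𝓡 n) 𝓘(ℝ, Euc n) (extChartAt (𝓡 n) y) q :=
      mdifferentiableAt_extChartAt (by simpa using hq)
    have h1 := mvfderiv_coordVec hz hd (stdVec i)
    rw [← coordField_mfderiv hq (coordVec x z (stdVec i)), h1]
    change (mfderiv (𝓡 n) 𝓘(ℝ, Euc n) (extChartAt (𝓡 n) y) q).inverse (τ (stdVec i)) = _
    have key : ∀ (L : Euc n →L[ℝ] TangentSpace (𝓡 n) q) (v : Euc n),
        L v = ∑ k, v k • L (stdVec k) := by
      intro L v
      conv_lhs => rw [Flattening.eq_sum_stdVec v]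
      simp only [map_sum, map_smul]
    exact key _ _
  have hmat : coordMetric g x z = A.transpose * coordMetric g y (extChartAt (𝓡 n) y q) * A := by
    rw [coordMetric_eq_gramOf_coordField g hq]
    ext i j
    have : coordMetric g x z i j = g.inner q (coordVec x z (stdVec i)) (coordVec x z (stdVec j)) := rfl
    rw [this, hvec, hvec]
    simp only [map_sum, map_smul, sum_apply, smul_apply, smul_eq_mul, Matrix.mul_apply, gramOf,
      Matrix.of_apply, Matrix.transpose_apply, Finset.mul_sum, Finset.sum_mul]
    refine Finset.sum_congr rfl fun k _ ↦ Finset.sum_congr rfl fun l _ ↦ ?_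
    ring
  rw [hmat, Matrix.det_mul, Matrix.det_mul, Matrix.det_transpose, hA,
    show A.det * (coordMetric g y (extChartAt (𝓡 n) y q)).det * A.det =
      A.det ^ 2 * (coordMetric g y (extChartAt (𝓡 n) y q)).det by ring,
    Real.sqrt_mul (sq_nonneg _), Real.sqrt_sq_eq_abs]

/-- Change of variables: the Jacobian of the transition map is absorbed by the transformation law of
`√det`. -/
theorem chartMeasure_apply_eq (x y : M) {A : Set M} (hA : MeasurableSet A)
    (hAx : A ⊆ (extChartAt (𝓡 n) x).source) (hAy : A ⊆ (extChartAt (𝓡 n) y).source) :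
    chartMeasure g x A = chartMeasure g y A := by
  rw [chartMeasure_apply g x hA, chartMeasure_apply g y hA]
  set s := (extChartAt (𝓡 n) x).target ∩ (extChartAt (𝓡 n) x).symm ⁻¹' A with hs
  have himg : (fun z ↦ extChartAt (𝓡 n) y ((extChartAt (𝓡 n) x).symm z)) '' s =
      (extChartAt (𝓡 n) y).target ∩ (extChartAt (𝓡 n) y).symm ⁻¹' A := by
    ext w
    constructor
    · rintro ⟨z, ⟨hz, hzA⟩, rfl⟩
      refine ⟨(extChartAt (𝓡 n) y).map_source (hAy hzA), ?_⟩
      rw [Set.mem_preimage, (extChartAt (𝓡 n) y).left_inv (hAy hzA)]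
      exact hzA
    · rintro ⟨hw, hwA⟩
      refine ⟨extChartAt (𝓡 n) x ((extChartAt (𝓡 n) y).symm w),
        ⟨(extChartAt (𝓡 n) x).map_source (hAx hwA), ?_⟩, ?_⟩
      · rw [Set.mem_preimage, (extChartAt (𝓡 n) x).left_inv (hAx hwA)]
        exact hwA
      · beta_reduce
        rw [(extChartAt (𝓡 n) x).left_inv (hAx hwA), (extChartAt (𝓡 n) y).right_inv hw]
  rw [← himg, lintegral_image_eq_lintegral_abs_det_fderiv_mul volume
    (f' := fderiv ℝ (fun z ↦ extChartAt (𝓡 n) y ((extChartAt (𝓡 n) x).symm z)))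
    (measurableSet_target_inter_preimage x hA)]
  · refine setLIntegral_congr_fun (measurableSet_target_inter_preimage x hA) fun z hz ↦ ?_
    rw [coordMetric_change g hz.1 (hAy hz.2), ENNReal.ofReal_mul (abs_nonneg _)]
  · intro z hz
    have hd : MDifferentiableAt (𝓡 n) 𝓘(ℝ, Euc n) (extChartAt (𝓡 n) y)
        ((extChartAt (𝓡 n) x).symm z) :=
      mdifferentiableAt_extChartAt (by simpa using hAy hz.2)
    have h1 := hd.comp z (mdifferentiableAt_extChartAt_symm hz.1)
    exact h1.differentiableAt.hasFDerivAt.hasFDerivWithinAt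
  · intro z hz w hw hzw
    have h1 := (extChartAt (𝓡 n) y).injOn (hAy hz.2) (hAy hw.2) hzw
    exact (extChartAt (𝓡 n) x).symm.injOn hz.1 hw.1 h1

end Measure

section Measure

variable {n : ℕ} {M : Type*} [TopologicalSpace M] [ChartedSpace (Euc n) M]
  [IsManifold (𝓡 n) ∞ M] [MeasurableSpace M] [BorelSpace M] (g : Metric n M)

theorem measurableSet_chart_source (x : M) : MeasurableSet (extChartAt (𝓡 n) x).source :=
  (isOpen_extChartAt_source x).measurableSet

theorem chartMeasure_inter_source (x : M) {A : Set M} (hA : MeasurableSet A) :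
    chartMeasure g x (A ∩ (extChartAt (𝓡 n) x).source) = chartMeasure g x A := by
  rw [chartMeasure_apply g x hA, chartMeasure_apply g x (hA.inter (measurableSet_chart_source x))]
  congr 2
  ext z
  constructor
  · rintro ⟨h1, h2, h3⟩
    exact ⟨h1, h2⟩
  · rintro ⟨h1, h2⟩
    exact ⟨h1, h2, (extChartAt (𝓡 n) x).map_target h1⟩

theorem chartMeasure_restrict_comm (x y : M) :
    (chartMeasure g x).restrict (extChartAt (𝓡 n) y).source =
      (chartMeasure g y).restrict (extChartAt (𝓡 n) x).source := by
  ext A hA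
  have hx := measurableSet_chart_source (n := n) x
  have hy := measurableSet_chart_source (n := n) y
  rw [Measure.restrict_apply hA, Measure.restrict_apply hA,
    ← chartMeasure_inter_source g x (hA.inter hy), ← chartMeasure_inter_source g y (hA.inter hx),
    Set.inter_right_comm A]
  exact chartMeasure_apply_eq g x y ((hA.inter hx).inter hy) (fun _ h ↦ h.1.2) (fun _ h ↦ h.2)

variable [T2Space M] [CompactSpace M]

variable (n M) in
/-- The finitely many points whose partition function is not zero. -/
def partitionFinset : Finset M :=
  ((chartPartition n M).locallyFinite.finite_nonempty_of_compact).toFinset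

theorem chartPartition_eq_zero {x : M} (hx : x ∉ partitionFinset n M) (q : M) :
    chartPartition n M x q = 0 := by
  by_contra h
  exact hx (by simpa [partitionFinset] using fun h0 ↦ h (congrFun h0 q))

theorem tsupport_chartPartition (x : M) :
    tsupport (chartPartition n M x) ⊆ (extChartAt (𝓡 n) x).source := by
  rw [extChartAt_source]
  exact (SmoothPartitionOfUnity.exists_isSubordinate_chartAt_source (𝓡 n) M).choose_spec x

theorem sum_chartPartition (q : M) : ∑ x ∈ partitionFinset n M, chartPartition n M x q = 1 := by
  rw [← (chartPartition n M).sum_eq_one (Set.mem_univ q), finsum_eq_sum_of_support_subset]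
  intro x hx
  by_contra h
  exact hx (chartPartition_eq_zero h q)

theorem riemannianMeasure_eq : riemannianMeasure g = ∑ x ∈ partitionFinset n M,
    (chartMeasure g x).withDensity fun q ↦ ENNReal.ofReal (chartPartition n M x q) := by
  ext A hA
  rw [riemannianMeasure, Measure.sum_apply _ hA, Measure.finsetSum_apply, tsum_eq_sum]
  intro x hx
  simp [chartPartition_eq_zero hx]

theorem measurable_chartPartition (x : M) :
    Measurable fun q ↦ ENNReal.ofReal (chartPartition n M x q) :=
  (chartPartition n M x).contMDiff.continuous.measurable.ennreal_ofReal

/-- On overlaps the chart measures agree, so over the chart at `x` every summand is the chart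
measure at `x` with a partition function as density, and these functions sum to one. -/
theorem riemannianMeasure_restrict (x : M) :
    (riemannianMeasure g).restrict (extChartAt (𝓡 n) x).source = chartMeasure g x := by
  ext A hA
  have hx := measurableSet_chart_source (n := n) x
  have hS : ∀ y, (fun q ↦ ENNReal.ofReal (chartPartition n M y q)) =
      (extChartAt (𝓡 n) y).source.indicator fun q ↦ ENNReal.ofReal (chartPartition n M y q) := by
    intro y
    rw [eq_comm, Set.indicator_eq_self]
    intro q hq
    apply tsupport_chartPartition y
    apply subset_tsupport
    intro h
    exact hq (by simp [h])
  have e : ∀ y, ((chartMeasure g y).withDensity fun q ↦ ENNReal.ofReal (chartPartition n M y q))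
      (A ∩ (extChartAt (𝓡 n) x).source) =
      ∫⁻ q in A, ENNReal.ofReal (chartPartition n M y q) ∂(chartMeasure g x) := by
    intro y
    rw [← Measure.restrict_apply hA, restrict_withDensity hx, ← chartMeasure_restrict_comm,
      ← withDensity_indicator (measurableSet_chart_source y), ← hS, withDensity_apply _ hA]
  rw [Measure.restrict_apply hA, riemannianMeasure_eq, Measure.finsetSum_apply]
  simp only [e]
  rw [← lintegral_finsetSum _ fun y _ ↦ measurable_chartPartition y]
  have : ∀ q, ∑ y ∈ partitionFinset n M, ENNReal.ofReal (chartPartition n M y q) = 1 := by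
    intro q
    rw [← ENNReal.ofReal_sum_of_nonneg fun y _ ↦ (chartPartition n M).nonneg y q,
      sum_chartPartition, ENNReal.ofReal_one]
  simp [this]

/-- Each of the finitely many summands lives on a compact subset of its chart domain, where the
continuous density `√det` has finite integral. -/
instance isFiniteMeasure_riemannianMeasure : IsFiniteMeasure (riemannianMeasure g) := by
  constructor
  rw [riemannianMeasure_eq, Measure.finsetSum_apply]
  refine ENNReal.sum_lt_top.2 fun x _ ↦ ?_
  set K := tsupport (chartPartition n M x) with hKdef
  have hK : IsCompact K := (isClosed_tsupport _).isCompact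
  have hKm : MeasurableSet K := (isClosed_tsupport _).measurableSet
  have hle : ((chartMeasure g x).withDensity fun q ↦ ENNReal.ofReal (chartPartition n M x q))
      Set.univ ≤ chartMeasure g x K := by
    rw [withDensity_apply _ MeasurableSet.univ, Measure.restrict_univ, ← setLIntegral_one,
      ← lintegral_indicator hKm]
    refine lintegral_mono fun q ↦ ?_
    by_cases hq : q ∈ K
    · rw [Set.indicator_of_mem hq]
      exact ENNReal.ofReal_le_one.2 ((chartPartition n M).le_one x q)
    · rw [Set.indicator_of_notMem hq, image_eq_zero_of_notMem_tsupport hq]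
      simp
  refine hle.trans_lt ?_
  rw [chartMeasure_apply g x hKm]
  have hKs := tsupport_chartPartition (n := n) x
  have himg : (extChartAt (𝓡 n) x).target ∩ (extChartAt (𝓡 n) x).symm ⁻¹' K =
      extChartAt (𝓡 n) x '' K := by
    rw [(extChartAt (𝓡 n) x).image_eq_target_inter_inv_preimage hKs]
  have hc : IsCompact ((extChartAt (𝓡 n) x).target ∩ (extChartAt (𝓡 n) x).symm ⁻¹' K) := by
    rw [himg]
    exact hK.image_of_continuousOn ((continuousOn_extChartAt x).mono hKs)
  exact ((((continuousOn_sqrt_det g x).mono Set.inter_subset_left)).integrableOn_compact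
    hc).lintegral_lt_top

theorem integrable_of_continuous {f : M → ℝ} (hf : Continuous f) :
    Integrable f (riemannianMeasure g) :=
  hf.integrable_of_hasCompactSupport (HasCompactSupport.of_compactSpace f)

theorem laplacian_eq_zero_of_notMem_tsupport {f : M → ℝ} {p : M} (hp : p ∉ tsupport f) :
    laplacian g f p = 0 := by
  refine (coordLaplacian_congr (f' := fun _ ↦ 0) ?_).trans coordLaplacian_zero
  have h1 : ∀ᶠ q in nhds p, f q = 0 := by
    filter_upwards [(isClosed_tsupport f).isOpen_compl.mem_nhds hp] with q hq
    exact image_eq_zero_of_notMem_tsupport hq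
  have h2 := continuousAt_extChartAt_symm (I := 𝓡 n) p
  rw [ContinuousAt, extChartAt_to_inv] at h2
  exact h2.eventually h1

theorem laplacian_sum {ι : Type*} (t : Finset ι) {f : ι → M → ℝ}
    (hf : ∀ a, ContMDiff (𝓡 n) 𝓘(ℝ) ∞ (f a)) (p : M) :
    laplacian g (fun q ↦ ∑ a ∈ t, f a q) p = ∑ a ∈ t, laplacian g (f a) p :=
  coordLaplacian_sum (isOpen_extChartAt_target (I := 𝓡 n) p) t
    (fun a ↦ contDiffOn_comp_extChartAt_symm (hf a) p) (mem_extChartAt_target (I := 𝓡 n) p)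

variable {g} {D : ℕ} (Φ : Flattening g D)

include Φ in
-- In the chart, `√det · Δf` is the Euclidean divergence of the field `W`, which vanishes off the
-- compact image of the support of `f`.
theorem integral_laplacian_chartMeasure (x : M) {f : M → ℝ} (hf : ContMDiff (𝓡 n) 𝓘(ℝ) ∞ f)
    (hs : tsupport f ⊆ (extChartAt (𝓡 n) x).source) :
    ∫ q, laplacian g f q ∂(chartMeasure g x) = 0 := by
  have hU := isOpen_extChartAt_target (I := 𝓡 n) x
  have hmet := isMetricOn_coordMetric g x
  set fl : Euc n → ℝ := fun y ↦ f ((extChartAt (𝓡 n) x).symm y) with hfl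
  have hfls : ContDiffOn ℝ ∞ fl (extChartAt (𝓡 n) x).target := contDiffOn_comp_extChartAt_symm hf x
  rw [chartMeasure, integral_map (aemeasurable_extChartAt_symm g x)
    (continuous_laplacian Φ hf).aestronglyMeasurable,
    integral_withDensity_eq_integral_toReal_smul₀ (aemeasurable_sqrt_det g x) (by simp)]
  let W : Fin n → Euc n → ℝ := fun i z ↦
    Real.sqrt (coordMetric g x z).det * ∑ j, (coordMetric g x z)⁻¹ i j * partialD j fl z
  have hW : ∀ i, ContDiffOn ℝ ∞ (W i) (extChartAt (𝓡 n) x).target := fun i ↦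
    ((contDiffOn_det hmet.smooth).sqrt fun z hz ↦ hmet.det_ne_zero z hz).mul
      (ContDiffOn.sum fun j _ ↦ (hmet.contDiffOn_inv i j).mul (contDiffOn_partialD hU hfls j))
  set K := extChartAt (𝓡 n) x '' tsupport f with hKdef
  have hK : IsCompact K := (isClosed_tsupport f).isCompact.image_of_continuousOn
    ((continuousOn_extChartAt x).mono hs)
  have hKU : K ⊆ (extChartAt (𝓡 n) x).target := by
    rintro _ ⟨q, hq, rfl⟩
    exact (extChartAt (𝓡 n) x).map_source (hs hq)
  have hfl0 : ∀ z ∈ (extChartAt (𝓡 n) x).target, z ∉ K → fl =ᶠ[nhds z] fun _ ↦ 0 := by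
    intro z hz hzK
    filter_upwards [hU.mem_nhds hz, hK.isClosed.isOpen_compl.mem_nhds hzK] with w hw hwK
    refine image_eq_zero_of_notMem_tsupport (f := f) (x := (extChartAt (𝓡 n) x).symm w) fun h ↦ ?_
    exact hwK ⟨_, h, (extChartAt (𝓡 n) x).right_inv hw⟩
  have hWK : ∀ i, ∀ z ∈ (extChartAt (𝓡 n) x).target, z ∉ K → W i z = 0 := by
    intro i z hz hzK
    have : ∀ j, partialD j fl z = 0 := fun j ↦ by
      rw [partialD, (hfl0 z hz hzK).fderiv_eq]
      simp
    simp [W, this]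
  have e : ∫ y in (extChartAt (𝓡 n) x).target,
      (ENNReal.ofReal (Real.sqrt (coordMetric g x y).det)).toReal •
        laplacian g f ((extChartAt (𝓡 n) x).symm y) =
      ∫ y in (extChartAt (𝓡 n) x).target, ∑ i, partialD i (W i) y := by
    refine setIntegral_congr_fun hU.measurableSet fun y hy ↦ ?_
    rw [ENNReal.toReal_ofReal (Real.sqrt_nonneg _), ← coordLaplacian_eq_laplacian Φ hf x hy,
      smul_eq_mul, ← hmet.sqrt_det_mul_coordLaplacian (fun z hz ↦ coordMetric_det_pos g hz) hfls hy]
  rw [e, integral_finsetSum]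
  · exact Finset.sum_eq_zero fun i _ ↦ setIntegral_partialD_eq_zero hU hK hKU (hW i) (hWK i) i
  · intro i _
    have hcont : ContinuousOn (partialD i (W i)) K :=
      (contDiffOn_partialD hU (hW i) i).continuousOn.mono hKU
    have hi := hcont.integrableOn_compact (μ := volume) hK
    refine hi.of_forall_sdiff_eq_zero hU.measurableSet fun z hz ↦ ?_
    have : W i =ᶠ[nhds z] fun _ ↦ 0 := by
      filter_upwards [hU.mem_nhds hz.1, hK.isClosed.isOpen_compl.mem_nhds hz.2] with w hw hwK
      exact hWK i w hw hwK
    rw [partialD, this.fderiv_eq]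
    simp

include Φ in
/-- The integral of the Laplacian of a smooth function over a closed manifold vanishes. -/
theorem integral_laplacian {f : M → ℝ} (hf : ContMDiff (𝓡 n) 𝓘(ℝ) ∞ f) :
    ∫ q, laplacian g f q ∂(riemannianMeasure g) = 0 := by
  have hρ : ∀ x, ContMDiff (𝓡 n) 𝓘(ℝ) ∞ (fun q ↦ chartPartition n M x q * f q) := fun x ↦
    (chartPartition n M x).contMDiff.mul hf
  -- The partition of unity splits `f` into functions supported in single charts. It is inserted
  -- inside the Laplacian, so its derivatives need no separate treatment.
  have e : f = fun q ↦ ∑ x ∈ partitionFinset n M, chartPartition n M x q * f q := by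
    ext q
    rw [← Finset.sum_mul, sum_chartPartition, one_mul]
  have hlap : ∀ q, laplacian g f q = ∑ x ∈ partitionFinset n M,
      laplacian g (fun q ↦ chartPartition n M x q * f q) q := by
    intro q
    conv_lhs => rw [e]
    exact laplacian_sum g _ hρ q
  simp only [hlap]
  rw [integral_finsetSum _ fun x _ ↦ integrable_of_continuous g (continuous_laplacian Φ (hρ x))]
  refine Finset.sum_eq_zero fun x _ ↦ ?_
  have hsub : tsupport (fun q ↦ chartPartition n M x q * f q) ⊆ (extChartAt (𝓡 n) x).source :=
    (tsupport_mul_subset_left).trans (tsupport_chartPartition x)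
  rw [← setIntegral_eq_integral_of_forall_compl_eq_zero (s := (extChartAt (𝓡 n) x).source)
    fun q hq ↦ laplacian_eq_zero_of_notMem_tsupport g fun h ↦ hq (hsub h),
    riemannianMeasure_restrict]
  exact integral_laplacian_chartMeasure Φ x (hρ x) hsub

end Measure

/-! ### The one-form dual to a vector field and its pull-backs. -/

section DualForm

variable {n : ℕ} {M : Type*} [TopologicalSpace M] [ChartedSpace (Euc n) M]
  [IsManifold (𝓡 n) ∞ M] (g : Metric n M) (X : VField n M)

/-- The one-form dual to `X` in the chart at `q`. -/
def dualForm (q : M) (z : Euc n) : Euc n →L[ℝ] ℝ :=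
  (g.inner ((extChartAt (𝓡 n) q).symm z) (X ((extChartAt (𝓡 n) q).symm z))).comp
    (mfderiv 𝓘(ℝ, Euc n) (𝓡 n) (extChartAt (𝓡 n) q).symm z)

theorem contDiffOn_dualForm (q : M) :
    ContDiffOn ℝ ∞ (dualForm g X q) (extChartAt (𝓡 n) q).target := by
  rw [contDiffOn_clm_apply]
  intro v
  exact contMDiffOn_inner g (X.contMDiff.comp_contMDiffOn (contMDiffOn_extChartAt_symm q))
    (contMDiffOn_coordVec q v)

theorem dualForm_mvfderiv {q x : M} (hx : x ∈ (extChartAt (𝓡 n) q).source)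
    (w : TangentSpace (𝓡 n) x) :
    dualForm g X q (extChartAt (𝓡 n) q x) (mvfderiv (𝓡 n) (extChartAt (𝓡 n) q) x w) =
      g.inner x (X x) w := by
  have key : ∀ z ∈ (extChartAt (𝓡 n) q).target,
      ∀ w : TangentSpace (𝓡 n) ((extChartAt (𝓡 n) q).symm z),
      dualForm g X q z (mvfderiv (𝓡 n) (extChartAt (𝓡 n) q) ((extChartAt (𝓡 n) q).symm z) w) =
        g.inner ((extChartAt (𝓡 n) q).symm z) (X ((extChartAt (𝓡 n) q).symm z)) w :=
    fun z hz w ↦ congrArg _ (coordVec_mfderiv_extChartAt hz w)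
  have h := key _ ((extChartAt (𝓡 n) q).map_source hx)
  rw [(extChartAt (𝓡 n) q).left_inv hx] at h
  exact h w

/-- The derivative of the pull-back of the one-form dual to `X`. -/
theorem fderiv_inner_mfderiv {k : ℕ} {U : Set (Euc k)} {φ : Euc k → M} (hU : IsOpen U)
    (hφ : ContMDiffOn 𝓘(ℝ, Euc k) (𝓡 n) ∞ φ U) {y : Euc k} (hy : y ∈ U) {q : M} (hq : φ y = q)
    (u v : Euc k) :
    fderiv ℝ (fun z ↦ g.inner (φ z) (X (φ z)) (mfderiv 𝓘(ℝ, Euc k) (𝓡 n) φ z v)) y u =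
      fderiv ℝ (dualForm g X q) (extChartAt (𝓡 n) q q)
        (fderiv ℝ (fun z ↦ extChartAt (𝓡 n) q (φ z)) y u)
        (fderiv ℝ (fun z ↦ extChartAt (𝓡 n) q (φ z)) y v) +
      dualForm g X q (extChartAt (𝓡 n) q q)
        (fderiv ℝ (fderiv ℝ (fun z ↦ extChartAt (𝓡 n) q (φ z))) y u v) := by
  subst hq
  set q := φ y with hq
  set ψ := extChartAt (𝓡 n) q with hψ
  set U' := U ∩ φ ⁻¹' ψ.source with hU'
  have hoU' : IsOpen U' := hφ.continuousOn.isOpen_inter_preimage hU (isOpen_extChartAt_source q)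
  have hyU' : y ∈ U' := ⟨hy, mem_extChartAt_source (I := 𝓡 n) q⟩
  set a : Euc k → Euc n := fun z ↦ ψ (φ z) with ha
  have has : ContDiffOn ℝ ∞ a U' := by
    rw [← contMDiffOn_iff_contDiffOn]
    refine (contMDiffOn_extChartAt (I := 𝓡 n) (x := q) (n := ∞)).comp
      (hφ.mono Set.inter_subset_left) fun z hz ↦ ?_
    rw [← extChartAt_source (𝓡 n) q]
    exact hz.2
  have hda : ∀ z ∈ U', ∀ v, fderiv ℝ a z v =
      mvfderiv (𝓡 n) ψ (φ z) (mfderiv 𝓘(ℝ, Euc k) (𝓡 n) φ z v) := by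
    intro z hz v
    have hd : MDifferentiableAt 𝓘(ℝ, Euc k) (𝓡 n) φ z :=
      (hφ.contMDiffAt (hU.mem_nhds hz.1)).mdifferentiableAt (by simp)
    have h := mfderiv_comp_apply z (mdifferentiableAt_extChartAt (I := 𝓡 n)
      (show φ z ∈ (chartAt (Euc n) q).source by rw [← extChartAt_source (𝓡 n) q]; exact hz.2)) hd v
    rw [← mfderiv_eq_fderiv]
    exact h
  have hev : (fun z ↦ g.inner (φ z) (X (φ z)) (mfderiv 𝓘(ℝ, Euc k) (𝓡 n) φ z v)) =ᶠ[nhds y]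
      fun z ↦ dualForm g X q (a z) (fderiv ℝ a z v) := by
    filter_upwards [hoU'.mem_nhds hyU'] with z hz
    rw [hda z hz v]
    exact (dualForm_mvfderiv g X hz.2 _).symm
  have hβ : DifferentiableAt ℝ (dualForm g X q) (a y) :=
    differentiableAt_of_contDiffOn (isOpen_extChartAt_target q) (contDiffOn_dualForm g X q)
      (mem_extChartAt_target (I := 𝓡 n) q)
  have had : DifferentiableAt ℝ a y := differentiableAt_of_contDiffOn hoU' has hyU'
  have hda2 : DifferentiableAt ℝ (fderiv ℝ a) y :=
    differentiableAt_of_contDiffOn hoU' (has.fderiv_of_isOpen (m := ∞) hoU' (by simp)) hyU'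
  have hβa : DifferentiableAt ℝ (fun z ↦ dualForm g X q (a z)) y := hβ.comp y had
  have hav : DifferentiableAt ℝ (fun z ↦ fderiv ℝ a z v) y :=
    hda2.clm_apply (differentiableAt_const v)
  rw [hev.fderiv_eq, fderiv_clm_apply hβa hav,
    fderiv_clm_apply hda2 (differentiableAt_const v)]
  have hc : fderiv ℝ (fun z ↦ dualForm g X q (a z)) y =
      (fderiv ℝ (dualForm g X q) (a y)).comp (fderiv ℝ a y) := fderiv_comp y hβ had
  rw [hc]
  simp only [add_apply, ContinuousLinearMap.comp_apply, ContinuousLinearMap.flip_apply,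
    fderiv_fun_const, Pi.zero_apply, zero_apply, map_zero, zero_add]
  rw [add_comm]

end DualForm

/-! ### Duals of elements of `𝔫_q` are closed at `q`. -/

section Symmetry

variable {n : ℕ} {M : Type*} [TopologicalSpace M] [ChartedSpace (Euc n) M]
  [IsManifold (𝓡 n) ∞ M] {g : Metric n M} {q : M} {s : M → M}

theorem section_congr (X : VField n M) {p q : M} (h : p = q) : (X p : Euc n) = (X q : Euc n) := by
  subst h; rfl

/-- The differential of a geodesic symmetry at its centre is `-1`. -/
theorem IsGeodesicSymmetry.mfderiv_eq_neg (hg : IsSemisimpleRSS g) (hs : IsGeodesicSymmetry g q s)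
    (v : TangentSpace (𝓡 n) q) : (mfderiv (𝓡 n) (𝓡 n) s q v : Euc n) = -(v : Euc n) := by
  -- The values at `q` of the fields in `𝔫_q` fill the tangent space, and the symmetry reverses
  -- these fields.
  obtain ⟨X, hX, rfl⟩ := ((hg.canonical q s hs).1.surjOn (Set.mem_univ v))
  have h := hX q
  refine (show (mfderiv (𝓡 n) (𝓡 n) s q (X.dagger q) : Euc n) = -(X.dagger (s q) : Euc n) from
    h).trans ?_
  rw [section_congr X.dagger hs.fixed]
  rfl

/-- The one-form dual to an element of `𝔫_q` is closed at `q`. -/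
theorem IsGeodesicSymmetry.fderiv_dualForm_symm (hg : IsSemisimpleRSS g)
    (hs : IsGeodesicSymmetry g q s) {X : IsometryAlgebra g} (hX : X ∈ minusSpace g s)
    (u v : Euc n) :
    fderiv ℝ (dualForm g X.dagger q) (extChartAt (𝓡 n) q q) u v =
      fderiv ℝ (dualForm g X.dagger q) (extChartAt (𝓡 n) q q) v u := by
  set β := dualForm g X.dagger q with hβ
  set y := extChartAt (𝓡 n) q q with hy
  have hyt : y ∈ (extChartAt (𝓡 n) q).target := mem_extChartAt_target (I := 𝓡 n) q
  have hU := isOpen_extChartAt_target (I := 𝓡 n) q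
  let φ : Euc n → M := fun z ↦ s ((extChartAt (𝓡 n) q).symm z)
  have hφ : ContMDiffOn 𝓘(ℝ, Euc n) (𝓡 n) ∞ φ (extChartAt (𝓡 n) q).target :=
    hs.smooth.comp_contMDiffOn (contMDiffOn_extChartAt_symm q)
  have hφy : φ y = q := by
    simp only [φ, hy, extChartAt_to_inv]
    exact hs.fixed
  have h := fderiv_inner_mfderiv g X.dagger hU hφ hyt hφy
  set a : Euc n → Euc n := fun z ↦ extChartAt (𝓡 n) q (φ z) with ha
  have hda : ∀ v, fderiv ℝ a y v = -v := by
    intro v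
    have hsd : MDifferentiableAt (𝓡 n) (𝓡 n) s q := hs.smooth.mdifferentiableAt (by simp)
    have hψd : MDifferentiableAt (𝓡 n) 𝓘(ℝ, Euc n) (extChartAt (𝓡 n) q) (s q) :=
      mdifferentiableAt_extChartAt (by rw [hs.fixed]; exact mem_chart_source _ _)
    have h1 := mvfderiv_eq_fderiv_center (hψd.comp q hsd) v
    refine h1.symm.trans ?_
    have h2 := mfderiv_comp_apply q hψd hsd v
    refine h2.trans ?_
    have h3 : ∀ p, p = q → ∀ w : Euc n, mvfderiv (𝓡 n) (extChartAt (𝓡 n) q) p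
        (show TangentSpace (𝓡 n) p from w) = w := by
      rintro p rfl w
      exact congrArg (fun L ↦ L w) (mfderiv_extChartAt_self (I := 𝓡 n) (x := p))
    exact (h3 _ hs.fixed _).trans (hs.mfderiv_eq_neg hg v)
  -- `s^*β = -β`, as `s` is an isometry that reverses `X†`.
  have hinv : ∀ u v, fderiv ℝ (fun z ↦ g.inner (φ z) (X.dagger (φ z))
      (mfderiv 𝓘(ℝ, Euc n) (𝓡 n) φ z v)) y u = -fderiv ℝ β y u v := by
    intro u v
    have hd := differentiableAt_of_contDiffOn hU (contDiffOn_dualForm g X.dagger q) hyt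
    have e : (fun z ↦ g.inner (φ z) (X.dagger (φ z)) (mfderiv 𝓘(ℝ, Euc n) (𝓡 n) φ z v)) =ᶠ[nhds y]
        fun z ↦ -β z v := by
      filter_upwards [hU.mem_nhds hyt] with z hz
      have h1 := mfderiv_comp_apply z (hs.smooth.mdifferentiableAt (by simp))
        (mdifferentiableAt_extChartAt_symm hz) v
      have h2 := hX ((extChartAt (𝓡 n) q).symm z)
      have h3 := hs.isometric ((extChartAt (𝓡 n) q).symm z)
        (X.dagger ((extChartAt (𝓡 n) q).symm z)) (coordVec q z v)
      rw [h2] at h3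
      refine (congrArg _ h1).trans ?_
      refine (neg_eq_iff_eq_neg.1 ?_)
      refine Eq.trans ?_ h3
      rw [map_neg]
      rfl
    rw [e.fderiv_eq, fderiv_fun_neg, fderiv_clm_apply hd (differentiableAt_const v)]
    simp
    rfl
  -- The chain rule for `s^*β` at `q`, with `ds = -1`, gives `Dβ(-u)(-v) + β(D²a(u, v)) = Dβ(u)(v) +
  -- β(D²a(u, v))`, where `a` is `s` in the chart. The left side of the pull-back formula is
  -- `-Dβ(u)(v)`. So `Dβ` is a multiple of a term symmetric in `u` and `v`.
  have key : ∀ u v, 2 * fderiv ℝ β y u v = -β y (fderiv ℝ (fderiv ℝ a) y u v) := by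
    intro u v
    have h1 := h u v
    rw [hinv, hda, hda] at h1
    simp only [map_neg, neg_apply, neg_neg] at h1
    linarith
  have hoU' : IsOpen ((extChartAt (𝓡 n) q).target ∩ φ ⁻¹' (extChartAt (𝓡 n) q).source) :=
    hφ.continuousOn.isOpen_inter_preimage hU (isOpen_extChartAt_source q)
  have has : ContDiffOn ℝ ∞ a ((extChartAt (𝓡 n) q).target ∩ φ ⁻¹' (extChartAt (𝓡 n) q).source) := by
    rw [← contMDiffOn_iff_contDiffOn]
    refine (contMDiffOn_extChartAt (I := 𝓡 n) (x := q) (n := ∞)).comp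
      (hφ.mono Set.inter_subset_left) fun z hz ↦ ?_
    simpa using hz.2
  have hyU' : y ∈ (extChartAt (𝓡 n) q).target ∩ φ ⁻¹' (extChartAt (𝓡 n) q).source :=
    ⟨hyt, by rw [Set.mem_preimage, hφy]; exact mem_extChartAt_source (I := 𝓡 n) q⟩
  have hsym : fderiv ℝ (fderiv ℝ a) y u v = fderiv ℝ (fderiv ℝ a) y v u :=
    ((has.contDiffAt (hoU'.mem_nhds hyU')).of_le minSmoothness_two_le).isSymmSndFDerivAt le_rfl _ _
  have k1 := key u v
  have k2 := key v u
  rw [hsym] at k1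
  linarith

/-- The pull-back of the one-form dual to an element of `𝔫_q` is closed over `q`. -/
theorem IsGeodesicSymmetry.fderiv_inner_comm (hg : IsSemisimpleRSS g)
    (hs : IsGeodesicSymmetry g q s) {X : IsometryAlgebra g} (hX : X ∈ minusSpace g s)
    {k : ℕ} {U : Set (Euc k)} {φ : Euc k → M} (hU : IsOpen U)
    (hφ : ContMDiffOn 𝓘(ℝ, Euc k) (𝓡 n) ∞ φ U) {y : Euc k} (hy : y ∈ U) (hq : φ y = q)
    (u v : Euc k) :
    fderiv ℝ (fun z ↦ g.inner (φ z) (X.dagger (φ z)) (mfderiv 𝓘(ℝ, Euc k) (𝓡 n) φ z v)) y u =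
    fderiv ℝ (fun z ↦ g.inner (φ z) (X.dagger (φ z)) (mfderiv 𝓘(ℝ, Euc k) (𝓡 n) φ z u)) y v := by
  rw [fderiv_inner_mfderiv g X.dagger hU hφ hy hq, fderiv_inner_mfderiv g X.dagger hU hφ hy hq,
    hs.fderiv_dualForm_symm hg hX]
  congr 2
  have hoU' : IsOpen (U ∩ φ ⁻¹' (extChartAt (𝓡 n) q).source) :=
    hφ.continuousOn.isOpen_inter_preimage hU (isOpen_extChartAt_source q)
  have has : ContDiffOn ℝ ∞ (fun z ↦ extChartAt (𝓡 n) q (φ z))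
      (U ∩ φ ⁻¹' (extChartAt (𝓡 n) q).source) := by
    rw [← contMDiffOn_iff_contDiffOn]
    refine (contMDiffOn_extChartAt (I := 𝓡 n) (x := q) (n := ∞)).comp
      (hφ.mono Set.inter_subset_left) fun z hz ↦ ?_
    simpa using hz.2
  have hyU' : y ∈ U ∩ φ ⁻¹' (extChartAt (𝓡 n) q).source :=
    ⟨hy, by rw [Set.mem_preimage, hq]; exact mem_extChartAt_source (I := 𝓡 n) q⟩
  exact ((has.contDiffAt (hoU'.mem_nhds hyU')).of_le minSmoothness_two_le).isSymmSndFDerivAt le_rfl _ _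

end Symmetry

/-! ### The involution of `𝔤` induced by a geodesic symmetry. -/

namespace IsGeodesicSymmetry

variable {n : ℕ} {M : Type*} [TopologicalSpace M] [ChartedSpace (Euc n) M]
  [IsManifold (𝓡 n) ∞ M] {g : Metric n M} {q : M} {s : M → M} (hs : IsGeodesicSymmetry g q s)
include hs

theorem mfderiv_injective (p : M) : Function.Injective (mfderiv (𝓡 n) (𝓡 n) s p) := by
  rw [injective_iff_map_eq_zero]
  intro u hu
  apply inner_ext g
  intro w
  rw [← hs.isometric, hu]
  simp

theorem isInvertible_mfderiv (p : M) : (mfderiv (𝓡 n) (𝓡 n) s p).IsInvertible := by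
  have key : ∀ L : Euc n →L[ℝ] Euc n, Function.Injective L → L.IsInvertible := by
    intro L hL
    refine ⟨(LinearEquiv.ofInjectiveEndo L.toLinearMap hL).toContinuousLinearEquiv, ?_⟩
    ext v
    rfl
  exact key _ (hs.mfderiv_injective p)

theorem mfderiv_mfderiv (p : M) (v : TangentSpace (𝓡 n) p) :
    (mfderiv (𝓡 n) (𝓡 n) s (s p) (mfderiv (𝓡 n) (𝓡 n) s p v) : Euc n) = (v : Euc n) := by
  have h := mfderiv_comp_apply p (hs.smooth.mdifferentiableAt (x := s p) (by simp))
    (hs.smooth.mdifferentiableAt (x := p) (by simp)) v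
  have e : s ∘ s = id := hs.involutive.comp_self
  refine h.symm.trans ?_
  have key : ∀ t : M → M, t = id → (mfderiv (𝓡 n) (𝓡 n) t p v : Euc n) = (v : Euc n) := by
    rintro t rfl
    rw [mfderiv_id]
    rfl
  exact key _ e

/-- The pull-back of a vector field by a geodesic symmetry. -/
def pull (X : VField n M) : VField n M where
  toFun := mpullback (𝓡 n) (𝓡 n) s X
  contMDiff_toFun := ContMDiff.mpullback_vectorField (n := ∞) X.contMDiff hs.smooth
    hs.isInvertible_mfderiv (by simp)

theorem mfderiv_pull (X : VField n M) (p : M) :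
    mfderiv (𝓡 n) (𝓡 n) s p (hs.pull X p) = X (s p) := by
  change mfderiv (𝓡 n) (𝓡 n) s p ((mfderiv (𝓡 n) (𝓡 n) s p).inverse (X (s p))) = X (s p)
  exact (hs.isInvertible_mfderiv p).self_apply_inverse _

theorem eq_pull_iff {X : VField n M} {p : M} {v : TangentSpace (𝓡 n) p} :
    hs.pull X p = v ↔ X (s p) = mfderiv (𝓡 n) (𝓡 n) s p v := by
  rw [← hs.mfderiv_pull X p]
  exact (hs.mfderiv_injective p).eq_iff.symm

theorem pull_apply_symm (X : VField n M) (p : M) :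
    hs.pull X (s p) = mfderiv (𝓡 n) (𝓡 n) s p (X p) := by
  rw [hs.eq_pull_iff]
  exact (section_congr X (hs.involutive p)).trans (hs.mfderiv_mfderiv p (X p)).symm

theorem pull_pull (X : VField n M) : hs.pull (hs.pull X) = X := by
  ext1 p
  rw [hs.eq_pull_iff, hs.pull_apply_symm]

theorem pull_bracket (X Y : VField n M) :
    hs.pull (X.bracket Y) = (hs.pull X).bracket (hs.pull Y) := by
  ext1 p
  exact mpullback_mlieBracket (n := ∞) X.mdifferentiableAt Y.mdifferentiableAt
    hs.smooth.contMDiffAt minSmoothness_two_le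

theorem isKillingField_pull {X : VField n M} (hX : IsKillingField g X) :
    IsKillingField g (hs.pull X) := by
  intro Y Z p
  have e : (fun x ↦ g.inner x (Y x) (Z x)) =
      (fun x ↦ g.inner x (hs.pull Y x) (hs.pull Z x)) ∘ s := by
    ext x
    rw [Function.comp_apply, hs.pull_apply_symm, hs.pull_apply_symm, hs.isometric]
  have hd : MDifferentiableAt (𝓡 n) 𝓘(ℝ) (fun x ↦ g.inner x (hs.pull Y x) (hs.pull Z x)) (s p) :=
    (contMDiff_metric_apply g _ _).mdifferentiableAt (by simp)
  have h1 : mvfderiv (𝓡 n) ((fun x ↦ g.inner x (hs.pull Y x) (hs.pull Z x)) ∘ s) p (hs.pull X p) =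
      mvfderiv (𝓡 n) (fun x ↦ g.inner x (hs.pull Y x) (hs.pull Z x)) (s p)
        (mfderiv (𝓡 n) (𝓡 n) s p (hs.pull X p)) :=
    mfderiv_comp_apply p hd (hs.smooth.mdifferentiableAt (by simp)) _
  have hb : ∀ Y : VField n M, mlieBracket (𝓡 n) X (hs.pull Y) (s p) =
      mfderiv (𝓡 n) (𝓡 n) s p (mlieBracket (𝓡 n) (hs.pull X) Y p) := by
    intro Y
    have h2 := hs.mfderiv_pull (X.bracket (hs.pull Y)) p
    rw [pull_bracket, pull_pull] at h2
    exact h2.symm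
  rw [e, h1, hs.mfderiv_pull, hX, hb, hb, hs.pull_apply_symm, hs.pull_apply_symm, hs.isometric,
    hs.isometric]

/-- The involution of `𝔤` induced by a geodesic symmetry. -/
def involution : IsometryAlgebra g ≃ₗ⁅ℝ⁆ IsometryAlgebra g where
  toFun X := (⟨hs.pull X.dagger, hs.isKillingField_pull X.2⟩ : killingFields g)
  invFun X := (⟨hs.pull X.dagger, hs.isKillingField_pull X.2⟩ : killingFields g)
  map_add' X Y := by
    apply IsometryAlgebra.dagger_injective
    ext1 p
    exact mpullback_add_apply
  map_smul' c X := by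
    apply IsometryAlgebra.dagger_injective
    ext1 p
    exact mpullback_const_smul_apply
  map_lie' {X Y} := by
    apply IsometryAlgebra.dagger_injective
    ext1 p
    have h := congrArg (fun V : VField n M ↦ V p) (hs.pull_bracket X.dagger Y.dagger)
    refine Eq.trans ?_ (congrArg Neg.neg h)
    exact mpullback_neg_apply (V := X.dagger.bracket Y.dagger)
  left_inv X := by
    apply IsometryAlgebra.dagger_injective
    exact hs.pull_pull _
  right_inv X := by
    apply IsometryAlgebra.dagger_injective
    exact hs.pull_pull _

theorem lieInner_involution (X Y : IsometryAlgebra g) :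
    lieInner g (hs.involution X) (hs.involution Y) = lieInner g X Y := by
  simp only [lieInner, LinearMap.neg_apply, LieAlgebra.killingForm_of_equiv_apply]

theorem involution_of_mem {X : IsometryAlgebra g} (hX : X ∈ minusSpace g s) :
    hs.involution X = -X := by
  apply IsometryAlgebra.dagger_injective
  ext1 p
  have h : hs.pull X.dagger p = -X.dagger p := by
    rw [hs.eq_pull_iff, map_neg, hX p, neg_neg]
  exact h

theorem sub_involution_mem (X : IsometryAlgebra g) : X - hs.involution X ∈ minusSpace g s := by
  intro p
  change mfderiv (𝓡 n) (𝓡 n) s p (X.dagger p - hs.pull X.dagger p) =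
    -(X.dagger (s p) - hs.pull X.dagger (s p))
  rw [map_sub, hs.mfderiv_pull, hs.pull_apply_symm, neg_sub]

/-- With `σ` the involution, `X - σX` lies in `𝔫_q` and vanishes at `q`, where evaluation on `𝔫_q`
is injective. -/
theorem involution_of_eq_zero (hg : IsSemisimpleRSS g) {X : IsometryAlgebra g}
    (hX : X.dagger q = 0) : hs.involution X = X := by
  have h0 : hs.pull X.dagger q = 0 := by
    rw [hs.eq_pull_iff, map_zero]
    exact (section_congr X.dagger hs.fixed).trans hX
  have h1 : IsometryAlgebra.evalAt g q (X - hs.involution X) = 0 := by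
    rw [map_sub]
    change X.dagger q - hs.pull X.dagger q = 0
    rw [h0, hX, sub_zero]
  have h2 := (hg.canonical q s hs).1.injOn (hs.sub_involution_mem X) (Submodule.zero_mem _)
    (h1.trans (map_zero _).symm)
  exact (sub_eq_zero.1 h2).symm

/-- Eigenvectors of an isometry for the eigenvalues `1` and `-1` are orthogonal, and automorphisms
of `𝔤` are isometries of the Killing form. -/
theorem lieInner_eq_zero (hg : IsSemisimpleRSS g) {X Y : IsometryAlgebra g} (hX : X.dagger q = 0)
    (hY : Y ∈ minusSpace g s) : lieInner g Y X = 0 := by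
  have h := hs.lieInner_involution Y X
  rw [hs.involution_of_mem hY, hs.involution_of_eq_zero hg hX, map_neg, LinearMap.neg_apply] at h
  linarith

/-- Up to a field vanishing at `q`, which is orthogonal to `𝔫_q`, `X` is the element of `𝔫_q` with
the same value at `q`. The canonical metric settles that case. -/
theorem lieInner_eq_inner (hg : IsSemisimpleRSS g) {Y : IsometryAlgebra g}
    (hY : Y ∈ minusSpace g s) (X : IsometryAlgebra g) :
    lieInner g Y X = g.inner q (Y.dagger q) (X.dagger q) := by
  obtain ⟨Z, hZ, hZX⟩ := ((hg.canonical q s hs).1.surjOn (Set.mem_univ (X.dagger q)))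
  have hZX' : Z.dagger q = X.dagger q := hZX
  have h0 : (X - Z).dagger q = 0 := by
    change X.dagger q - Z.dagger q = 0
    rw [hZX', sub_self]
  have h1 := hs.lieInner_eq_zero hg h0 hY
  rw [map_sub, sub_eq_zero] at h1
  rw [h1, ← (hg.canonical q s hs).2 Y hY Z hZ, hZX']

end IsGeodesicSymmetry

/-! ### Lifts to `𝔫_q`, non-degeneracy and finite dimension of `𝔤`. -/

namespace IsSemisimpleRSS

variable {n : ℕ} {M : Type*} [TopologicalSpace M] [ChartedSpace (Euc n) M]
  [IsManifold (𝓡 n) ∞ M] {g : Metric n M} (hg : IsSemisimpleRSS g)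
include hg

theorem exists_lift (q : M) (u : TangentSpace (𝓡 n) q) : ∃ s, IsGeodesicSymmetry g q s ∧
    ∃ Y ∈ minusSpace g s, Y.dagger q = u ∧ ∀ X, lieInner g Y X = g.inner q u (X.dagger q) := by
  obtain ⟨s, hs⟩ := hg.symmetric q
  obtain ⟨Y, hY, hYu⟩ := ((hg.canonical q s hs).1.surjOn (Set.mem_univ u))
  have hYu' : Y.dagger q = u := hYu
  exact ⟨s, hs, Y, hY, hYu', fun X ↦ by rw [hs.lieInner_eq_inner hg hY, hYu']⟩

/-- Pairing `X` with the lift of `X†(q)` gives `|X†(q)|²`, for every `q`. -/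
theorem eq_zero_of_lieInner {X : IsometryAlgebra g} (h : ∀ Y, lieInner g Y X = 0) : X = 0 := by
  apply IsometryAlgebra.dagger_injective
  ext1 q
  obtain ⟨s, hs, Y, hY, hYu, hYX⟩ := hg.exists_lift q (X.dagger q)
  have h1 := hYX X
  rw [h Y] at h1
  by_contra hne
  exact (g.pos q (X.dagger q) hne).ne h1

theorem finiteDimensional [Nonempty M] (hn : 0 < n) : FiniteDimensional ℝ (IsometryAlgebra g) := by
  by_contra hfin
  have h0 : ∀ X Y, lieInner g X Y = 0 := by
    intro X Y
    -- Without a finite basis the trace is zero by convention, and so is the Killing form. This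
    -- contradicts `lieInner` being positive on the lift of a nonzero tangent vector.
    have : LinearMap.trace ℝ (IsometryAlgebra g) = 0 := by
      rw [LinearMap.trace, dif_neg]
      rintro ⟨t, ⟨b⟩⟩
      exact hfin (Module.Finite.of_basis b)
    simp [lieInner, killingForm_apply_apply, this]
  obtain ⟨q⟩ := ‹Nonempty M›
  obtain ⟨s, hs, Y, hY, hYu, hYX⟩ := hg.exists_lift q (tangentBasis q ⟨0, hn⟩)
  have h1 := hYX Y
  rw [h0, hYu] at h1
  exact (g.pos q _ ((linearIndependent_tangentBasis q).ne_zero _)).ne h1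

end IsSemisimpleRSS

theorem lieInner_symm {n : ℕ} {M : Type*} [TopologicalSpace M] [ChartedSpace (Euc n) M]
    [IsManifold (𝓡 n) ∞ M] (g : Metric n M) (X Y : IsometryAlgebra g) :
    lieInner g X Y = lieInner g Y X := by
  simp only [lieInner, LinearMap.neg_apply]
  rw [LieModule.traceForm_comm]

/-! ### The Lie bracket with a vector field at one of its zeros. -/

section Bracket

variable {n : ℕ} {M : Type*} [TopologicalSpace M] [ChartedSpace (Euc n) M]
  [IsManifold (𝓡 n) ∞ M]

/-- A vector field in the chart at `q`. -/
def coordRep (X : VField n M) (q : M) (z : Euc n) : Euc n :=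
  mvfderiv (𝓡 n) (extChartAt (𝓡 n) q) ((extChartAt (𝓡 n) q).symm z)
    (X ((extChartAt (𝓡 n) q).symm z))

theorem coordRep_self (X : VField n M) (q : M) : coordRep X q (extChartAt (𝓡 n) q q) = X q := by
  have key : ∀ p, p = q → (mvfderiv (𝓡 n) (extChartAt (𝓡 n) q) p (X p) : Euc n) = X q := by
    rintro p rfl
    exact congrArg (fun L ↦ L (X p)) (mfderiv_extChartAt_self (I := 𝓡 n) (x := p))
  exact key _ (extChartAt_to_inv q)

theorem mpullbackWithin_eq_coordRep (X : VField n M) (q : M) {z : Euc n}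
    (hz : z ∈ (extChartAt (𝓡 n) q).target) :
    mpullbackWithin 𝓘(ℝ, Euc n) (𝓡 n) (extChartAt (𝓡 n) q).symm X (Set.range (𝓡 n)) z =
      coordRep X q z := by
  have e1 : mpullbackWithin 𝓘(ℝ, Euc n) (𝓡 n) (extChartAt (𝓡 n) q).symm X
      (Set.range (𝓡 n)) z = (mfderiv 𝓘(ℝ, Euc n) (𝓡 n) (extChartAt (𝓡 n) q).symm z).inverse
        (X ((extChartAt (𝓡 n) q).symm z)) := by
    rw [mpullbackWithin_apply]
    simp
  refine e1.trans ?_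
  have hinv : (mfderiv 𝓘(ℝ, Euc n) (𝓡 n) (extChartAt (𝓡 n) q).symm z).IsInvertible := by
    refine ContinuousLinearMap.IsInvertible.of_inverse
      (g := mfderiv (𝓡 n) 𝓘(ℝ, Euc n) (extChartAt (𝓡 n) q) ((extChartAt (𝓡 n) q).symm z)) ?_ ?_
    · ext w
      exact coordVec_mfderiv_extChartAt hz w
    · ext1 w
      exact mfderiv_extChartAt_coordVec hz w
  exact hinv.inverse_apply_eq.2 (coordVec_mfderiv_extChartAt hz _).symm

theorem mlieBracket_eq_coordRep (X Y : VField n M) (q : M) :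
    mlieBracket (𝓡 n) X Y q =
      (lieBracket ℝ (coordRep X q) (coordRep Y q) (extChartAt (𝓡 n) q q) : Euc n) := by
  have hyt := mem_extChartAt_target (I := 𝓡 n) q
  have hU := isOpen_extChartAt_target (I := 𝓡 n) q
  have hhat : ∀ X : VField n M, mpullbackWithin 𝓘(ℝ, Euc n) (𝓡 n) (extChartAt (𝓡 n) q).symm X
      (Set.range (𝓡 n)) =ᶠ[nhds (extChartAt (𝓡 n) q q)] coordRep X q := fun X ↦
    Filter.eventuallyEq_of_mem (hU.mem_nhds hyt) fun z hz ↦ mpullbackWithin_eq_coordRep X q hz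
  have hid : ∀ L : Euc n →L[ℝ] Euc n, L = .id ℝ (Euc n) → ∀ v, L.inverse v = v := by
    rintro L rfl v
    rw [ContinuousLinearMap.inverse_id]
    rfl
  have hs : ∀ s : Set (Euc n), s = Set.univ → ∀ (A B A' B' : Euc n → Euc n) (y : Euc n),
      A =ᶠ[nhds y] A' → B =ᶠ[nhds y] B' →
      lieBracketWithin ℝ A B s y = lieBracket ℝ A' B' y := by
    rintro s rfl A B A' B' y hA hB
    rw [lieBracketWithin_univ]
    exact hA.lieBracket_vectorField_eq hB
  have hset : (extChartAt (𝓡 n) q).symm ⁻¹' Set.univ ∩ Set.range (𝓡 n) = Set.univ := by simp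
  let A (X : VField n M) (z : Euc n) : Euc n :=
    mpullbackWithin 𝓘(ℝ, Euc n) (𝓡 n) (extChartAt (𝓡 n) q).symm X (Set.range (𝓡 n)) z
  have h1 : mlieBracket (𝓡 n) X Y q =
      (mfderiv (𝓡 n) 𝓘(ℝ, Euc n) (extChartAt (𝓡 n) q) q).inverse
      (lieBracketWithin ℝ (A X) (A Y) ((extChartAt (𝓡 n) q).symm ⁻¹' Set.univ ∩ Set.range (𝓡 n))
        (extChartAt (𝓡 n) q q)) := rfl
  exact h1.trans ((hid _ (mfderiv_extChartAt_self (I := 𝓡 n) (x := q)) _).trans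
    (hs _ hset _ _ _ _ _ (hhat X) (hhat Y)))

/-- The Lie bracket with a vector field vanishing at `q`. -/
theorem mlieBracket_of_eq_zero (g : Metric n M) {X : VField n M} {q : M} (hX : X q = 0)
    (Y : VField n M) :
    mlieBracket (𝓡 n) X Y q = -covAlong g (fun x ↦ x) X q (Y q) := by
  have hcoord := (Flattening.mdifferentiableAt_coord (F := fun x : M ↦ x) (V := X)
    X.mdifferentiableAt (p := q)).2
  have hcov : covAlong g (fun x ↦ x) X q (Y q) =
      (fderiv ℝ (coordRep X q) (extChartAt (𝓡 n) q q) (Y q) : Euc n) := by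
    -- At a zero of `X` the Christoffel term of `∇X` drops out, so `∇X` and the bracket both reduce
    -- to the coordinate derivative of `X`.
    have h0 : ∀ v : Euc n, v = 0 → ∀ w,
        christoffelMap (coordMetric g q) (extChartAt (𝓡 n) q q) w v = 0 := by
      rintro v rfl w
      ext k
      simp [christoffelMap]
    refine (congrArg₂ (fun a b : Euc n ↦ a + b) (mvfderiv_eq_fderiv_center hcoord (Y q))
      (h0 _ hX _)).trans ?_
    exact add_zero _
  have h0 : ∀ (A B : Euc n → Euc n) (y : Euc n), A y = 0 →
      lieBracket ℝ A B y = -fderiv ℝ A y (B y) := by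
    intro A B y h
    rw [lieBracket, h, map_zero, zero_sub]
  rw [hcov]
  refine (mlieBracket_eq_coordRep X Y q).trans ((h0 _ _ _ ?_).trans ?_)
  · exact (coordRep_self X q).trans hX
  · exact congrArg (fun w : Euc n ↦ -fderiv ℝ (coordRep X q) (extChartAt (𝓡 n) q q) w)
      (coordRep_self Y q)

end Bracket

/-! ### The flattening of a symmetric space by its Killing fields. -/

namespace IsSemisimpleRSS

variable {n D : ℕ} {M : Type*} [TopologicalSpace M] [ChartedSpace (Euc n) M]
  [IsManifold (𝓡 n) ∞ M] {g : Metric n M} (hg : IsSemisimpleRSS g)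
  (b : Module.Basis (Fin D) ℝ (IsometryAlgebra g)) (hb : (lieInner g).IsOrthoᵢ b)
  (hne : ∀ c, lieInner g (b c) (b c) ≠ 0)

include hb in
theorem lieInner_basis (X : IsometryAlgebra g) (c : Fin D) :
    lieInner g X (b c) = b.repr X c * lieInner g (b c) (b c) := by
  conv_lhs => rw [← b.sum_repr X]
  simp only [map_sum, map_smul, LinearMap.sum_apply, LinearMap.smul_apply, smul_eq_mul]
  refine Finset.sum_eq_single c (fun d _ hd ↦ ?_) (by simp)
  rw [show lieInner g (b d) (b c) = 0 from hb hd, mul_zero]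

/-- The coordinates on `𝔤` given by the pairing with an orthogonal basis. -/
def coords : IsometryAlgebra g ≃ₗ[ℝ] (Fin D → ℝ) where
  toFun X c := lieInner g X (b c)
  map_add' X Y := by ext c; simp
  map_smul' a X := by ext c; simp
  invFun z := ∑ c, ((lieInner g (b c) (b c))⁻¹ * z c) • b c
  left_inv X := by
    conv_rhs => rw [← b.sum_repr X]
    refine Finset.sum_congr rfl fun c _ ↦ ?_
    beta_reduce
    rw [lieInner_basis b hb X c, mul_comm, mul_assoc, mul_inv_cancel₀ (hne c), mul_one]
  right_inv z := by
    ext c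
    change lieInner g (∑ c, ((lieInner g (b c) (b c))⁻¹ * z c) • b c) (b c) = z c
    rw [lieInner_basis b hb _ c]
    have : b.repr (∑ c, ((lieInner g (b c) (b c))⁻¹ * z c) • b c) c =
        (lieInner g (b c) (b c))⁻¹ * z c := by
      rw [b.repr_sum_self]
    rw [this, mul_comm, ← mul_assoc, mul_inv_cancel₀ (hne c), one_mul]

theorem coords_apply (X : IsometryAlgebra g) (c : Fin D) :
    coords b hb hne X c = lieInner g X (b c) := rfl

theorem weightedForm_coords (X Y : IsometryAlgebra g) :
    weightedForm (fun c ↦ (lieInner g (b c) (b c))⁻¹) (coords b hb hne X) (coords b hb hne Y) =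
      lieInner g X Y := by
  conv_rhs => rw [← b.sum_repr Y]
  rw [weightedForm_apply]
  simp only [map_sum, map_smul, smul_eq_mul, coords_apply]
  refine Finset.sum_congr rfl fun c _ ↦ ?_
  rw [lieInner_basis b hb Y c]
  field_simp [hne c]

/-- The map `T_qN → ℝ^D`, `u ↦ (⟨u, X_c†⟩)_c`. -/
def pairing (q : M) : TangentSpace (𝓡 n) q →L[ℝ] (Fin D → ℝ) :=
  ContinuousLinearMap.pi fun c ↦ g.inner q ((b c).dagger q)

theorem pairing_apply (q : M) (u : TangentSpace (𝓡 n) q) (c : Fin D) :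
    pairing b q u c = g.inner q ((b c).dagger q) u := rfl

/-- In coordinates, `J` is the lift of tangent vectors to `𝔫_q`. -/
theorem pairing_eq_coords {q : M} {u : TangentSpace (𝓡 n) q} {Y : IsometryAlgebra g}
    (hY : ∀ X, lieInner g Y X = g.inner q u (X.dagger q)) :
    pairing b q u = coords b hb hne Y := by
  ext c
  rw [pairing_apply, coords_apply, hY, g.symm]

include hg in
theorem weightedForm_pairing (q : M) (u : TangentSpace (𝓡 n) q) (X : IsometryAlgebra g) :
    weightedForm (fun c ↦ (lieInner g (b c) (b c))⁻¹) (pairing b q u) (coords b hb hne X) =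
      g.inner q u (X.dagger q) := by
  obtain ⟨s, hs, Y, hY, hYu, hYX⟩ := hg.exists_lift q u
  rw [pairing_eq_coords b hb hne hYX, weightedForm_coords, hYX]

theorem contMDiff_pairing : ContMDiff (𝓡 n).tangent 𝓘(ℝ, Fin D → ℝ) ∞
    (fun z : TangentBundle (𝓡 n) M ↦ pairing b z.1 z.2) := by
  rw [contMDiff_pi_space]
  intro c
  let _ : Bundle.RiemannianBundle (fun x : M ↦ TangentSpace (𝓡 n) x) := ⟨g.toRiemannianMetric⟩
  have h1 : ContMDiff (𝓡 n).tangent (𝓡 n).tangent ∞ (fun z : TangentBundle (𝓡 n) M ↦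
      (⟨z.1, (b c).dagger z.1⟩ : TangentBundle (𝓡 n) M)) :=
    (b c).dagger.contMDiff.comp (Bundle.contMDiff_proj _)
  have h2 : ContMDiff (𝓡 n).tangent (𝓡 n).tangent ∞ (fun z : TangentBundle (𝓡 n) M ↦
      (⟨z.1, z.2⟩ : TangentBundle (𝓡 n) M)) := contMDiff_id
  exact ContMDiff.inner_bundle (E := fun x : M ↦ TangentSpace (𝓡 n) x) h1 h2

/-- The flattening of a symmetric space by its Killing fields. -/
def flattening : Flattening g D where
  ε c := (lieInner g (b c) (b c))⁻¹
  J := pairing b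
  smooth := contMDiff_pairing b
  isometric q u v := by
    obtain ⟨s, hs, Y, hY, hYu, hYX⟩ := hg.exists_lift q v
    rw [pairing_eq_coords b hb hne hYX, hg.weightedForm_pairing b hb hne, hYu]
  torsionFree k U φ hU hφ y hy u v w := by
    obtain ⟨s, hs, Y, hY, hYu, hYX⟩ := hg.exists_lift (φ y) w
    rw [pairing_eq_coords b hb hne hYX]
    -- The lift `Y` of `w` at the single point `φ y` is kept fixed. Pairing with its coordinates
    -- turns `J` into the one-form dual to `Y†`, whose pull-back is closed over `φ y`.
    set L : (Fin D → ℝ) →L[ℝ] ℝ := (weightedForm fun c ↦ (lieInner g (b c) (b c))⁻¹).flip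
      (coords b hb hne Y) with hL
    have e : ∀ u v, L (fderiv ℝ (fun z ↦ pairing b (φ z) (mfderiv 𝓘(ℝ, Euc k) (𝓡 n) φ z v)) y u) =
        fderiv ℝ (fun z ↦ g.inner (φ z) (Y.dagger (φ z)) (mfderiv 𝓘(ℝ, Euc k) (𝓡 n) φ z v)) y u := by
      intro u v
      have hd : DifferentiableAt ℝ
          (fun z ↦ pairing b (φ z) (mfderiv 𝓘(ℝ, Euc k) (𝓡 n) φ z v)) y := by
        refine differentiableAt_of_contDiffOn hU ?_ hy
        rw [← contMDiffOn_iff_contDiffOn]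
        exact (contMDiff_pairing b).comp_contMDiffOn (contMDiffOn_mfderiv_apply hU hφ v)
      have h1 := L.hasFDerivAt.comp y hd.hasFDerivAt
      have h2 : (fun z ↦ g.inner (φ z) (Y.dagger (φ z)) (mfderiv 𝓘(ℝ, Euc k) (𝓡 n) φ z v)) =
          L ∘ (fun z ↦ pairing b (φ z) (mfderiv 𝓘(ℝ, Euc k) (𝓡 n) φ z v)) := by
        ext z
        rw [g.symm]
        exact (hg.weightedForm_pairing b hb hne _ _ _).symm
      rw [h2, h1.fderiv]
      rfl
    refine (show _ = L _ from rfl).trans ?_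
    rw [map_sub, e, e, hs.fderiv_inner_comm hg hY hU hφ hy rfl, sub_self]

theorem flattening_form_coords (X Y : IsometryAlgebra g) :
    (flattening hg b hb hne).form (coords b hb hne X) (coords b hb hne Y) = lieInner g X Y :=
  weightedForm_coords b hb hne X Y

theorem flattening_form_J_coords (q : M) (u : TangentSpace (𝓡 n) q) (X : IsometryAlgebra g) :
    (flattening hg b hb hne).form ((flattening hg b hb hne).J q u) (coords b hb hne X) =
      g.inner q u (X.dagger q) :=
  hg.weightedForm_pairing b hb hne q u X

/-- For `V` extending `v`, differentiate `⟨J V, κX⟩ = ⟨V, X†⟩ = ⟨J V, J X†⟩` in the direction `u`,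
with `κ` the coordinates on `𝔤`. As `X†` vanishes at `q`, the last expression only contributes `⟨J
v, D_u(J X†)⟩`, and `D_u(J X†) = J(∇_u X†)` because the `II` term vanishes. -/
theorem form_II_coords_of_eq_zero {q : M} {X : IsometryAlgebra g} (hX : X.dagger q = 0)
    (u v : TangentSpace (𝓡 n) q) :
    (flattening hg b hb hne).form ((flattening hg b hb hne).II q u v) (coords b hb hne X) =
      g.inner q v (covAlong g (fun x ↦ x) X.dagger q u) := by
  set Φ := flattening hg b hb hne with hΦ
  have hJ : ∀ q u, Φ.form (Φ.J q u) (coords b hb hne X) = g.inner q u (X.dagger q) := fun q u ↦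
    flattening_form_J_coords hg b hb hne q u X
  rw [Flattening.II_apply, Flattening.nrm_apply, map_sub, sub_apply, hJ, hX, map_zero, sub_zero,
    ← Φ.mvfderiv_J_coordField]
  have hd1 : MDifferentiableAt (𝓡 n) 𝓘(ℝ, Fin D → ℝ) (fun x ↦ Φ.J x (coordField q v x)) q :=
    (Φ.smooth.mdifferentiableAt (by simp)).comp q (Flattening.mdifferentiableAt_coordField q v)
  have hd2 : MDifferentiableAt (𝓡 n) 𝓘(ℝ, Fin D → ℝ) (fun x ↦ Φ.J x (X.dagger x)) q :=
    (Φ.contMDiff_J X.dagger).mdifferentiableAt (by simp)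
  have hK := Φ.mvfderiv_J (F := fun x ↦ x) X.dagger.mdifferentiableAt (p := q) u
  have e0 : Φ.II q (mfderiv (𝓡 n) (𝓡 n) (fun x : M ↦ x) q u) (X.dagger q) = 0 := by
    rw [hX, map_zero]
  rw [e0, add_zero] at hK
  rw [mvfderiv_eq_fderiv_center hd1]
  rw [mvfderiv_eq_fderiv_center hd2] at hK
  have hd1' := differentiableAt_comp_extChartAt_symm hd1
  have hd2' := differentiableAt_comp_extChartAt_symm hd2
  set y := extChartAt (𝓡 n) q q with hy
  set A : Euc n → (Fin D → ℝ) := fun z ↦ Φ.J ((extChartAt (𝓡 n) q).symm z)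
    (coordField q v ((extChartAt (𝓡 n) q).symm z)) with hA
  set B : Euc n → (Fin D → ℝ) := fun z ↦ Φ.J ((extChartAt (𝓡 n) q).symm z)
    (X.dagger ((extChartAt (𝓡 n) q).symm z)) with hB
  have hAy : A y = Φ.J q v := by
    have key : ∀ p, p = q → Φ.J p (coordField q v p) = Φ.J q v := by
      rintro p rfl
      rw [Flattening.coordField_self]
    exact key _ (extChartAt_to_inv q)
  have hBy : B y = 0 := by
    have key : ∀ p, p = q → Φ.J p (X.dagger p) = 0 := by
      rintro p rfl
      rw [hX, map_zero]
    exact key _ (extChartAt_to_inv q)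
  have hAB : (fun z ↦ Φ.form (A z) (coords b hb hne X)) = fun z ↦ Φ.form (A z) (B z) := by
    ext z
    exact (hJ _ _).trans (Φ.form_J _ _ _).symm
  have h1 := (Φ.form.hasFDerivAt_of_bilinear hd1'.hasFDerivAt
    (hasFDerivAt_const (coords b hb hne X) y)).fderiv
  have h2 := (Φ.form.hasFDerivAt_of_bilinear hd1'.hasFDerivAt hd2'.hasFDerivAt).fderiv
  have h3 := congrArg (fun L ↦ L u) (h1.symm.trans ((congrArg (fun f ↦ fderiv ℝ f y) hAB).trans h2))
  simp only [ContinuousLinearMap.precompR_apply, map_zero, zero_add, hAy, hBy, add_zero] at h3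
  refine h3.trans ?_
  refine (congrArg _ hK).trans (Φ.form_J _ _ _)

/-- The second fundamental form of the flattening of a symmetric space is antisymmetric. -/
theorem flattening_II_antisymm (q : M) (u v : TangentSpace (𝓡 n) q) :
    (flattening hg b hb hne).II q u v = -(flattening hg b hb hne).II q v u := by
  set Φ := flattening hg b hb hne with hΦ
  obtain ⟨S, hS⟩ := (coords b hb hne).surjective (Φ.II q u v + Φ.II q v u)
  have key : ∀ X, Φ.form (Φ.II q u v + Φ.II q v u) (coords b hb hne X) = 0 := by
    intro X
    -- Split `X` into `X - Y`, which vanishes at `q`, and `Y ∈ 𝔫_q`, whose coordinates lie in the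
    -- image of `J` and so are orthogonal to `II`.
    obtain ⟨s, hs, Y, hY, hYu, hYX⟩ := hg.exists_lift q (X.dagger q)
    have hJ : Φ.J q (X.dagger q) = coords b hb hne Y := pairing_eq_coords b hb hne hYX
    have hXY : (X - Y).dagger q = 0 := by
      change X.dagger q - Y.dagger q = 0
      rw [hYu, sub_self]
    have e : X = (X - Y) + Y := by abel
    rw [e, map_add, map_add, ← hJ, map_add, add_apply, add_apply, Φ.form_II_J, Φ.form_II_J,
      hg.form_II_coords_of_eq_zero b hb hne hXY, hg.form_II_coords_of_eq_zero b hb hne hXY]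
    -- Global fields with the values `u` and `v` at `q`, as required by the Killing equation.
    obtain ⟨_, _, U, _, hU, _⟩ := hg.exists_lift q u
    obtain ⟨_, _, V, _, hV, _⟩ := hg.exists_lift q v
    have hkill := (X - Y).2 U.dagger V.dagger q
    have e1 := mlieBracket_of_eq_zero g hXY U.dagger
    have e2 := mlieBracket_of_eq_zero g hXY V.dagger
    rw [hU] at e1
    rw [hV] at e2
    have hkill' : mvfderiv (𝓡 n) (fun x ↦ g.inner x (U.dagger x) (V.dagger x)) q ((X - Y).dagger q) =
      g.inner q (mlieBracket (𝓡 n) (X - Y).dagger U.dagger q) (V.dagger q) +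
      g.inner q (U.dagger q) (mlieBracket (𝓡 n) (X - Y).dagger V.dagger q) := hkill
    -- The derivative term of the Killing equation vanishes because `X - Y` does at `q`. What
    -- remains says that `∇(X - Y)` is skew at `q`.
    rw [hXY, map_zero, e1, e2, hU, hV, map_neg, map_neg, neg_apply, g.symm q _ v] at hkill'
    linarith
  have hzero : S = 0 := by
    apply hg.eq_zero_of_lieInner
    intro Y
    rw [lieInner_symm, ← flattening_form_coords hg b hb hne, hS]
    exact key Y
  rw [hzero, map_zero] at hS
  exact eq_neg_of_add_eq_zero_left hS.symm

include hg in
-- These three properties are all that the trace formula uses about the symmetric space.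
theorem exists_flattening [Nonempty M] (hn : 0 < n) :
    ∃ (D : ℕ) (Φ : Flattening g D) (κ : IsometryAlgebra g ≃ₗ[ℝ] (Fin D → ℝ)),
      (∀ X Y, Φ.form (κ X) (κ Y) = lieInner g X Y) ∧
      (∀ q u X, Φ.form (Φ.J q u) (κ X) = g.inner q u (X.dagger q)) ∧
      ∀ q u v, Φ.II q u v = -Φ.II q v u := by
  have := hg.finiteDimensional hn
  obtain ⟨b, hb⟩ := LinearMap.BilinForm.exists_orthogonal_basis (B := lieInner g)
    ⟨lieInner_symm g⟩
  have hsep : (lieInner g).SeparatingLeft := fun X hX ↦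
    hg.eq_zero_of_lieInner fun Y ↦ by rw [lieInner_symm, hX]
  have hne := hb.not_isOrtho_basis_self_of_separatingLeft hsep
  exact ⟨_, flattening hg b hb hne, coords b hb hne, flattening_form_coords hg b hb hne,
    flattening_form_J_coords hg b hb hne, flattening_II_antisymm hg b hb hne⟩

end IsSemisimpleRSS

section Basics

variable {n : ℕ} {M : Type*} [TopologicalSpace M] [ChartedSpace (Euc n) M]
  [IsManifold (𝓡 n) ∞ M]

/-- The product rule for a bilinear map. -/
theorem mvfderiv_bilinear {E F G : Type*} [NormedAddCommGroup E] [NormedSpace ℝ E]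
    [NormedAddCommGroup F] [NormedSpace ℝ F] [NormedAddCommGroup G] [NormedSpace ℝ G]
    (L : E →L[ℝ] F →L[ℝ] G) {A : M → E} {B : M → F} {p : M}
    (hA : MDifferentiableAt (𝓡 n) 𝓘(ℝ, E) A p) (hB : MDifferentiableAt (𝓡 n) 𝓘(ℝ, F) B p)
    (u : TangentSpace (𝓡 n) p) :
    mvfderiv (𝓡 n) (fun x ↦ L (A x) (B x)) p u =
      L (A p) (mvfderiv (𝓡 n) B p u) + L (mvfderiv (𝓡 n) A p u) (B p) := by
  have hL : MDifferentiableAt (𝓡 n) 𝓘(ℝ, F →L[ℝ] G) (fun x ↦ L (A x)) p :=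
    L.differentiableAt.mdifferentiableAt.comp p hA
  have h := (L.hasFDerivAt_of_bilinear (differentiableAt_comp_extChartAt_symm hA).hasFDerivAt
    (differentiableAt_comp_extChartAt_symm hB).hasFDerivAt).fderiv
  rw [mvfderiv_eq_fderiv_center hA, mvfderiv_eq_fderiv_center hB,
    mvfderiv_eq_fderiv_center (hL.clm_apply hB)]
  refine (congrArg (fun T ↦ T u) h).trans ?_
  have key : ∀ q, q = p → ∀ y z, L (A q) y + L z (B q) = L (A p) y + L z (B p) := by
    rintro q rfl y z; rfl
  exact key _ (extChartAt_to_inv p) _ _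

theorem IsOrthonormalAt.sum_inner_smul {g : Metric n M} {p : M}
    {e : Fin n → TangentSpace (𝓡 n) p} (he : IsOrthonormalAt g p e) (u : TangentSpace (𝓡 n) p) :
    ∑ i, g.inner p u (e i) • e i = u := by
  have hG : gramOf g p e = 1 := by
    ext i j
    simp [gramOf, he i j, Matrix.one_apply]
  have h := sum_gramOf_inv_inner_smul g (E := e) (by simp [hG]) u
  simpa [hG, Matrix.one_apply] using h

theorem IsOrthonormalAt.inner_eq_sum {g : Metric n M} {p : M}
    {e : Fin n → TangentSpace (𝓡 n) p} (he : IsOrthonormalAt g p e)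
    (u v : TangentSpace (𝓡 n) p) :
    g.inner p u v = ∑ i, g.inner p u (e i) * g.inner p v (e i) := by
  conv_lhs => rw [← he.sum_inner_smul v]
  simp only [map_sum, map_smul, smul_eq_mul, mul_comm]

end Basics

/-! ### Hypersurfaces with a unit normal: Weingarten equation and norms of derivatives. -/

section Hypersurface

variable {m D : ℕ} {S M : Type*} [TopologicalSpace S] [ChartedSpace (Euc m) S]
  [IsManifold (𝓡 m) ∞ S] [TopologicalSpace M] [ChartedSpace (Euc (m + 1)) M]
  [IsManifold (𝓡 (m + 1)) ∞ M] {gS : Metric m S} {gM : Metric (m + 1) M} {f : S → M}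
  {ν : ∀ p : S, TangentSpace (𝓡 (m + 1)) (f p)} {p : S} {e : Fin m → TangentSpace (𝓡 m) p}

theorem IsUnitNormal.isOrthonormalAt_cons (hν : IsUnitNormal (m := m) gM f ν)
    (hf : IsIsometricImmersion gS gM f) (he : IsOrthonormalAt gS p e) :
    IsOrthonormalAt gM (f p)
      (Fin.cons (ν p) fun μ ↦ mfderiv (𝓡 m) (𝓡 (m + 1)) f p (e μ)) := by
  intro i j
  induction i using Fin.cases with
  | zero =>
    induction j using Fin.cases with
    | zero => simpa using hν.unit p
    | succ j => simpa [(Fin.succ_ne_zero j).symm] using hν.normal p (e j)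
  | succ i =>
    induction j using Fin.cases with
    | zero => simpa [gM.symm (f p) _ (ν p)] using hν.normal p (e i)
    | succ j => simpa [hf.isometric] using he i j

/-- The trace over `TM` along a hypersurface. -/
theorem IsUnitNormal.metricTrace_eq (hν : IsUnitNormal (m := m) gM f ν)
    (hf : IsIsometricImmersion gS gM f) (he : IsOrthonormalAt gS p e)
    {W : Type*} [AddCommGroup W] [Module ℝ W]
    (B : TangentSpace (𝓡 (m + 1)) (f p) →ₗ[ℝ] TangentSpace (𝓡 (m + 1)) (f p) →ₗ[ℝ] W) :
    metricTrace gM (f p) (fun u v ↦ B u v) = B (ν p) (ν p) +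
      ∑ μ, B (mfderiv (𝓡 m) (𝓡 (m + 1)) f p (e μ)) (mfderiv (𝓡 m) (𝓡 (m + 1)) f p (e μ)) := by
  rw [metricTrace_eq_orthonormal gM B (hν.isOrthonormalAt_cons hf he), Fin.sum_univ_succ]
  rfl

theorem IsUnitNormal.inner_eq_sum (hν : IsUnitNormal (m := m) gM f ν)
    (hf : IsIsometricImmersion gS gM f) (he : IsOrthonormalAt gS p e)
    (u v : TangentSpace (𝓡 (m + 1)) (f p)) :
    gM.inner (f p) u v = gM.inner (f p) u (ν p) * gM.inner (f p) v (ν p) +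
      ∑ μ, gM.inner (f p) u (mfderiv (𝓡 m) (𝓡 (m + 1)) f p (e μ)) *
        gM.inner (f p) v (mfderiv (𝓡 m) (𝓡 (m + 1)) f p (e μ)) := by
  rw [(hν.isOrthonormalAt_cons hf he).inner_eq_sum u v, Fin.sum_univ_succ]
  rfl

theorem inner_normalPart (hf : IsIsometricImmersion gS gM f) (w : TangentSpace (𝓡 (m + 1)) (f p))
    (u : TangentSpace (𝓡 m) p) :
    gM.inner (f p) (normalPart gS gM f p w) (mfderiv (𝓡 m) (𝓡 (m + 1)) f p u) = 0 := by
  have h := inner_sharp gS p ((gM.inner (f p) w).comp (mfderiv (𝓡 m) (𝓡 (m + 1)) f p) :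
    TangentSpace (𝓡 m) p →ₗ[ℝ] ℝ) u
  rw [normalPart, map_sub, sub_apply, hf.isometric]
  exact sub_eq_zero.2 h.symm

/-- The normal bundle of a hypersurface is spanned by the unit normal. -/
theorem IsUnitNormal.normalPart_eq (hν : IsUnitNormal (m := m) gM f ν)
    (hf : IsIsometricImmersion gS gM f) (he : IsOrthonormalAt gS p e)
    (w : TangentSpace (𝓡 (m + 1)) (f p)) :
    normalPart gS gM f p w = gM.inner (f p) w (ν p) • ν p := by
  have h0 : gM.inner (f p) (normalPart gS gM f p w) (ν p) = gM.inner (f p) w (ν p) := by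
    rw [normalPart, map_sub, sub_apply, gM.symm (f p) (mfderiv (𝓡 m) (𝓡 (m + 1)) f p _),
      hν.normal, sub_zero]
  apply inner_ext gM
  intro u
  rw [hν.inner_eq_sum hf he, h0, map_smul, smul_apply, gM.symm (f p) (ν p) u, smul_eq_mul]
  simp [inner_normalPart hf]

/-- The scalar second fundamental form `⟨A(u, w), ν⟩` of a hypersurface. -/
def scalarFF (gS : Metric m S) (gM : Metric (m + 1) M) (f : S → M)
    (ν : ∀ p : S, TangentSpace (𝓡 (m + 1)) (f p)) (p : S) (u w : TangentSpace (𝓡 m) p) : ℝ :=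
  gM.inner (f p) (secondFF gS gM f p u w) (ν p)

theorem IsUnitNormal.secondFF_eq (hν : IsUnitNormal (m := m) gM f ν)
    (hf : IsIsometricImmersion gS gM f) (he : IsOrthonormalAt gS p e)
    (u w : TangentSpace (𝓡 m) p) :
    secondFF gS gM f p u w = scalarFF gS gM f ν p u w • ν p := by
  have h := hν.normalPart_eq hf he
    (covAlong gM f (fun x ↦ mfderiv (𝓡 m) (𝓡 (m + 1)) f x (coordField p w x)) p u)
  have e1 : secondFF gS gM f p u w = _ := h
  rw [scalarFF, e1, map_smul, smul_apply, hν.unit, smul_eq_mul, mul_one]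

namespace Flattening

variable (Φ : Flattening gM D)

theorem mvfderiv_J_field {n : ℕ} {N : Type*} [TopologicalSpace N] [ChartedSpace (Euc n) N]
    [IsManifold (𝓡 n) ∞ N] {g : Metric n N} (Ψ : Flattening g D) (T : VField n N) (q : N)
    (u : TangentSpace (𝓡 n) q) :
    mvfderiv (𝓡 n) (fun x ↦ Ψ.J x (T x)) q u =
      Ψ.J q (covAlong g (fun x ↦ x) T q u) + Ψ.II q u (T q) := by
  refine (Ψ.mvfderiv_J (F := fun x ↦ x) T.mdifferentiableAt (p := q) u).trans ?_
  have h : mfderiv (𝓡 n) (𝓡 n) (fun x : N ↦ x) q = .id ℝ _ := mfderiv_id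
  rw [h]
  rfl

theorem form_J_add_II {n : ℕ} {N : Type*} [TopologicalSpace N] [ChartedSpace (Euc n) N]
    [IsManifold (𝓡 n) ∞ N] {g : Metric n N} (Ψ : Flattening g D) {q : N}
    (a u v a' u' v' : TangentSpace (𝓡 n) q) :
    Ψ.form (Ψ.J q a + Ψ.II q u v) (Ψ.J q a' + Ψ.II q u' v') =
      g.inner q a a' + Ψ.form (Ψ.II q u v) (Ψ.II q u' v') := by
  rw [map_add, map_add, add_apply, add_apply, form_J, form_II_J, form_J_II]
  ring

theorem contMDiff_normal (hν : IsUnitNormal (m := m) gM f ν) :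
    ContMDiff (𝓡 m) 𝓘(ℝ, Fin D → ℝ) ∞ (fun x ↦ Φ.J (f x) (ν x)) :=
  Φ.smooth.comp hν.smooth

theorem mdifferentiableAt_normal (hν : IsUnitNormal (m := m) gM f ν) :
    MDifferentiableAt (𝓡 m) 𝓘(ℝ, Fin D → ℝ) (fun x ↦ Φ.J (f x) (ν x)) p :=
  (Φ.contMDiff_normal hν).mdifferentiableAt (by simp)

theorem form_mvfderiv_normal_self (hν : IsUnitNormal (m := m) gM f ν)
    (u : TangentSpace (𝓡 m) p) :
    Φ.form (mvfderiv (𝓡 m) (fun x ↦ Φ.J (f x) (ν x)) p u) (Φ.J (f p) (ν p)) = 0 := by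
  have hd := Φ.mdifferentiableAt_normal (p := p) hν
  have h := mvfderiv_bilinear Φ.form hd hd u
  have e1 : (fun x ↦ Φ.form (Φ.J (f x) (ν x)) (Φ.J (f x) (ν x))) = fun _ ↦ (1 : ℝ) := by
    ext x
    rw [form_J, hν.unit]
  rw [e1, mvfderiv_const, Φ.form_symm (Φ.J (f p) (ν p))] at h
  have h' : (0 : ℝ) = _ := h
  linarith

theorem form_normal_J (hf : IsIsometricImmersion gS gM f) (hν : IsUnitNormal (m := m) gM f ν)
    (p : S) (w : TangentSpace (𝓡 m) p) :
    Φ.form (Φ.J (f p) (ν p)) ((Φ.pullback hf).J p w) = 0 :=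
  (Φ.form_J _ _ _).trans (hν.normal p w)

theorem form_normal_II (hf : IsIsometricImmersion gS gM f) (u w : TangentSpace (𝓡 m) p) :
    Φ.form (Φ.J (f p) (ν p)) ((Φ.pullback hf).II p u w) = scalarFF gS gM f ν p u w := by
  rw [II_pullback, map_add, form_J_II, add_zero, form_J, gM.symm, scalarFF]

/-- The Weingarten equation. -/
theorem form_mvfderiv_normal (hf : IsIsometricImmersion gS gM f)
    (hν : IsUnitNormal (m := m) gM f ν) (u w : TangentSpace (𝓡 m) p) :
    Φ.form (mvfderiv (𝓡 m) (fun x ↦ Φ.J (f x) (ν x)) p u) ((Φ.pullback hf).J p w) =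
      -scalarFF gS gM f ν p u w := by
  set Ψ := Φ.pullback hf with hΨ
  have hd := Φ.mdifferentiableAt_normal (p := p) hν
  have hd' : MDifferentiableAt (𝓡 m) 𝓘(ℝ, Fin D → ℝ) (fun x ↦ Ψ.J x (coordField p w x)) p :=
    (Ψ.smooth.mdifferentiableAt (by simp)).comp p (mdifferentiableAt_coordField p w)
  have h := mvfderiv_bilinear Φ.form hd hd' u
  have e1 : (fun x ↦ Φ.form (Φ.J (f x) (ν x)) (Ψ.J x (coordField p w x))) = fun _ ↦ (0 : ℝ) := by
    ext x
    exact Φ.form_normal_J hf hν x _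
  have e2 : Φ.form (Φ.J (f p) (ν p)) (fderiv ℝ (Ψ.loc p) (extChartAt (𝓡 m) p p) u w) =
      scalarFF gS gM f ν p u w := by
    rw [← Φ.form_normal_II hf, II_apply, nrm_apply, map_sub, Φ.form_normal_J hf hν, sub_zero]
  rw [e1, mvfderiv_const, Ψ.mvfderiv_J_coordField, e2, coordField_self] at h
  have h' : (0 : ℝ) = _ := h
  linarith

theorem form_normal_mvfderiv (hf : IsIsometricImmersion gS gM f)
    (hν : IsUnitNormal (m := m) gM f ν) (T : VField m S) (u : TangentSpace (𝓡 m) p) :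
    Φ.form (Φ.J (f p) (ν p)) (mvfderiv (𝓡 m) (fun x ↦ (Φ.pullback hf).J x (T x)) p u) =
      scalarFF gS gM f ν p u (T p) := by
  rw [mvfderiv_J_field, map_add, Φ.form_normal_J hf hν, form_normal_II, zero_add]

theorem mvfderiv_normal (hν : IsUnitNormal (m := m) gM f ν) (u : TangentSpace (𝓡 m) p) :
    mvfderiv (𝓡 m) (fun x ↦ Φ.J (f x) (ν x)) p u = Φ.J (f p) (covAlong gM f ν p u) +
      Φ.II (f p) (mfderiv (𝓡 m) (𝓡 (m + 1)) f p u) (ν p) :=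
  Φ.mvfderiv_J (hν.smooth.mdifferentiableAt (by simp)) u

/-- The Gauss formula splits the derivative of `Jν` into orthogonal parts: `J(∇_uν)`, where `∇_uν`
is tangent to the hypersurface with coefficients given by the Weingarten equation, and `II(u, ν)`.
-/
theorem normSq_mvfderiv_normal (hf : IsIsometricImmersion gS gM f)
    (hν : IsUnitNormal (m := m) gM f ν) (he : IsOrthonormalAt gS p e) (u : TangentSpace (𝓡 m) p) :
    Φ.form (mvfderiv (𝓡 m) (fun x ↦ Φ.J (f x) (ν x)) p u)
        (mvfderiv (𝓡 m) (fun x ↦ Φ.J (f x) (ν x)) p u) =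
      ∑ μ, scalarFF gS gM f ν p u (e μ) ^ 2 +
        Φ.form (Φ.II (f p) (mfderiv (𝓡 m) (𝓡 (m + 1)) f p u) (ν p))
          (Φ.II (f p) (mfderiv (𝓡 m) (𝓡 (m + 1)) f p u) (ν p)) := by
  have hc : ∀ w, gM.inner (f p) (covAlong gM f ν p u) w =
      Φ.form (mvfderiv (𝓡 m) (fun x ↦ Φ.J (f x) (ν x)) p u) (Φ.J (f p) w) := by
    intro w
    rw [Φ.mvfderiv_normal hν, map_add, add_apply, form_J, form_II_J, add_zero]
  have h1 : gM.inner (f p) (covAlong gM f ν p u) (covAlong gM f ν p u) =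
      ∑ μ, scalarFF gS gM f ν p u (e μ) ^ 2 := by
    rw [hν.inner_eq_sum hf he, hc, Φ.form_mvfderiv_normal_self hν, zero_mul, zero_add]
    refine Finset.sum_congr rfl fun μ _ ↦ ?_
    have h2 := (hc (mfderiv (𝓡 m) (𝓡 (m + 1)) f p (e μ))).trans
      (Φ.form_mvfderiv_normal hf hν u (e μ))
    rw [h2]
    ring
  rw [Φ.mvfderiv_normal hν, form_J_add_II, h1]

theorem normSq_II_pullback (hf : IsIsometricImmersion gS gM f)
    (hν : IsUnitNormal (m := m) gM f ν) (he : IsOrthonormalAt gS p e)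
    (u w u' w' : TangentSpace (𝓡 m) p) :
    Φ.form ((Φ.pullback hf).II p u w) ((Φ.pullback hf).II p u' w') =
      scalarFF gS gM f ν p u w * scalarFF gS gM f ν p u' w' +
        Φ.form (Φ.II (f p) (mfderiv (𝓡 m) (𝓡 (m + 1)) f p u) (mfderiv (𝓡 m) (𝓡 (m + 1)) f p w))
          (Φ.II (f p) (mfderiv (𝓡 m) (𝓡 (m + 1)) f p u')
            (mfderiv (𝓡 m) (𝓡 (m + 1)) f p w')) := by
  rw [II_pullback, II_pullback, form_J_add_II, hν.secondFF_eq hf he, hν.secondFF_eq hf he, map_smul, map_smul, smul_apply, hν.unit]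
  simp only [smul_eq_mul]
  ring

/-- The derivative of `J T` has three mutually orthogonal parts: the intrinsic covariant derivative,
the second fundamental form along `ν`, and the ambient `II`. -/
theorem normSq_mvfderiv_field (hf : IsIsometricImmersion gS gM f)
    (hν : IsUnitNormal (m := m) gM f ν) (he : IsOrthonormalAt gS p e) (T : VField m S)
    (u : TangentSpace (𝓡 m) p) :
    Φ.form (mvfderiv (𝓡 m) (fun x ↦ (Φ.pullback hf).J x (T x)) p u)
        (mvfderiv (𝓡 m) (fun x ↦ (Φ.pullback hf).J x (T x)) p u) =
      ∑ μ, (Φ.pullback hf).covBilin T p u (e μ) ^ 2 + (scalarFF gS gM f ν p u (T p) ^ 2 +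
        Φ.form (Φ.II (f p) (mfderiv (𝓡 m) (𝓡 (m + 1)) f p u)
            (mfderiv (𝓡 m) (𝓡 (m + 1)) f p (T p)))
          (Φ.II (f p) (mfderiv (𝓡 m) (𝓡 (m + 1)) f p u)
            (mfderiv (𝓡 m) (𝓡 (m + 1)) f p (T p)))) := by
  set Ψ := Φ.pullback hf with hΨ
  have hform : Φ.form = Ψ.form := rfl
  have hc : ∀ w, gS.inner p (covAlong gS (fun x ↦ x) T p u) w = Ψ.covBilin T p u w := by
    intro w
    rw [covBilin_apply, mvfderiv_J_field, map_add, add_apply, form_J, form_II_J, add_zero]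
  have h1 : gS.inner p (covAlong gS (fun x ↦ x) T p u) (covAlong gS (fun x ↦ x) T p u) =
      ∑ μ, Ψ.covBilin T p u (e μ) ^ 2 := by
    rw [he.inner_eq_sum]
    exact Finset.sum_congr rfl fun μ _ ↦ by rw [hc, sq]
  have h2 := Φ.normSq_II_pullback hf hν he u (T p) u (T p)
  rw [hform, ← hΨ] at h2
  rw [sq (scalarFF gS gM f ν p u (T p)), hform, ← h2, mvfderiv_J_field, form_J_add_II, h1]

end Flattening

end Hypersurface

/-! ### Traces in weighted frames and the Ricci tensor. -/

section Traces

variable {n D : ℕ} {M : Type*} [TopologicalSpace M] [ChartedSpace (Euc n) M]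
  [IsManifold (𝓡 n) ∞ M] {g : Metric n M} {p : M}

/-- The weighted frame is arbitrary so that two cases are covered: orthonormal bases with weights
`1`, used in computations, and the global frame of a flattening, used for continuity. -/
theorem metricTrace_mul (l : TangentSpace (𝓡 n) p →ₗ[ℝ] ℝ) {ι : Type*} [Fintype ι]
    {ε : ι → ℝ} {E : ι → TangentSpace (𝓡 n) p}
    (hE : ∀ B : TangentSpace (𝓡 n) p →ₗ[ℝ] TangentSpace (𝓡 n) p →ₗ[ℝ] ℝ,
      metricTrace g p (fun u v ↦ B u v) = ∑ c, ε c • B (E c) (E c)) :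
    metricTrace g p (fun u v ↦ l u * l v) = ∑ c, ε c * l (E c) ^ 2 := by
  refine (hE ((LinearMap.mul ℝ ℝ).compl₁₂ l l)).trans (Finset.sum_congr rfl fun c _ ↦ ?_)
  rw [sq]
  rfl

theorem metricTrace_metricTrace_mul
    (C : TangentSpace (𝓡 n) p →ₗ[ℝ] TangentSpace (𝓡 n) p →ₗ[ℝ] ℝ) {ι : Type*} [Fintype ι]
    {ε : ι → ℝ} {E : ι → TangentSpace (𝓡 n) p}
    (hE : ∀ B : TangentSpace (𝓡 n) p →ₗ[ℝ] TangentSpace (𝓡 n) p →ₗ[ℝ] ℝ,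
      metricTrace g p (fun u v ↦ B u v) = ∑ c, ε c • B (E c) (E c)) :
    metricTrace g p (fun u v ↦ metricTrace g p fun u' v' ↦ C u u' * C v v') =
      ∑ c, ∑ d, ε c * (ε d * C (E c) (E d) ^ 2) := by
  have h1 : ∀ u v, metricTrace g p (fun u' v' ↦ C u u' * C v v') =
      ∑ d, ε d • (C u (E d) * C v (E d)) := fun u v ↦
    hE ((LinearMap.mul ℝ ℝ).compl₁₂ (C u) (C v))
  simp only [h1]
  have h2 := hE (∑ d, ε d • (LinearMap.mul ℝ ℝ).compl₁₂ (C.flip (E d)) (C.flip (E d)))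
  simp only [LinearMap.sum_apply, LinearMap.smul_apply, LinearMap.compl₁₂_apply,
    LinearMap.flip_apply, LinearMap.mul_apply'] at h2
  rw [h2]
  simp only [smul_eq_mul, Finset.mul_sum, sq]

theorem IsOrthonormalAt.metricTrace_eq {W : Type*} [AddCommGroup W] [Module ℝ W]
    {e : Fin n → TangentSpace (𝓡 n) p} (he : IsOrthonormalAt g p e)
    (B : TangentSpace (𝓡 n) p →ₗ[ℝ] TangentSpace (𝓡 n) p →ₗ[ℝ] W) :
    metricTrace g p (fun u v ↦ B u v) = ∑ μ, (1 : ℝ) • B (e μ) (e μ) := by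
  simp only [one_smul]
  exact metricTrace_eq_orthonormal g B he

namespace Flattening

variable (Φ : Flattening g D)

/-- The bilinear form `(u, u') ↦ ⟨R(u, v)w, u'⟩`. -/
def curvatureBilin (p : M) (v w : TangentSpace (𝓡 n) p) :
    TangentSpace (𝓡 n) p →ₗ[ℝ] TangentSpace (𝓡 n) p →ₗ[ℝ] ℝ :=
  (Φ.II p).compr₂ (Φ.form (Φ.II p v w)).toLinearMap -
    Φ.form.toLinearMap₁₂.compl₁₂ ((Φ.II p).flip w) (Φ.II p v)

theorem curvatureBilin_apply (v w u u' : TangentSpace (𝓡 n) p) :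
    Φ.curvatureBilin p v w u u' =
      Φ.form (Φ.II p v w) (Φ.II p u u') - Φ.form (Φ.II p u w) (Φ.II p v u') := rfl

theorem ricci_eq_metricTrace (v w : TangentSpace (𝓡 n) p) :
    ricci g p v w = metricTrace g p (fun u u' ↦ Φ.curvatureBilin p v w u u') := by
  simp only [ricci, Φ.inner_curvature, curvatureBilin_apply]

theorem ricci_eq_frame (v w : TangentSpace (𝓡 n) p) :
    ricci g p v w = ∑ c, Φ.ε c *
      (Φ.form (Φ.II p v w) (Φ.II p (Φ.frame c p) (Φ.frame c p)) -
        Φ.form (Φ.II p (Φ.frame c p) w) (Φ.II p v (Φ.frame c p))) := by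
  rw [ricci_eq_metricTrace, metricTrace_eq_frame]
  rfl

include Φ in
theorem ricci_smul_smul (c : ℝ) (v : TangentSpace (𝓡 n) p) :
    ricci g p (c • v) (c • v) = c ^ 2 * ricci g p v v := by
  rw [Φ.ricci_eq_frame, Φ.ricci_eq_frame, Finset.mul_sum]
  refine Finset.sum_congr rfl fun d _ ↦ ?_
  simp only [map_smul, LinearMap.smul_apply, smul_apply, smul_eq_mul]
  ring

theorem metricTrace_curvature (v z : TangentSpace (𝓡 n) p) {e : Fin n → TangentSpace (𝓡 n) p}
    (he : IsOrthonormalAt g p e) :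
    metricTrace g p (fun u w ↦ g.inner p (curvature g p u v w) z) =
      ∑ μ, (Φ.form (Φ.II p v (e μ)) (Φ.II p (e μ) z) -
        Φ.form (Φ.II p (e μ) (e μ)) (Φ.II p v z)) := by
  simp only [Φ.inner_curvature]
  exact metricTrace_eq_orthonormal g (Φ.form.toLinearMap₁₂.flip.compl₁₂ ((Φ.II p).flip z) (Φ.II p v) -
    (Φ.II p).compr₂ (Φ.form.flip (Φ.II p v z)).toLinearMap) he

end Flattening

end Traces

/-! ### Bochner's formula on a manifold. -/

section Bochner

variable {n D : ℕ} {M : Type*} [TopologicalSpace M] [ChartedSpace (Euc n) M]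
  [IsManifold (𝓡 n) ∞ M] {g : Metric n M}

/-- The vector field dual to a one-form. -/
def sharpField (g : Metric n M) (α : OneForm n M) : VField n M where
  toFun := sharpForm g α
  contMDiff_toFun := contMDiff_sharpForm g α

theorem coordHalfNormSq_coordForm (g : Metric n M) (α : OneForm n M) (p : M) {y : Euc n}
    (hy : y ∈ (extChartAt (𝓡 n) p).target) :
    coordHalfNormSq (coordMetric g p) (coordForm α p) y =
      (1 / 2) * g.inner ((extChartAt (𝓡 n) p).symm y) (sharpForm g α ((extChartAt (𝓡 n) p).symm y))
        (sharpForm g α ((extChartAt (𝓡 n) p).symm y)) := by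
  have hE := (coordMetric_det_pos g hy).ne'
  rw [coordMetric_eq_gramOf] at hE
  rw [coordHalfNormSq]
  congr 1
  set q := (extChartAt (𝓡 n) p).symm y
  have h := sum_gramOf_inv_inner_smul g hE (sharpForm g α q)
  have h2 := congrArg (g.inner q (sharpForm g α q)) h
  rw [← h2]
  simp only [map_sum, map_smul, smul_eq_mul, inner_sharpForm]
  rw [coordMetric_eq_gramOf]
  refine Finset.sum_congr rfl fun i _ ↦ Finset.sum_congr rfl fun j _ ↦ ?_
  rw [mul_assoc, mul_comm (coordForm α p i y)]
  rfl

theorem sum_mul_sum_comm {ι : Type*} [Fintype ι] (G : ι → ι → ℝ) (a : ι → ℝ)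
    (X : ι → ι → ι → ℝ) :
    ∑ i, ∑ j, G i j * (a i * ∑ l, ∑ k, G l k * X l j k) =
      ∑ l, ∑ k, G l k * ∑ i, ∑ j, G i j * (a i * X l j k) := by
  simp only [Finset.mul_sum]
  calc ∑ i, ∑ j, ∑ l, ∑ k, G i j * (a i * (G l k * X l j k))
      = ∑ x : ι × ι, ∑ z : ι × ι, G x.1 x.2 * (a x.1 * (G z.1 z.2 * X z.1 x.2 z.2)) := by
        simp only [Fintype.sum_prod_type]
    _ = ∑ z : ι × ι, ∑ x : ι × ι, G z.1 z.2 * (G x.1 x.2 * (a x.1 * X z.1 x.2 z.2)) := by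
        rw [Finset.sum_comm]
        exact Finset.sum_congr rfl fun _ _ ↦ Finset.sum_congr rfl fun _ _ ↦ by ring
    _ = _ := by simp only [Fintype.sum_prod_type]

theorem inner_curvature_tangentBasis (g : Metric n M) (p : M) (i j k : Fin n)
    (z : TangentSpace (𝓡 n) p) :
    g.inner p (curvature g p (tangentBasis p i) (tangentBasis p j) (tangentBasis p k)) z =
      ∑ a, curvatureCoeff (coordMetric g p) a i j k (extChartAt (𝓡 n) p p) *
        g.inner p (tangentBasis p a) z := by
  have e : curvature g p (tangentBasis p i) (tangentBasis p j) (tangentBasis p k) =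
      ∑ a, curvatureCoeff (coordMetric g p) a i j k (extChartAt (𝓡 n) p p) • tangentBasis p a := by
    have h : ∀ u : Euc n, u = ∑ a, u a • stdVec a := Flattening.eq_sum_stdVec
    refine (h (coordCurvature (coordMetric g p) (extChartAt (𝓡 n) p p) (stdVec i) (stdVec j)
      (stdVec k))).trans (Finset.sum_congr rfl fun a _ ↦ ?_)
    have h' : coordCurvature (coordMetric g p) (extChartAt (𝓡 n) p p) (stdVec i) (stdVec j)
      (stdVec k) a = curvatureCoeff (coordMetric g p) a i j k (extChartAt (𝓡 n) p p) := by
      simp [coordCurvature]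
    rw [h']
    rfl
  rw [e]
  simp only [map_sum, map_smul, sum_apply, smul_apply, smul_eq_mul]

theorem coordForm_self (α : OneForm n M) (p : M) (i : Fin n) :
    coordForm α p i (extChartAt (𝓡 n) p p) = α p (tangentBasis p i) := by
  have key : ∀ q, q = p → ∀ v w : Euc n, v = w →
      α q (show TangentSpace (𝓡 n) q from v) = α p (show TangentSpace (𝓡 n) p from w) := by
    rintro q rfl v w rfl; rfl
  exact key _ (extChartAt_to_inv p) _ _ (coordVec_self p (stdVec i))

namespace Flattening

variable (Φ : Flattening g D)

theorem covForm_coordForm_self (α : OneForm n M) (p : M) (i j : Fin n) :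
    covForm (coordMetric g p) (coordForm α p) i j (extChartAt (𝓡 n) p p) =
      Φ.covBilin (sharpField g α) p (tangentBasis p i) (tangentBasis p j) := by
  refine (Φ.covForm_eq (sharpField g α) p (fun j z _ ↦ (inner_sharpForm g α _ _).symm)
    (mem_extChartAt_target (I := 𝓡 n) p) i j).trans ?_
  have key : ∀ q, q = p → ∀ v w v' w' : Euc n, v = v' → w = w' →
      Φ.covBilin (sharpField g α) q (show TangentSpace (𝓡 n) q from v)
        (show TangentSpace (𝓡 n) q from w) =
      Φ.covBilin (sharpField g α) p (show TangentSpace (𝓡 n) p from v')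
        (show TangentSpace (𝓡 n) p from w') := by
    rintro q rfl v w v' w' rfl rfl; rfl
  exact key _ (extChartAt_to_inv p) _ _ _ _ (coordVec_self p (stdVec i)) (coordVec_self p (stdVec j))

/-- The Bochner formula for harmonic one-forms. -/
theorem laplacian_halfNormSq {α : OneForm n M} (hα : IsHarmonic g α) {p : M}
    {e : Fin n → TangentSpace (𝓡 n) p} (he : IsOrthonormalAt g p e) :
    laplacian g (fun q ↦ (1 / 2) * g.inner q (sharpField g α q) (sharpField g α q)) p =
      ∑ μ, ∑ l, Φ.covBilin (sharpField g α) p (e μ) (e l) ^ 2 -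
      ∑ μ, (Φ.form (Φ.II p (sharpField g α p) (e μ)) (Φ.II p (e μ) (sharpField g α p)) -
        Φ.form (Φ.II p (e μ) (e μ)) (Φ.II p (sharpField g α p) (sharpField g α p))) := by
  have hyt := mem_extChartAt_target (I := 𝓡 n) p
  have h1 : laplacian g (fun q ↦ (1 / 2) * g.inner q (sharpField g α q) (sharpField g α q)) p =
      coordLaplacian (coordMetric g p) (coordHalfNormSq (coordMetric g p) (coordForm α p))
        (extChartAt (𝓡 n) p p) := by
    refine coordLaplacian_congr ?_
    filter_upwards [(isOpen_extChartAt_target (I := 𝓡 n) p).mem_nhds hyt] with z hz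
    exact (coordHalfNormSq_coordForm g α p hz).symm
  rw [h1, (isMetricOn_coordMetric g p).coordLaplacian_halfNormSq (contDiffOn_coordForm α p) hyt
    (hα p), coordMetric_self]
  congr 1
  · have h2 := metricTrace_metricTrace_mul (Φ.covBilin (sharpField g α) p) he.metricTrace_eq
    simp only [one_mul] at h2
    rw [← h2]
    simp only [Φ.covForm_coordForm_self]
    rfl
  -- The curvature term is the trace of `⟨R(·, T)·, T⟩`, which is `-Ric(T, T)`. Matching it with the
  -- coordinate formula amounts to expanding `T = α^♯` in the coordinate basis.
  · rw [← Φ.metricTrace_curvature _ _ he]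
    have hT : ∀ l : TangentSpace (𝓡 n) p →ₗ[ℝ] ℝ, l (sharpField g α p) =
        ∑ i, ∑ j, (gram g p)⁻¹ i j * (α p (tangentBasis p i) * l (tangentBasis p j)) := by
      intro l
      have h3 : sharpField g α p =
        ∑ i, ∑ j, ((gram g p)⁻¹ i j * α p (tangentBasis p j)) • tangentBasis p i := rfl
      rw [h3, Finset.sum_comm]
      simp only [map_sum, map_smul, smul_eq_mul]
      refine Finset.sum_congr rfl fun i _ ↦ Finset.sum_congr rfl fun j _ ↦ ?_
      rw [gram_inv_symm, mul_assoc]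
    have h4 : ∀ l k, g.inner p (curvature g p (tangentBasis p l) (sharpField g α p)
        (tangentBasis p k)) (sharpField g α p) = ∑ i, ∑ j, (gram g p)⁻¹ i j *
        (α p (tangentBasis p i) * g.inner p (curvature g p (tangentBasis p l) (tangentBasis p j)
        (tangentBasis p k)) (sharpField g α p)) := by
      intro l k
      simp only [Φ.inner_curvature]
      exact hT ((Φ.form.flip (Φ.II p (tangentBasis p l) (sharpField g α p))).toLinearMap ∘ₗ
        (Φ.II p).flip (tangentBasis p k) -
        (Φ.form (Φ.II p (tangentBasis p l) (tangentBasis p k))).toLinearMap ∘ₗ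
          (Φ.II p).flip (sharpField g α p))
    have h5 : ∀ a, g.inner p (tangentBasis p a) (sharpField g α p) = α p (tangentBasis p a) :=
      fun a ↦ (g.symm _ _ _).trans (inner_sharpForm g α p _)
    simp only [metricTrace, smul_eq_mul, h4, inner_curvature_tangentBasis, h5, coordForm_self]
    exact sum_mul_sum_comm _ _ _

end Flattening

end Bochner

/-! ### The index form on multiples of the unit normal. -/

section Density

variable {m D : ℕ} {S M : Type*} [TopologicalSpace S] [ChartedSpace (Euc m) S]
  [IsManifold (𝓡 m) ∞ S] [TopologicalSpace M] [ChartedSpace (Euc (m + 1)) M]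
  [IsManifold (𝓡 (m + 1)) ∞ M] {gS : Metric m S} {gM : Metric (m + 1) M} {f : S → M}
  {ν : ∀ p : S, TangentSpace (𝓡 (m + 1)) (f p)} {p : S} {e : Fin m → TangentSpace (𝓡 m) p}

theorem contMDiff_smul_along {n : ℕ} {N : Type*} [TopologicalSpace N] [ChartedSpace (Euc n) N]
    [IsManifold (𝓡 n) ∞ N] {h : S → N} {V : ∀ p, TangentSpace (𝓡 n) (h p)} {φ : S → ℝ}
    (hφ : ContMDiff (𝓡 m) 𝓘(ℝ) ∞ φ)
    (hV : ContMDiff (𝓡 m) (𝓡 n).tangent ∞ fun p ↦ (⟨h p, V p⟩ : TangentBundle (𝓡 n) N)) :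
    ContMDiff (𝓡 m) (𝓡 n).tangent ∞
      fun p ↦ (⟨h p, φ p • V p⟩ : TangentBundle (𝓡 n) N) := by
  intro p
  obtain ⟨h1, h2⟩ := Bundle.contMDiffAt_totalSpace.1 (hV p)
  refine Bundle.contMDiffAt_totalSpace.2 ⟨h1, ((hφ p).smul h2).congr_of_eventuallyEq ?_⟩
  have hopen := (trivializationAt (Euc n) (fun x : N ↦ TangentSpace (𝓡 n) x) (h p)).open_baseSet
  have hmem := FiberBundle.mem_baseSet_trivializationAt' (F := Euc n)
    (E := fun x : N ↦ TangentSpace (𝓡 n) x) (h p)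
  filter_upwards [h1.continuousAt.preimage_mem_nhds (hopen.mem_nhds hmem)] with q hq
  exact ((trivializationAt (Euc n) (fun x : N ↦ TangentSpace (𝓡 n) x) (h p)).linear ℝ hq).map_smul
    (φ q) (V q)

namespace Flattening

variable (Φ : Flattening gM D)

include Φ in
-- The product rule for `φ · Jν`, paired with `Jν`: the term with the derivative of `Jν` vanishes
-- since `|ν| = 1`.
theorem inner_covAlong_smul_normal (hν : IsUnitNormal (m := m) gM f ν) {φ : S → ℝ}
    (hφ : ContMDiff (𝓡 m) 𝓘(ℝ) ∞ φ) (u : TangentSpace (𝓡 m) p) :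
    gM.inner (f p) (covAlong gM f (fun x ↦ φ x • ν x) p u) (ν p) = mvfderiv (𝓡 m) φ p u := by
  have h1 := Φ.mvfderiv_J ((contMDiff_smul_along hφ hν.smooth).mdifferentiableAt (by simp)
    (x := p)) u
  have h2 := mvfderiv_bilinear (ContinuousLinearMap.lsmul ℝ ℝ : ℝ →L[ℝ] (Fin D → ℝ) →L[ℝ] _)
    (hφ.mdifferentiableAt (by simp) (x := p)) (Φ.mdifferentiableAt_normal (p := p) hν) u
  simp only [ContinuousLinearMap.lsmul_apply] at h2
  simp only [map_smul] at h1
  rw [h2] at h1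
  have h3 := congrArg (fun z ↦ Φ.form z (Φ.J (f p) (ν p))) h1
  simp only [map_add, map_smul, add_apply, smul_apply, smul_eq_mul, form_J, form_II_J,
    Φ.form_mvfderiv_normal_self hν, hν.unit] at h3
  linarith

include Φ in
theorem normalCov_smul_normal (hf : IsIsometricImmersion gS gM f)
    (hν : IsUnitNormal (m := m) gM f ν) (he : IsOrthonormalAt gS p e) {φ : S → ℝ}
    (hφ : ContMDiff (𝓡 m) 𝓘(ℝ) ∞ φ) (u : TangentSpace (𝓡 m) p) :
    normalCov gS gM f (fun x ↦ φ x • ν x) p u = mvfderiv (𝓡 m) φ p u • ν p := by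
  rw [normalCov, hν.normalPart_eq hf he, Φ.inner_covAlong_smul_normal hν hφ]

include Φ in
/-- The integrand of the index form on the normal field `φν`. -/
theorem indexDensity_smul_normal (hf : IsIsometricImmersion gS gM f)
    (hν : IsUnitNormal (m := m) gM f ν) (he : IsOrthonormalAt gS p e) {φ : S → ℝ}
    (hφ : ContMDiff (𝓡 m) 𝓘(ℝ) ∞ φ) :
    indexDensity gS gM f (fun x ↦ φ x • ν x) (fun x ↦ φ x • ν x) p =
      metricTrace gS p (fun u v ↦ mvfderiv (𝓡 m) φ p u * mvfderiv (𝓡 m) φ p v) -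
        (ricci gM (f p) (ν p) (ν p) + normSqSecondFF gS gM f p) * φ p ^ 2 := by
  simp only [indexDensity, Φ.normalCov_smul_normal hf hν he hφ, Φ.ricci_smul_smul, map_smul,
    smul_apply, hν.unit, smul_eq_mul, mul_one]
  have h : (fun u v ↦ mvfderiv (𝓡 m) φ p v * mvfderiv (𝓡 m) φ p u) =
    fun u v ↦ mvfderiv (𝓡 m) φ p u * mvfderiv (𝓡 m) φ p v := by
    ext u v; ring
  rw [h]
  ring

/-- The scalar second fundamental form as a bilinear form. -/
def scalarBilin (hf : IsIsometricImmersion gS gM f) (ν : ∀ p : S, TangentSpace (𝓡 (m + 1)) (f p))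
    (p : S) : TangentSpace (𝓡 m) p →ₗ[ℝ] TangentSpace (𝓡 m) p →ₗ[ℝ] ℝ :=
  ((Φ.pullback hf).II p).compr₂ (Φ.form (Φ.J (f p) (ν p))).toLinearMap

theorem scalarBilin_apply (hf : IsIsometricImmersion gS gM f) (u w : TangentSpace (𝓡 m) p) :
    Φ.scalarBilin hf ν p u w = scalarFF gS gM f ν p u w :=
  Φ.form_normal_II hf u w

theorem normSqSecondFF_eq_metricTrace (hf : IsIsometricImmersion gS gM f)
    (hν : IsUnitNormal (m := m) gM f ν) (he : IsOrthonormalAt gS p e) :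
    normSqSecondFF gS gM f p = metricTrace gS p (fun u v ↦ metricTrace gS p fun u' v' ↦
      Φ.scalarBilin hf ν p u u' * Φ.scalarBilin hf ν p v v') := by
  have h : ∀ u u' v v', gM.inner (f p) (secondFF gS gM f p u u') (secondFF gS gM f p v v') =
      Φ.scalarBilin hf ν p u u' * Φ.scalarBilin hf ν p v v' := by
    intro u u' v v'
    rw [hν.secondFF_eq hf he u u', hν.secondFF_eq hf he v v', scalarBilin_apply,
      scalarBilin_apply, map_smul, map_smul, smul_apply, hν.unit]
    simp only [smul_eq_mul]
    ring
  simp only [normSqSecondFF, h]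

include Φ in
theorem normSqSecondFF_eq_sum (hf : IsIsometricImmersion gS gM f)
    (hν : IsUnitNormal (m := m) gM f ν) (he : IsOrthonormalAt gS p e) :
    normSqSecondFF gS gM f p = ∑ μ, ∑ l, scalarFF gS gM f ν p (e μ) (e l) ^ 2 := by
  have h := metricTrace_metricTrace_mul (Φ.scalarBilin hf ν p) he.metricTrace_eq
  rw [Φ.normSqSecondFF_eq_metricTrace hf hν he, h]
  simp only [one_mul, scalarBilin_apply]

include Φ in
theorem continuous_normSqSecondFF (hf : IsIsometricImmersion gS gM f)
    (hν : IsUnitNormal (m := m) gM f ν) {e : ∀ p : S, Fin m → TangentSpace (𝓡 m) p}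
    (he : ∀ p, IsOrthonormalAt gS p (e p)) : Continuous (normSqSecondFF gS gM f) := by
  set Ψ := Φ.pullback hf with hΨ
  have h : normSqSecondFF gS gM f = fun p ↦ ∑ c, ∑ d, Ψ.ε c * (Ψ.ε d *
      Φ.form (Φ.J (f p) (ν p)) (Ψ.II p (Ψ.frame c p) (Ψ.frame d p)) ^ 2) := by
    ext p
    rw [Φ.normSqSecondFF_eq_metricTrace hf hν (he p),
      metricTrace_metricTrace_mul (Φ.scalarBilin hf ν p) (Ψ.metricTrace_eq_frame p)]
    rfl
  rw [h]
  refine continuous_finsetSum _ fun c _ ↦ continuous_finsetSum _ fun d _ ↦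
    continuous_const.mul (continuous_const.mul (Continuous.pow ?_ 2))
  exact (Φ.form.continuous.comp (Φ.contMDiff_normal hν).continuous).clm_apply
    (Ψ.continuous_II_frame c d)

include Φ in
theorem continuous_ricci_normal (hf : IsIsometricImmersion gS gM f)
    (hν : IsUnitNormal (m := m) gM f ν) :
    Continuous fun p ↦ ricci gM (f p) (ν p) (ν p) := by
  simp only [Φ.ricci_eq_frame]
  have hf' := hf.smooth.continuous
  have h1 := (Φ.contMDiff_normal hν).continuous
  have h2 : ∀ c, Continuous fun p ↦ Φ.J (f p) (Φ.frame c (f p)) := fun c ↦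
    (Φ.contMDiff_J (Φ.frame c)).continuous.comp hf'
  refine continuous_finsetSum _ fun c _ ↦ continuous_const.mul (Continuous.sub ?_ ?_)
  · exact (Φ.form.continuous.comp (Φ.continuous_II hf' h1 h1)).clm_apply
      (Φ.continuous_II hf' (h2 c) (h2 c))
  · exact (Φ.form.continuous.comp (Φ.continuous_II hf' (h2 c) h1)).clm_apply
      (Φ.continuous_II hf' h1 (h2 c))

include Φ in
-- The bases `e p` are chosen pointwise, with no continuity in `p`. The density is therefore
-- rewritten with the global frames of the flattenings.
theorem continuous_indexDensity_smul_normal (hf : IsIsometricImmersion gS gM f)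
    (hν : IsUnitNormal (m := m) gM f ν) {e : ∀ p : S, Fin m → TangentSpace (𝓡 m) p}
    (he : ∀ p, IsOrthonormalAt gS p (e p)) {φ : S → ℝ} (hφ : ContMDiff (𝓡 m) 𝓘(ℝ) ∞ φ) :
    Continuous (indexDensity gS gM f (fun x ↦ φ x • ν x) (fun x ↦ φ x • ν x)) := by
  set Ψ := Φ.pullback hf with hΨ
  have h : indexDensity gS gM f (fun x ↦ φ x • ν x) (fun x ↦ φ x • ν x) = fun p ↦
      ∑ c, Ψ.ε c * mvfderiv (𝓡 m) φ p (Ψ.frame c p) ^ 2 -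
        (ricci gM (f p) (ν p) (ν p) + normSqSecondFF gS gM f p) * φ p ^ 2 := by
    ext p
    rw [Φ.indexDensity_smul_normal hf hν (he p) hφ]
    congr 1
    exact metricTrace_mul (mvfderiv (𝓡 m) φ p).toLinearMap (Ψ.metricTrace_eq_frame p)
  rw [h]
  refine Continuous.sub (continuous_finsetSum _ fun c _ ↦ continuous_const.mul
    ((contMDiff_deriv (Ψ.frame c) hφ).continuous.pow 2)) ?_
  exact ((Φ.continuous_ricci_normal hf hν).add (Φ.continuous_normSqSecondFF hf hν he)).mul
    (hφ.continuous.pow 2)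

/-- The Ricci curvature in the normal direction of a hypersurface. -/
theorem ricci_normal_eq_sum (hf : IsIsometricImmersion gS gM f)
    (hν : IsUnitNormal (m := m) gM f ν) (he : IsOrthonormalAt gS p e) :
    ricci gM (f p) (ν p) (ν p) = ∑ μ,
      (Φ.form (Φ.II (f p) (ν p) (ν p)) (Φ.II (f p) (mfderiv (𝓡 m) (𝓡 (m + 1)) f p (e μ))
          (mfderiv (𝓡 m) (𝓡 (m + 1)) f p (e μ))) -
        Φ.form (Φ.II (f p) (mfderiv (𝓡 m) (𝓡 (m + 1)) f p (e μ)) (ν p))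
          (Φ.II (f p) (ν p) (mfderiv (𝓡 m) (𝓡 (m + 1)) f p (e μ)))) := by
  rw [Φ.ricci_eq_metricTrace, hν.metricTrace_eq hf he]
  simp only [curvatureBilin_apply, sub_self, zero_add]

include Φ in
theorem sum_scalarFF_self (hf : IsIsometricImmersion gS gM f) (hmin : IsMinimal gS gM f)
    (he : IsOrthonormalAt gS p e) : ∑ μ, scalarFF gS gM f ν p (e μ) (e μ) = 0 := by
  have h1 : metricTrace gS p (secondFF gS gM f p) = ∑ μ, secondFF gS gM f p (e μ) (e μ) := by
    have h2 := metricTrace_eq_orthonormal gS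
      (((Φ.pullback hf).II p).compr₂ (Φ.proj (f p))) he
    simp only [LinearMap.compr₂_apply, ← Φ.secondFF_eq_proj hf] at h2
    exact h2
  have h3 := h1.symm.trans (hmin p)
  have h4 := congrArg (fun w ↦ gM.inner (f p) w (ν p)) h3
  simp only [map_sum, sum_apply, map_zero, zero_apply] at h4
  exact h4

end Flattening

end Density

/-! ### Bivectors and Parseval's identity. -/

section Wedge

variable {V W : Type*} [AddCommGroup V] [Module ℝ V] [AddCommGroup W] [Module ℝ W]

theorem update_zero_pair (x y z : V) : Function.update ![x, y] 0 z = ![z, y] := by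
  ext i; fin_cases i <;> rfl

theorem update_one_pair (x y z : V) : Function.update ![x, y] 1 z = ![x, z] := by
  ext i; fin_cases i <;> rfl

/-- The bivector `x ∧ y`, as a bilinear map. -/
def wedge : V →ₗ[ℝ] V →ₗ[ℝ] ⋀[ℝ]^2 V :=
  LinearMap.mk₂ ℝ (fun x y ↦ exteriorPower.ιMulti ℝ 2 ![x, y])
    (fun x x' y ↦ by
      simpa only [update_zero_pair] using
        (exteriorPower.ιMulti ℝ 2).map_update_add ![x, y] 0 x x')
    (fun c x y ↦ by
      simpa only [update_zero_pair] using
        (exteriorPower.ιMulti ℝ 2).map_update_smul ![x, y] 0 c x)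
    (fun x y y' ↦ by
      simpa only [update_one_pair] using
        (exteriorPower.ιMulti ℝ 2).map_update_add ![x, y] 1 y y')
    (fun c x y ↦ by
      simpa only [update_one_pair] using
        (exteriorPower.ιMulti ℝ 2).map_update_smul ![x, y] 1 c y)

theorem wedgeForm_wedge (b : LinearMap.BilinForm ℝ V) (x y z w : V) :
    wedgeForm b (wedge x y) (wedge z w) = b x z * b y w - b x w * b y z :=
  wedgeForm_ιMulti b x y z w

/-- The hypotheses say that `x` and `y` are the images of `x'` and `y'` under the adjoint of `L`, so
the identity is clear on decomposable bivectors. It moves the test functions from the varying spaces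
`∧²T_qN` to the fixed space `∧²𝔤`. -/
theorem wedgeForm_map {b : LinearMap.BilinForm ℝ V} {b' : LinearMap.BilinForm ℝ W} (L : V →ₗ[ℝ] W)
    {x y : V} {x' y' : W} (hx : ∀ X, b x X = b' x' (L X)) (hy : ∀ X, b y X = b' y' (L X))
    (w : ⋀[ℝ]^2 V) :
    wedgeForm b' (wedge x' y') (exteriorPower.map 2 L w) = wedgeForm b (wedge x y) w := by
  have h : (wedgeForm b' (wedge x' y')) ∘ₗ exteriorPower.map 2 L = wedgeForm b (wedge x y) := by
    apply exteriorPower.linearMap_ext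
    ext z
    have hz : z = ![z 0, z 1] := by
      ext i; fin_cases i <;> rfl
    have hLz : L ∘ ![z 0, z 1] = ![L (z 0), L (z 1)] := by
      ext i; fin_cases i <;> rfl
    rw [LinearMap.compAlternatingMap_apply, LinearMap.compAlternatingMap_apply, hz,
      LinearMap.comp_apply, exteriorPower.map_apply_ιMulti, hLz]
    refine (wedgeForm_wedge b' x' y' (L (z 0)) (L (z 1))).trans
      (Eq.trans ?_ (wedgeForm_wedge b x y (z 0) (z 1)).symm)
    rw [hx, hx, hy, hy]
  exact congrArg (fun l ↦ l w) h

/-- Parseval's identity. -/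
theorem sum_sq_of_orthonormal (b : LinearMap.BilinForm ℝ V) {ι : Type*} [Fintype ι] [DecidableEq ι]
    (v : Module.Basis ι ℝ V) (hv : ∀ i j, b (v i) (v j) = if i = j then 1 else 0) (x : V) :
    ∑ i, b x (v i) ^ 2 = b x x := by
  have h : ∀ i, b x (v i) = v.repr x i := by
    intro i
    conv_lhs => rw [← v.sum_repr x]
    simp only [map_sum, map_smul, LinearMap.sum_apply, LinearMap.smul_apply, hv]
    simp
  conv_rhs => enter [2]; rw [← v.sum_repr x]
  simp only [map_sum, map_smul, h, smul_eq_mul, sq]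

/-- Applied with `n, t` the images of `ν, T`, with `x, y` their derivatives along `u`, and with `c =
⟨A(u, T), ν⟩`. The cross term vanishes and each of the two squares loses `c²`. -/
theorem wedgeForm_add_self (b : LinearMap.BilinForm ℝ V) (hb : ∀ x y, b x y = b y x) {x y n t : V}
    {c : ℝ} (hxn : b x n = 0) (hnt : b n t = 0) (hnn : b n n = 1) (hxt : b x t = -c)
    (hny : b n y = c) :
    wedgeForm b (wedge n y + wedge x t) (wedge n y + wedge x t) =
      b x x * b t t + b y y - 2 * c ^ 2 := by
  simp only [map_add, LinearMap.add_apply, wedgeForm_wedge]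
  rw [hb t x, hb n x, hb y n, hb t n, hxn, hnt, hnn, hxt, hny]
  ring

theorem wedgeForm_self (b : LinearMap.BilinForm ℝ V) {n t : V} (hnt : b n t = 0)
    (hnn : b n n = 1) : wedgeForm b (wedge n t) (wedge n t) = b t t := by
  rw [wedgeForm_wedge, hnt, hnn]
  ring

/-- The bilinear map `(x, y) ↦ ⟨κ⁻¹x ∧ κ⁻¹y, w⟩`. -/
def wedgePairing {E : Type*} [NormedAddCommGroup E] [NormedSpace ℝ E] [FiniteDimensional ℝ E]
    (b : LinearMap.BilinForm ℝ V) (κ : V ≃ₗ[ℝ] E) (w : ⋀[ℝ]^2 V) : E →L[ℝ] E →L[ℝ] ℝ :=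
  LinearMap.toContinuousLinearMap ((LinearMap.toContinuousLinearMap :
    (E →ₗ[ℝ] ℝ) ≃ₗ[ℝ] (E →L[ℝ] ℝ)).toLinearMap ∘ₗ
      ((wedge.compl₁₂ κ.symm.toLinearMap κ.symm.toLinearMap).compr₂ ((wedgeForm b).flip w)))

theorem wedgePairing_apply {E : Type*} [NormedAddCommGroup E] [NormedSpace ℝ E]
    [FiniteDimensional ℝ E] (b : LinearMap.BilinForm ℝ V) (κ : V ≃ₗ[ℝ] E) (w : ⋀[ℝ]^2 V)
    (x y : E) : wedgePairing b κ w x y = wedgeForm b (wedge (κ.symm x) (κ.symm y)) w := rfl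

end Wedge

/-! ### Traces of the test functions and of the index density. -/

section TestFunctions

variable {m d D : ℕ} {S M N : Type*} [TopologicalSpace S] [ChartedSpace (Euc m) S]
  [IsManifold (𝓡 m) ∞ S] [TopologicalSpace M] [ChartedSpace (Euc (m + 1)) M]
  [IsManifold (𝓡 (m + 1)) ∞ M] [TopologicalSpace N] [ChartedSpace (Euc d) N]
  [IsManifold (𝓡 d) ∞ N] {gS : Metric m S} {gM : Metric (m + 1) M} {gN : Metric d N} {F : M → N}
  (hF : IsIsometricImmersion gM gN F) {f : S → M} (hf : IsIsometricImmersion gS gM f)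
  {ν : ∀ p : S, TangentSpace (𝓡 (m + 1)) (f p)} (hν : IsUnitNormal (m := m) gM f ν)
  (T : VField m S) {p : S} {e : Fin m → TangentSpace (𝓡 m) p} (Φ : Flattening gN D)
  {κ : IsometryAlgebra gN ≃ₗ[ℝ] (Fin D → ℝ)}
  (hκ : ∀ X Y, Φ.form (κ X) (κ Y) = lieInner gN X Y)
  (hJ : ∀ q u X, Φ.form (Φ.J q u) (κ X) = gN.inner q u (X.dagger q))

namespace Flattening

include hκ in
theorem lieInner_symm_apply (x y : Fin D → ℝ) :
    lieInner gN (κ.symm x) (κ.symm y) = Φ.form x y := by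
  rw [← hκ, κ.apply_symm_apply, κ.apply_symm_apply]

include hκ hJ in
-- By `hκ` and `hJ`, the map `κ⁻¹ ∘ J` is adjoint to evaluation of Killing fields, so `φ` pairs the
-- constant `w` with the moving bivector of `Jν` and `JT`.
theorem testFunction_eq (w : ⋀[ℝ]^2 (IsometryAlgebra gN)) :
    testFunction gN F f ν T w = fun p ↦ wedgePairing (lieInner gN) κ w
      ((Φ.pullback hF).J (f p) (ν p)) (((Φ.pullback hF).pullback hf).J p (T p)) := by
  ext p
  have h : ∀ u X, lieInner gN (κ.symm (Φ.J (F (f p)) u)) X =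
      metricForm gN (F (f p)) u (IsometryAlgebra.evalAt gN (F (f p)) X) := by
    intro u X
    rw [← hκ, κ.apply_symm_apply, hJ]
    rfl
  exact wedgeForm_map (IsometryAlgebra.evalAt gN (F (f p))) (h _) (h _) w

include hν hκ hJ hF hf in
theorem contMDiff_testFunction (w : ⋀[ℝ]^2 (IsometryAlgebra gN)) :
    ContMDiff (𝓡 m) 𝓘(ℝ) ∞ (testFunction gN F f ν T w) := by
  rw [Φ.testFunction_eq hF hf T hκ hJ]
  exact ((wedgePairing (lieInner gN) κ w).contDiff.contMDiff.comp
    ((Φ.pullback hF).contMDiff_normal hν)).clm_apply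
      (((Φ.pullback hF).pullback hf).contMDiff_J T)

include hν hκ hJ in
theorem mvfderiv_testFunction (w : ⋀[ℝ]^2 (IsometryAlgebra gN)) (u : TangentSpace (𝓡 m) p) :
    mvfderiv (𝓡 m) (testFunction gN F f ν T w) p u = wedgeForm (lieInner gN)
      (wedge (κ.symm ((Φ.pullback hF).J (f p) (ν p)))
          (κ.symm (mvfderiv (𝓡 m) (fun x ↦ ((Φ.pullback hF).pullback hf).J x (T x)) p u)) +
        wedge (κ.symm (mvfderiv (𝓡 m) (fun x ↦ (Φ.pullback hF).J (f x) (ν x)) p u))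
          (κ.symm (((Φ.pullback hF).pullback hf).J p (T p)))) w := by
  rw [Φ.testFunction_eq hF hf T hκ hJ, map_add, LinearMap.add_apply]
  exact mvfderiv_bilinear (wedgePairing (lieInner gN) κ w)
    ((Φ.pullback hF).mdifferentiableAt_normal hν)
    ((((Φ.pullback hF).pullback hf).contMDiff_J T).mdifferentiableAt (by simp)) u

variable {ι : Type*} [Fintype ι] [DecidableEq ι]
  (v : Module.Basis ι ℝ (⋀[ℝ]^2 (IsometryAlgebra gN)))
  (hv : ∀ a b, wedgeForm (lieInner gN) (v a) (v b) = if a = b then 1 else 0)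

include hν hκ hJ hv hF hf in
theorem sum_sq_testFunction (p : S) :
    ∑ a, testFunction gN F f ν T (v a) p ^ 2 = gS.inner p (T p) (T p) := by
  simp only [Φ.testFunction_eq hF hf T hκ hJ, wedgePairing_apply]
  rw [sum_sq_of_orthonormal _ v hv, wedgeForm_self, Φ.lieInner_symm_apply hκ]
  · exact ((Φ.pullback hF).pullback hf).form_J p (T p) (T p)
  · rw [Φ.lieInner_symm_apply hκ]
    exact (Φ.pullback hF).form_normal_J hf hν p (T p)
  · rw [Φ.lieInner_symm_apply hκ]
    exact ((Φ.pullback hF).form_J _ _ _).trans (hν.unit p)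

include hν hκ hJ hv in
-- Parseval's identity for the derivative of the bivector `Jν ∧ JT`. The last term comes from the
-- Weingarten equation and its counterpart for `T`.
theorem sum_sq_mvfderiv_testFunction (u : TangentSpace (𝓡 m) p) :
    ∑ a, mvfderiv (𝓡 m) (testFunction gN F f ν T (v a)) p u ^ 2 =
      (Φ.pullback hF).form (mvfderiv (𝓡 m) (fun x ↦ (Φ.pullback hF).J (f x) (ν x)) p u)
        (mvfderiv (𝓡 m) (fun x ↦ (Φ.pullback hF).J (f x) (ν x)) p u) * gS.inner p (T p) (T p) +
      (Φ.pullback hF).form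
        (mvfderiv (𝓡 m) (fun x ↦ ((Φ.pullback hF).pullback hf).J x (T x)) p u)
        (mvfderiv (𝓡 m) (fun x ↦ ((Φ.pullback hF).pullback hf).J x (T x)) p u) -
      2 * scalarFF gS gM f ν p u (T p) ^ 2 := by
  simp only [Φ.mvfderiv_testFunction hF hf hν T hκ hJ]
  rw [sum_sq_of_orthonormal _ v hv, wedgeForm_add_self (c := scalarFF gS gM f ν p u (T p)),
    Φ.lieInner_symm_apply hκ, Φ.lieInner_symm_apply hκ, Φ.lieInner_symm_apply hκ,
    ← ((Φ.pullback hF).pullback hf).form_J p (T p) (T p)]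
  · rfl
  · exact lieInner_symm gN
  · rw [Φ.lieInner_symm_apply hκ]
    exact (Φ.pullback hF).form_mvfderiv_normal_self hν u
  · rw [Φ.lieInner_symm_apply hκ]
    exact (Φ.pullback hF).form_normal_J hf hν p (T p)
  · rw [Φ.lieInner_symm_apply hκ]
    exact ((Φ.pullback hF).form_J _ _ _).trans (hν.unit p)
  · rw [Φ.lieInner_symm_apply hκ]
    exact (Φ.pullback hF).form_mvfderiv_normal hf hν u (T p)
  · rw [Φ.lieInner_symm_apply hκ]
    exact (Φ.pullback hF).form_normal_mvfderiv hf hν T u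

include hν hκ hJ hv in
/-- The trace of the index form integrand over the test variations. -/
theorem sum_indexDensity (he : IsOrthonormalAt gS p e) :
    ∑ a, indexDensity gS gM f (testVariation gN F f ν T (v a)) (testVariation gN F f ν T (v a)) p =
      ∑ μ, ∑ l, ((Φ.pullback hF).pullback hf).covBilin T p (e μ) (e l) ^ 2 -
      ∑ μ, scalarFF gS gM f ν p (e μ) (T p) ^ 2 +
      ∑ μ, ((Φ.pullback hF).form
          ((Φ.pullback hF).II (f p) (mfderiv (𝓡 m) (𝓡 (m + 1)) f p (e μ))
            (mfderiv (𝓡 m) (𝓡 (m + 1)) f p (T p)))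
          ((Φ.pullback hF).II (f p) (mfderiv (𝓡 m) (𝓡 (m + 1)) f p (e μ))
            (mfderiv (𝓡 m) (𝓡 (m + 1)) f p (T p))) +
        (Φ.pullback hF).form
          ((Φ.pullback hF).II (f p) (mfderiv (𝓡 m) (𝓡 (m + 1)) f p (e μ)) (ν p))
          ((Φ.pullback hF).II (f p) (mfderiv (𝓡 m) (𝓡 (m + 1)) f p (e μ)) (ν p)) *
          gS.inner p (T p) (T p)) -
      ricci gM (f p) (ν p) (ν p) * gS.inner p (T p) (T p) := by
  have h1 : ∀ a, indexDensity gS gM f (testVariation gN F f ν T (v a))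
      (testVariation gN F f ν T (v a)) p =
      ∑ μ, mvfderiv (𝓡 m) (testFunction gN F f ν T (v a)) p (e μ) ^ 2 -
        (ricci gM (f p) (ν p) (ν p) + normSqSecondFF gS gM f p) *
          testFunction gN F f ν T (v a) p ^ 2 := by
    intro a
    refine ((Φ.pullback hF).indexDensity_smul_normal hf hν he
      (Φ.contMDiff_testFunction hF hf hν T hκ hJ (v a))).trans ?_
    congr 1
    refine (metricTrace_mul (mvfderiv (𝓡 m) (testFunction gN F f ν T (v a)) p).toLinearMap
      he.metricTrace_eq).trans ?_
    simp only [one_mul]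
    rfl
  simp only [h1, Finset.sum_sub_distrib, ← Finset.mul_sum]
  rw [Φ.sum_sq_testFunction hF hf hν T hκ hJ v hv, Finset.sum_comm]
  simp only [Φ.sum_sq_mvfderiv_testFunction hF hf hν T hκ hJ v hv,
    (Φ.pullback hF).normSq_mvfderiv_normal hf hν he,
    (Φ.pullback hF).normSq_mvfderiv_field hf hν he,
    (Φ.pullback hF).normSqSecondFF_eq_sum hf hν he]
  -- The `|A|²|T|²` in the sum of `|D_u(Jν)|²|T|²` cancels the potential. Of the two copies of `-∑
  -- A(e_μ, T)²`, one is cancelled by the normal part of the derivative of `JT`.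
  simp only [Finset.sum_add_distrib, Finset.sum_sub_distrib, ← Finset.sum_mul, ← Finset.mul_sum,
    add_mul]
  ring

end Flattening

end TestFunctions

/-! ### Comparison with the curvature integrands. -/

section Integrands

variable {m d D : ℕ} {S M N : Type*} [TopologicalSpace S] [ChartedSpace (Euc m) S]
  [IsManifold (𝓡 m) ∞ S] [TopologicalSpace M] [ChartedSpace (Euc (m + 1)) M]
  [IsManifold (𝓡 (m + 1)) ∞ M] [TopologicalSpace N] [ChartedSpace (Euc d) N]
  [IsManifold (𝓡 d) ∞ N] {gS : Metric m S} {gM : Metric (m + 1) M} {gN : Metric d N} {F : M → N}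
  (hF : IsIsometricImmersion gM gN F) {f : S → M} (hf : IsIsometricImmersion gS gM f)
  {ν : ∀ p : S, TangentSpace (𝓡 (m + 1)) (f p)} (hν : IsUnitNormal (m := m) gM f ν)
  (Φ : Flattening gN D)

namespace Flattening

theorem form_II_pullback {q : M} (x y x' y' : TangentSpace (𝓡 (m + 1)) q) :
    (Φ.pullback hF).form ((Φ.pullback hF).II q x y) ((Φ.pullback hF).II q x' y') =
      gN.inner (F q) (secondFF gM gN F q x y) (secondFF gM gN F q x' y') +
        Φ.form (Φ.II (F q) (mfderiv (𝓡 (m + 1)) (𝓡 d) F q x) (mfderiv (𝓡 (m + 1)) (𝓡 d) F q y))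
          (Φ.II (F q) (mfderiv (𝓡 (m + 1)) (𝓡 d) F q x')
            (mfderiv (𝓡 (m + 1)) (𝓡 d) F q y')) := by
  rw [II_pullback, II_pullback, pullback_form, form_J_add_II]

include hF Φ in
/-- The Gauss equation of an immersion. -/
theorem inner_curvature_pullback {q : M} (x y z w : TangentSpace (𝓡 (m + 1)) q) :
    gM.inner q (curvature gM q x y z) w =
      gN.inner (F q) (secondFF gM gN F q y z) (secondFF gM gN F q x w) -
        gN.inner (F q) (secondFF gM gN F q x z) (secondFF gM gN F q y w) +
      gN.inner (F q) (curvature gN (F q) (mfderiv (𝓡 (m + 1)) (𝓡 d) F q x)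
        (mfderiv (𝓡 (m + 1)) (𝓡 d) F q y) (mfderiv (𝓡 (m + 1)) (𝓡 d) F q z))
          (mfderiv (𝓡 (m + 1)) (𝓡 d) F q w) := by
  rw [(Φ.pullback hF).inner_curvature, Φ.inner_curvature, form_II_pullback, form_II_pullback]
  ring

include hν hf in
/-- The Ricci curvature in the normal direction as a sum of sectional curvatures. -/
theorem ricci_normal_eq_sum_curvature (Ψ : Flattening gM D) {p : S}
    {e : Fin m → TangentSpace (𝓡 m) p} (he : IsOrthonormalAt gS p e) :
    ricci gM (f p) (ν p) (ν p) = ∑ μ, gM.inner (f p)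
      (curvature gM (f p) (ν p) (mfderiv (𝓡 m) (𝓡 (m + 1)) f p (e μ))
        (mfderiv (𝓡 m) (𝓡 (m + 1)) f p (e μ))) (ν p) := by
  rw [Ψ.ricci_normal_eq_sum hf hν he]
  refine Finset.sum_congr rfl fun μ _ ↦ ?_
  rw [Ψ.inner_curvature, Ψ.form_symm (Ψ.II (f p) (ν p) (ν p)),
    Ψ.form_symm (Ψ.II (f p) (mfderiv (𝓡 m) (𝓡 (m + 1)) f p (e μ)) (ν p))]

include hν hf hF Φ in
-- The Gauss equation of `M` in `N`, for each `e_μ`, after expanding `Ric(ν, ν)` over the tangent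
-- basis. The curvature of `N` cancels, and each `|B|²` appears a second time.
theorem curvatureIntegrand_eq_secondFFIntegrand (T : ∀ p : S, TangentSpace (𝓡 m) p)
    {e : ∀ p : S, Fin m → TangentSpace (𝓡 m) p} (he : ∀ p, IsOrthonormalAt gS p (e p)) :
    curvatureIntegrand gS gM gN F f ν T e = secondFFIntegrand gS gM gN F f ν T e := by
  ext p
  simp only [curvatureIntegrand, secondFFIntegrand]
  rw [(Φ.pullback hF).ricci_normal_eq_sum_curvature hf hν (he p), Finset.sum_mul,
    ← Finset.sum_add_distrib, ← Finset.sum_sub_distrib, ← Finset.sum_add_distrib,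
    ← Finset.sum_sub_distrib]
  refine Finset.sum_congr rfl fun μ _ ↦ ?_
  rw [Φ.inner_curvature_pullback hF, Φ.inner_curvature_pullback hF,
    Φ.secondFF_symm hF (f p) (mfderiv (𝓡 m) (𝓡 (m + 1)) f p (e p μ))
      (mfderiv (𝓡 m) (𝓡 (m + 1)) f p (T p)),
    Φ.secondFF_symm hF (f p) (mfderiv (𝓡 m) (𝓡 (m + 1)) f p (e p μ)) (ν p),
    gN.symm (F (f p)) (secondFF gM gN F (f p) (mfderiv (𝓡 m) (𝓡 (m + 1)) f p (e p μ))
      (mfderiv (𝓡 m) (𝓡 (m + 1)) f p (e p μ))),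
    gN.symm (F (f p)) (secondFF gM gN F (f p) (mfderiv (𝓡 m) (𝓡 (m + 1)) f p (e p μ))
      (mfderiv (𝓡 m) (𝓡 (m + 1)) f p (e p μ)))]
  ring

/-- If the second fundamental form is antisymmetric, its norm is a sectional curvature. -/
theorem normSq_II_pullback_of_antisymm (hanti : ∀ q u v, Φ.II q u v = -Φ.II q v u) {q : M}
    (x y : TangentSpace (𝓡 (m + 1)) q) :
    (Φ.pullback hF).form ((Φ.pullback hF).II q x y) ((Φ.pullback hF).II q x y) =
      gN.inner (F q) (secondFF gM gN F q x y) (secondFF gM gN F q x y) +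
      gN.inner (F q) (curvature gN (F q) (mfderiv (𝓡 (m + 1)) (𝓡 d) F q y)
        (mfderiv (𝓡 (m + 1)) (𝓡 d) F q x) (mfderiv (𝓡 (m + 1)) (𝓡 d) F q x))
          (mfderiv (𝓡 (m + 1)) (𝓡 d) F q y) := by
  -- The diagonal of `II` vanishes, so the Gauss equation on `N` keeps only `-⟨II(y, x), II(x, y)⟩ =
  -- |II(x, y)|²`.
  have h0 : ∀ z, Φ.II (F q) z z = 0 := fun z ↦ self_eq_neg.1 (hanti _ _ _)
  rw [form_II_pullback, Φ.inner_curvature, h0,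
    hanti (F q) (mfderiv (𝓡 (m + 1)) (𝓡 d) F q y) (mfderiv (𝓡 (m + 1)) (𝓡 d) F q x)]
  simp only [map_zero, map_neg, neg_apply, zero_apply]
  ring

variable {κ : IsometryAlgebra gN ≃ₗ[ℝ] (Fin D → ℝ)}
  (hκ : ∀ X Y, Φ.form (κ X) (κ Y) = lieInner gN X Y)
  (hJ : ∀ q u X, Φ.form (Φ.J q u) (κ X) = gN.inner q u (X.dagger q))
  (hanti : ∀ q u v, Φ.II q u v = -Φ.II q v u)
  {ι : Type*} [Fintype ι] [DecidableEq ι] {v : Module.Basis ι ℝ (⋀[ℝ]^2 (IsometryAlgebra gN))}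
  (hv : ∀ a b, wedgeForm (lieInner gN) (v a) (v b) = if a = b then 1 else 0)

include hν hf hF hκ hJ hanti hv in
/-- The trace of the index form integrand is the sum of a divergence and `curvatureIntegrand`. -/
theorem sum_indexDensity_eq (hmin : IsMinimal gS gM f) {α : OneForm m S} (hα : IsHarmonic gS α)
    {e : ∀ p : S, Fin m → TangentSpace (𝓡 m) p} (he : ∀ p, IsOrthonormalAt gS p (e p)) (p : S) :
    ∑ a, indexDensity gS gM f (testVariation gN F f ν (sharpField gS α) (v a))
        (testVariation gN F f ν (sharpField gS α) (v a)) p =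
      laplacian gS (fun q ↦ (1 / 2) * gS.inner q (sharpField gS α q) (sharpField gS α q)) p +
        curvatureIntegrand gS gM gN F f ν (sharpField gS α) e p := by
  set T := sharpField gS α with hT
  set Ψ := Φ.pullback hF with hΨ
  rw [Φ.sum_indexDensity hF hf hν T hκ hJ v hv (he p),
    (Ψ.pullback hf).laplacian_halfNormSq hα (he p), ← hT, ← hΨ]
  -- The Gauss equation of `Σ` in `M`, in the form needed for the curvature term of Bochner's
  -- formula.
  have h1 : ∀ μ, (Ψ.pullback hf).form ((Ψ.pullback hf).II p (T p) (e p μ))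
      ((Ψ.pullback hf).II p (e p μ) (T p)) -
      (Ψ.pullback hf).form ((Ψ.pullback hf).II p (e p μ) (e p μ))
        ((Ψ.pullback hf).II p (T p) (T p)) =
      scalarFF gS gM f ν p (e p μ) (T p) ^ 2 -
        scalarFF gS gM f ν p (e p μ) (e p μ) * scalarFF gS gM f ν p (T p) (T p) -
      gM.inner (f p) (curvature gM (f p) (mfderiv (𝓡 m) (𝓡 (m + 1)) f p (T p))
        (mfderiv (𝓡 m) (𝓡 (m + 1)) f p (e p μ)) (mfderiv (𝓡 m) (𝓡 (m + 1)) f p (e p μ)))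
        (mfderiv (𝓡 m) (𝓡 (m + 1)) f p (T p)) := by
    intro μ
    have hs : scalarFF gS gM f ν p (T p) (e p μ) = scalarFF gS gM f ν p (e p μ) (T p) := by
      rw [scalarFF, Ψ.secondFF_symm hf, scalarFF]
    rw [pullback_form, Ψ.normSq_II_pullback hf hν (he p), Ψ.normSq_II_pullback hf hν (he p),
      Ψ.inner_curvature, hs]
    ring
  rw [Finset.sum_congr rfl fun μ _ ↦ h1 μ]
  simp only [curvatureIntegrand, Φ.normSq_II_pullback_of_antisymm hF hanti, hΨ]
  simp only [Finset.sum_sub_distrib, Finset.sum_add_distrib, ← Finset.sum_mul, add_mul]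
  -- Minimality removes the products with the trace of the second fundamental form.
  rw [(Φ.pullback hF).sum_scalarFF_self hf hmin (he p)]
  ring

end Flattening

end Integrands

end TraceFormula

end

/-! ### The trace formula. -/

theorem mainTheorem5 {m k : ℕ} {S M N : Type*}
    -- the closed hypersurface `Σ`, of dimension `n - 1 = m`
    [TopologicalSpace S] [ChartedSpace (Euc m) S] [IsManifold (𝓡 m) ∞ S]
    [T2Space S] [CompactSpace S] [MeasurableSpace S] [BorelSpace S]
    -- the Riemannian manifold `M`, of dimension `n = m + 1`
    [TopologicalSpace M] [ChartedSpace (Euc (m + 1)) M] [IsManifold (𝓡 (m + 1)) ∞ M]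
    [T2Space M] [SecondCountableTopology M]
    -- the compact semi-simple Riemannian symmetric space `N`, of dimension `n + k`
    [TopologicalSpace N] [ChartedSpace (Euc (m + 1 + k)) N] [IsManifold (𝓡 (m + 1 + k)) ∞ N]
    [T2Space N] [CompactSpace N] [ConnectedSpace N]
    (gS : Metric m S) (gM : Metric (m + 1) M) (gN : Metric (m + 1 + k) N)
    (hN : IsSemisimpleRSS gN)
    (F : M → N) (hF : IsIsometricImmersion gM gN F)
    (f : S → M) (hf : IsIsometricImmersion gS gM f) (hmin : IsMinimal gS gM f)
    (ν : ∀ p : S, TangentSpace (𝓡 (m + 1)) (f p)) (hν : IsUnitNormal (m := m) gM f ν)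
    (α : OneForm m S) (hα : IsHarmonic gS α)
    -- an orthonormal basis of every tangent space of `Σ`
    (e : ∀ p : S, Fin m → TangentSpace (𝓡 m) p) (he : ∀ p, IsOrthonormalAt gS p (e p))
    -- an orthonormal basis of `∧²𝔤`
    {ι : Type*} [Fintype ι] [DecidableEq ι]
    (v : Module.Basis ι ℝ (⋀[ℝ]^2 (IsometryAlgebra gN)))
    (hv : ∀ a b, wedgeForm (lieInner gN) (v a) (v b) = if a = b then 1 else 0) :
    (∀ a, Integrable (indexDensity gS gM f (testVariation gN F f ν (sharpForm gS α) (v a))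
      (testVariation gN F f ν (sharpForm gS α) (v a))) (riemannianMeasure gS)) ∧
    Integrable (curvatureIntegrand gS gM gN F f ν (sharpForm gS α) e) (riemannianMeasure gS) ∧
    Integrable (secondFFIntegrand gS gM gN F f ν (sharpForm gS α) e) (riemannianMeasure gS) ∧
    ∑ a, testForm gS gM gN F f ν (sharpForm gS α) (v a) (v a) =
      ∫ p, curvatureIntegrand gS gM gN F f ν (sharpForm gS α) e p ∂(riemannianMeasure gS) ∧
    ∑ a, testForm gS gM gN F f ν (sharpForm gS α) (v a) (v a) =
      ∫ p, secondFFIntegrand gS gM gN F f ν (sharpForm gS α) e p ∂(riemannianMeasure gS) := by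
  obtain ⟨D, Φ, κ, hκ, hJ, hanti⟩ := hN.exists_flattening (by omega)
  have hdens : ∀ a, Integrable (indexDensity gS gM f
      (testVariation gN F f ν (sharpForm gS α) (v a))
      (testVariation gN F f ν (sharpForm gS α) (v a))) (riemannianMeasure gS) := fun a ↦
    integrable_of_continuous gS ((Φ.pullback hF).continuous_indexDensity_smul_normal hf hν he
      (Φ.contMDiff_testFunction hF hf hν (sharpField gS α) hκ hJ (v a)))
  have hsmooth : ContMDiff (𝓡 m) 𝓘(ℝ) ∞
      (fun q ↦ (1 / 2) * gS.inner q (sharpField gS α q) (sharpField gS α q)) :=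
    contMDiff_const.mul (contMDiff_metric_apply gS _ _)
  have hlap := integrable_of_continuous gS
    (continuous_laplacian ((Φ.pullback hF).pullback hf) hsmooth)
  have hsum := Φ.sum_indexDensity_eq hF hf hν hκ hJ hanti hv hmin hα he
  -- The frame `e` may depend on `p` in a non-measurable way, so the integrability of the integrand
  -- is read off from this identity with continuous functions.
  have hcurv : curvatureIntegrand gS gM gN F f ν (sharpForm gS α) e = fun p ↦
      ∑ a, indexDensity gS gM f (testVariation gN F f ν (sharpForm gS α) (v a))
        (testVariation gN F f ν (sharpForm gS α) (v a)) p -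
      laplacian gS (fun q ↦ (1 / 2) * gS.inner q (sharpField gS α q) (sharpField gS α q)) p :=
    funext fun p ↦ eq_sub_of_add_eq' (hsum p).symm
  have hsumint := integrable_finsetSum Finset.univ fun a _ ↦ hdens a
  have hint : Integrable (curvatureIntegrand gS gM gN F f ν (sharpForm gS α) e)
      (riemannianMeasure gS) := by
    rw [hcurv]
    exact hsumint.sub hlap
  have heq : ∑ a, testForm gS gM gN F f ν (sharpForm gS α) (v a) (v a) =
      ∫ p, curvatureIntegrand gS gM gN F f ν (sharpForm gS α) e p ∂(riemannianMeasure gS) := by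
    -- The Laplacian of `½|ω|²` contributes nothing to the integral over the closed manifold `Σ`.
    rw [hcurv, integral_sub hsumint hlap,
      integral_laplacian ((Φ.pullback hF).pullback hf) hsmooth, sub_zero,
      integral_finsetSum _ fun a _ ↦ hdens a]
    rfl
  have hsecond := Φ.curvatureIntegrand_eq_secondFFIntegrand hF hf hν (sharpForm gS α) he
  exact ⟨hdens, hint, hsecond ▸ hint, heq, hsecond ▸ heq⟩
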